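/- \textbf{Theorem.} Let $\xi,\eta\in \mathrm{SL}(2,\mathbb R)$ and suppose that the commutator $\gamma:=\xi\eta\xi^{-1}\eta^{-1}$ is elliptic, i.e. $|\operatorname{tr}\gamma|<2$. Let $\theta := 2\arccos(-\tfrac12\operatorname{tr}\gamma)\in(0,2\pi)$ be its rotation angle. ($\gamma$ rotates the hyperbolic plane $\mathbf H^2$ about its fixed point by the angle $\theta$, counterclockwise or clockwise; of the two values in $(0,2\pi)$ with this property, $\theta$ is the one with $\operatorname{tr}\gamma=-2\cos(\theta/2)$.) Let $\bar M=\mathbb R^2/\mathbb Z^2$ be the closed torus and $M=\bar M\setminus\{0\}$ the one-holed (punctured) torus. Its fundamental group based at $(\tfrac12,\tfrac12)$ is freely generated by the classes $X,Y$ of the loops $t\mapsto(\tfrac12+t,\tfrac12)$ and $t\mapsto(\tfrac12,\tfrac12+t)$, and $K=XYX^{-1}Y^{-1}$ is the class of a loop around the puncture; products of loops are read from left to right. Then there is a singular hyperbolic structure on $\bar M$ with one singularity, a cone point at $0$ of cone angle $\theta$, whose holonomy representation lifts to the homomorphism $\rho:\pi_1(M)\to\mathrm{SL}(2,\mathbb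 R)$ with $$\rho(X)=\xi,\qquad \rho(Y)=\eta,\qquad \rho(K)=\gamma .$$ Here a singular hyperbolic structure with a cone point of angle $\theta$ at $0$ is an atlas of charts $M\to\mathbf H^2$ whose changes of charts are locally restrictions of orientation-preserving isometries of $\mathbf H^2$ (no compatibility with a given orientation of $\bar M$ is required), such that a neighbourhood of $0$ in $\bar M$ is homeomorphic to a ball about the apex of the hyperbolic cone of angle $\theta$, by a homeomorphism that takes $0$ to the apex and is a local isometry elsewhere. The cone is the set of pairs $(r,\varphi)$, $r\ge 0$, $\varphi\in\mathbb R/\theta\mathbb Z$, with $\{r=0\}$ collapsed to a point and with the metric of $\mathbf H^2$ in geodesic polar coordinates $(r,\varphi)$. That the holonomy lifts to $\rho$ means that there is a chart $e_0$ at the base point whose continuation along every loop in the class $w$ leads to $\rho(w)\circ e_0$, for all $w\in\pi_1(M)$. -/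

import Mathlib

open scoped MatrixGroups Topology UpperHalfPlane

noncomputable section

/-! ### Elliptic elements and hyperbolic polar coordinates -/

/-- `γ ∈ SL(2, ℝ)` is elliptic (i.e. `|tr γ| < 2`, so that it rotates the hyperbolic plane about a
unique fixed point) with rotation angle `θ = 2 arccos (-(tr γ) / 2) ∈ (0, 2π)`. -/
def IsEllipticWithAngle (γ : SL(2, ℝ)) (θ : ℝ) : Prop :=
  |(γ : Matrix (Fin 2) (Fin 2) ℝ).trace| < 2 ∧
    θ = 2 * Real.arccos (-(γ : Matrix (Fin 2) (Fin 2) ℝ).trace / 2)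

/-- The matrix acting on the upper half-plane as the counterclockwise rotation by the angle `φ`
about the point `i`. -/
def rotationAboutI (φ : ℝ) : SL(2, ℝ) :=
  ⟨!![Real.cos (φ / 2), Real.sin (φ / 2); -Real.sin (φ / 2), Real.cos (φ / 2)], by
    rw [Matrix.det_fin_two_of]
    linarith [Real.sin_sq_add_cos_sq (φ / 2), sq (Real.sin (φ / 2)), sq (Real.cos (φ / 2))]⟩

/-- The point of the upper half-plane with geodesic polar coordinates `(r, φ)` about `i`: the
rotation by `φ` of the point `i e ^ r`, which lies at hyperbolic distance `r ≥ 0` from `i`. -/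
def hypPolar (q : ℝ × ℝ) : ℍ :=
  rotationAboutI q.2 • (⟨(Real.exp q.1 : ℂ) * Complex.I, by
    rw [Complex.im_ofReal_mul, Complex.I_im, mul_one]; exact Real.exp_pos _⟩ : ℍ)

/-! ### Hyperbolic structures -/

/-- The property of being locally the restriction of an orientation-preserving isometry of the
hyperbolic plane. -/
def hypPregroupoid : Pregroupoid ℍ where
  property f u := ∀ x ∈ u, ∃ g : SL(2, ℝ), ∀ᶠ y in 𝓝 x, f y = g • y
  comp := by
    intro f g u v hf hg hu hv huv x hx
    obtain ⟨a, ha⟩ := hf x hx.1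
    obtain ⟨b, hb⟩ := hg (f x) hx.2
    refine ⟨b * a, ?_⟩
    have hfx : f x = a • x := ha.self_of_nhds
    have hc : ContinuousAt f x := by
      have h1 : Continuous fun y : ℍ => a • y := continuous_const_smul a
      exact h1.continuousAt.congr (ha.mono fun y hy => hy.symm)
    filter_upwards [ha, hc.eventually hb] with y hy hy'
    rw [Function.comp_apply, hy', hy, mul_smul]
  id_mem := fun x _ => ⟨1, Filter.Eventually.of_forall fun y => (one_smul _ y).symm⟩
  locality := by
    intro f u hu h x hx
    obtain ⟨v, _, hxv, hf⟩ := h x hx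
    exact hf x ⟨hx, hxv⟩
  congr := by
    intro f g u hu hfg hf x hx
    obtain ⟨a, ha⟩ := hf x hx
    refine ⟨a, ?_⟩
    filter_upwards [ha, hu.mem_nhds hx] with y hy hyu
    rw [hfg y hyu, hy]

/-- The structure groupoid on the hyperbolic plane of local homeomorphisms that are locally
restrictions of orientation-preserving isometries. A hyperbolic structure on a surface `M` is a
`ChartedSpace ℍ M` whose changes of charts lie in this groupoid. -/
def hypGroupoid : StructureGroupoid ℍ := hypPregroupoid.groupoid

/-- The hyperbolic structure on `T ∖ {c}` extends over `c` as a conical singularity of cone angle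
`θ`. The map `P` is a chart in geodesic polar coordinates: it induces a homeomorphism from the
open ball of radius `R` about the apex of the hyperbolic cone of angle `θ`, that is, of
`[0, R) × ℝ` with `{0} × ℝ` collapsed to the apex and `(r, φ)` identified with `(r, φ + θ)`, onto
an open neighbourhood of `c`, sending the apex to `c`, and away from the apex it is a local
isometry for the hyperbolic metric of the cone. -/
def HasConePoint {T : Type*} [TopologicalSpace T] (c : T) [ChartedSpace ℍ {x : T // x ≠ c}]
    (θ : ℝ) : Prop :=
  ∃ (R : ℝ) (P : ℝ × ℝ → T), 0 < R ∧
    ContinuousOn P (Set.Ico 0 R ×ˢ Set.univ) ∧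
    (∀ φ, P (0, φ) = c) ∧
    (∀ r ∈ Set.Ioo 0 R, ∀ φ, P (r, φ) ≠ c) ∧
    (∀ r ∈ Set.Ioo 0 R, ∀ s ∈ Set.Ioo 0 R, ∀ φ ψ,
      P (r, φ) = P (s, ψ) ↔ r = s ∧ ∃ k : ℤ, ψ = φ + k * θ) ∧
    (∀ ε ∈ Set.Ioc 0 R, IsOpen (P '' (Set.Ico 0 ε ×ˢ Set.univ))) ∧
    (∀ r ∈ Set.Ioo 0 R, ∀ φ, ∀ e ∈ hypGroupoid.maximalAtlas {x : T // x ≠ c},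
      (∃ h : P (r, φ) ≠ c, (⟨P (r, φ), h⟩ : {x : T // x ≠ c}) ∈ e.source) →
      ∃ g : SL(2, ℝ), ∀ᶠ q in 𝓝 (r, φ), ∃ h : P q ≠ c, e ⟨P q, h⟩ = g • hypPolar q)

/-- A singular hyperbolic structure on the surface `T` with a single singularity, a cone point `c`
of cone angle `θ`. -/
structure SingularHyperbolicStructure (T : Type*) [TopologicalSpace T] (c : T) (θ : ℝ) where
  /-- the atlas of hyperbolic charts on the complement of the cone point -/
  chartedSpace : ChartedSpace ℍ {x : T // x ≠ c}
  hasGroupoid : HasGroupoid {x : T // x ≠ c} hypGroupoid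
  hasConePoint : HasConePoint c θ

/-! ### Holonomy -/

/-- Continuing the hyperbolic chart `e₀` at `x` along the loop `γ` leads to the chart `g • e₀`. -/
def HolonomyAlong {M : Type*} [TopologicalSpace M] [ChartedSpace ℍ M] {x : M}
    (e₀ : OpenPartialHomeomorph M ℍ) (γ : Path x x) (g : SL(2, ℝ)) : Prop :=
  ∃ e : unitInterval → OpenPartialHomeomorph M ℍ,
    e 0 = e₀ ∧
    (∀ t, e t ∈ hypGroupoid.maximalAtlas M ∧ γ t ∈ (e t).source) ∧
    (∀ t, ∀ᶠ s in 𝓝 t, ∀ᶠ y in 𝓝 (γ s), e s y = e t y) ∧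
    (∀ᶠ y in 𝓝 x, e 1 y = g • e₀ y)

/-- The representation `ρ` of `Π` is (a lift to `SL(2, ℝ)` of) the holonomy representation of a
hyperbolic surface `M`, where `π` is mapped to the fundamental group of `M` by the marking `m`. The
product in the fundamental group is taken such that `a * b` is first `a`, then `b`, whence the
opposite of the multiplication of `FundamentalGroup`. -/
def IsHolonomy {M : Type*} [TopologicalSpace M] [ChartedSpace ℍ M] {x : M}
    {π : Type*} [Group π] (m : π →* (FundamentalGroup M x)ᵐᵒᵖ) (ρ : π →* SL(2, ℝ)) : Prop :=
  ∃ e₀ ∈ hypGroupoid.maximalAtlas M, x ∈ e₀.source ∧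
    ∀ (w : π) (γ : Path x x),
      m w = MulOpposite.op (FundamentalGroup.fromPath (Path.Homotopic.Quotient.mk γ)) →
      HolonomyAlong e₀ γ (ρ w)

/-! ### The torus and its one-holed torus -/

/-- The closed torus `ℝ² / ℤ²`. -/
abbrev Torus : Type := UnitAddCircle × UnitAddCircle

/-- The torus with the point `0` removed. -/
abbrev PuncturedTorus : Type := {x : Torus // x ≠ 0}

lemma half_ne_zero_unitAddCircle : (((1 / 2 : ℝ) : UnitAddCircle)) ≠ 0 := by
  intro h
  obtain ⟨n, hn⟩ := (AddCircle.coe_eq_zero_iff (1 : ℝ)).1 h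
  simp only [zsmul_eq_mul, mul_one] at hn
  have h2 : (2 * n : ℤ) = 1 := by
    have : (2 * n : ℝ) = 1 := by rw [hn]; norm_num
    exact_mod_cast this
  omega

/-- The base point, the centre of the unit square. -/
def torusBase : PuncturedTorus :=
  ⟨(((1 / 2 : ℝ) : UnitAddCircle), ((1 / 2 : ℝ) : UnitAddCircle)),
    fun h => half_ne_zero_unitAddCircle (congrArg Prod.fst h)⟩

/-- The loop `t ↦ (1/2 + t, 1/2)`. -/
def torusLoopX : Path torusBase torusBase where
  toFun t := ⟨(((1 / 2 + (t : ℝ) : ℝ) : UnitAddCircle), ((1 / 2 : ℝ) : UnitAddCircle)),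
    fun h => half_ne_zero_unitAddCircle (congrArg Prod.snd h)⟩
  continuous_toFun := by
    refine Continuous.subtype_mk (Continuous.prodMk ?_ continuous_const) _
    exact (AddCircle.continuous_mk' (1 : ℝ)).comp (by fun_prop)
  source' := by simp [torusBase]
  target' := by simp [torusBase]

/-- The loop `t ↦ (1/2, 1/2 + t)`. -/
def torusLoopY : Path torusBase torusBase where
  toFun t := ⟨(((1 / 2 : ℝ) : UnitAddCircle), ((1 / 2 + (t : ℝ) : ℝ) : UnitAddCircle)),
    fun h => half_ne_zero_unitAddCircle (congrArg Prod.fst h)⟩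
  continuous_toFun := by
    refine Continuous.subtype_mk (Continuous.prodMk continuous_const ?_) _
    exact (AddCircle.continuous_mk' (1 : ℝ)).comp (by fun_prop)
  source' := by simp [torusBase]
  target' := by simp [torusBase]

/-- The free group on `X` and `Y`. -/
abbrev TorusGroup : Type := FreeGroup (Fin 2)

/-- The generator `X`. -/
def genX : TorusGroup := FreeGroup.of 0

/-- The generator `Y`. -/
def genY : TorusGroup := FreeGroup.of 1

/-- The boundary element `K = [X, Y]`, which is the class of a loop around the puncture. -/
def genK : TorusGroup := genX * genY * genX⁻¹ * genY⁻¹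

/-- The identification of the free group on `X, Y` with the fundamental group of the punctured
torus, which takes `X` and `Y` to the classes of the two loops above. -/
def torusMarking : TorusGroup →* (FundamentalGroup PuncturedTorus torusBase)ᵐᵒᵖ :=
  FreeGroup.lift
    ![MulOpposite.op (FundamentalGroup.fromPath (Path.Homotopic.Quotient.mk torusLoopX)),
      MulOpposite.op (FundamentalGroup.fromPath (Path.Homotopic.Quotient.mk torusLoopY))]

/-- `ρ` is (a lift to `SL(2, ℝ)` of) the holonomy representation of the singular hyperbolic
structure `S` on the torus. -/
def SingularHyperbolicStructure.HasHolonomy {θ : ℝ}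
    (S : SingularHyperbolicStructure Torus 0 θ) (ρ : TorusGroup →* SL(2, ℝ)) : Prop :=
  letI := S.chartedSpace
  IsHolonomy torusMarking ρ

end

/-! The torus is glued from a hyperbolic parallelogram that is read off from half-turns. The bracket
`ξη - ηξ` has trace zero and determinant `2 - tr γ > 0`, so a multiple of it is a half-turn `J`
about a point `j`. Since `J⁻¹ξ` and `J⁻¹η` have trace zero as well, they are up to sign half-turns
`M`, `N` about points `m`, `n`; thus `ξ = ±JM` and `η = ±JN` (`exists_commuting_half_turn`).
Fricke's trace identity becomes `tr γ = 2 - 4D`, where `D` is the Gram determinant of the unit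
vectors of `m`, `n`, `j` in the hyperboloid model (`exists_midpointTriple`). Ellipticity is
therefore `0 < D < 1`: `D > 0` says that the three points are not collinear, and `D < 1` that the
lines that are to carry the left and the bottom side meet, in a vertex `A`.

The points `A`, `NA`, `JA`, `MA` are the corners of a convex parallelogram `P` with centre `j`. The
side pairings are `JM` (left to right) and `JN` (bottom to top). All corners become one point of the
torus. The copies `P` and `M(P)` fill half of the angle around it: at `A` they span the wedge from
the bottom side of `P` to its image under `MJN`, which is a rotation about `A` by `θ/2 < π`.

The geometry is linear algebra in the basis `m`, `n`, `j`: half-turns are explicit linear maps,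
sides are kernels of linear forms, and `P` has a bilinear parametrisation `quad` on which the
half-turns act by symmetries of the unit square. Its extension `strip` to `P ∪ M(P)` is a
homeomorphism onto its image (`injOn_strip`, `isOpen_strip_image`).

Three charts cover the punctured torus, and they differ by `ρ` of a cocycle with values in the free
group (`eventually_smul_chart_eq`). The same cocycle glues a covering in which a loop of class `w`
lifts to a path from `1` to `w` (`exists_lift_of_torusMarking_eq`), so continuing a chart along a
loop amounts to following this lift (`isHolonomy`). Only the action of `ρ` on the plane enters,
hence the signs in `ξ = ±JM`, `η = ±JN` are harmless.

For the cone point, a small sector of angle `θ/2` in polar coordinates about `A` is lifted through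
`strip` to the plane over the torus. The other half of the cone is supplied by the point reflection
`-1` of the torus, which is an isometry (`coneLift`, `hasConePoint`). -/

noncomputable section

/-! ### The hyperboloid model -/

/-- The polarisation of the determinant of the symmetric matrix `!![p, q; q, r]`, which is
written as the vector `(p, q, r)`. -/
def hypForm (v w : ℝ × ℝ × ℝ) : ℝ := (v.1 * w.2.2 + v.2.2 * w.1) / 2 - v.2.1 * w.2.1

/-- The cone of positive definite symmetric matrices. -/
def posCone : Set (ℝ × ℝ × ℝ) := {v | 0 < v.2.2 ∧ 0 < hypForm v v}

/-- The positive definite symmetric matrix of determinant one that represents a point. -/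
def symVec (z : ℍ) : ℝ × ℝ × ℝ := ((z.re ^ 2 + z.im ^ 2) / z.im, z.re / z.im, 1 / z.im)

/-- The point represented by a positive definite symmetric matrix. -/
def ofVec (v : ℝ × ℝ × ℝ) : ℍ :=
  if h : 0 < √(hypForm v v) / v.2.2 then ⟨⟨v.2.1 / v.2.2, √(hypForm v v) / v.2.2⟩, h⟩
  else UpperHalfPlane.I

/-- The action `S ↦ g S gᵀ` of `SL(2, ℝ)` on symmetric matrices. -/
def vecAct (g : SL(2, ℝ)) : (ℝ × ℝ × ℝ) →ₗ[ℝ] (ℝ × ℝ × ℝ) where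
  toFun v := (g 0 0 ^ 2 * v.1 + 2 * (g 0 0 * g 0 1) * v.2.1 + g 0 1 ^ 2 * v.2.2,
    g 0 0 * g 1 0 * v.1 + (g 0 0 * g 1 1 + g 0 1 * g 1 0) * v.2.1 + g 0 1 * g 1 1 * v.2.2,
    g 1 0 ^ 2 * v.1 + 2 * (g 1 0 * g 1 1) * v.2.1 + g 1 1 ^ 2 * v.2.2)
  map_add' v w := by
    ext <;> simp <;> ring
  map_smul' t v := by
    ext <;> simp <;> ring

lemma SL2_det (g : SL(2, ℝ)) : g 0 0 * g 1 1 - g 0 1 * g 1 0 = 1 := by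
  have := g.det_coe
  rwa [Matrix.det_fin_two] at this

lemma hypForm_comm (v w : ℝ × ℝ × ℝ) : hypForm v w = hypForm w v := by
  unfold hypForm; ring

lemma hypForm_add_left (u v w : ℝ × ℝ × ℝ) : hypForm (u + v) w = hypForm u w + hypForm v w := by
  simp only [hypForm, Prod.fst_add, Prod.snd_add]; ring

lemma hypForm_smul_left (t : ℝ) (v w : ℝ × ℝ × ℝ) : hypForm (t • v) w = t * hypForm v w := by
  simp only [hypForm, Prod.smul_fst, Prod.smul_snd, smul_eq_mul]; ring

lemma hypForm_add_right (u v w : ℝ × ℝ × ℝ) : hypForm w (u + v) = hypForm w u + hypForm w v := by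
  simp only [hypForm, Prod.fst_add, Prod.snd_add]; ring

lemma hypForm_smul_right (t : ℝ) (v w : ℝ × ℝ × ℝ) : hypForm w (t • v) = t * hypForm w v := by
  simp only [hypForm, Prod.smul_fst, Prod.smul_snd, smul_eq_mul]; ring

/-- The form polarises the determinant, and `det (g S gᵀ) = (det g)² det S`. -/
lemma hypForm_vecAct (g : SL(2, ℝ)) (v w : ℝ × ℝ × ℝ) :
    hypForm (vecAct g v) (vecAct g w) = hypForm v w := by
  have h : hypForm (vecAct g v) (vecAct g w) =
      (g 0 0 * g 1 1 - g 0 1 * g 1 0) ^ 2 * hypForm v w := by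
    simp only [hypForm, vecAct, LinearMap.coe_mk, AddHom.coe_mk]; ring
  rw [h, SL2_det, one_pow, one_mul]

lemma vecAct_mul (g h : SL(2, ℝ)) (v : ℝ × ℝ × ℝ) : vecAct (g * h) v = vecAct g (vecAct h v) := by
  simp only [vecAct, LinearMap.coe_mk, AddHom.coe_mk, Matrix.SpecialLinearGroup.coe_mul,
    Matrix.mul_apply, Fin.sum_univ_two]
  ext <;> simp only <;> ring

lemma vecAct_neg (g : SL(2, ℝ)) (v : ℝ × ℝ × ℝ) : vecAct (-g) v = vecAct g v := by
  simp only [vecAct, LinearMap.coe_mk, AddHom.coe_mk, Matrix.SpecialLinearGroup.coe_neg,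
    Matrix.neg_apply]
  ext <;> simp only <;> ring

lemma vecAct_one (v : ℝ × ℝ × ℝ) : vecAct 1 v = v := by
  simp [vecAct]

lemma vecAct_vecAct_inv (g : SL(2, ℝ)) (v : ℝ × ℝ × ℝ) : vecAct g (vecAct g⁻¹ v) = v := by
  rw [← vecAct_mul, mul_inv_cancel, vecAct_one]

lemma hypForm_symVec (z : ℍ) : hypForm (symVec z) (symVec z) = 1 := by
  have := z.im_pos.ne'
  simp only [hypForm, symVec]; field_simp; ring

lemma symVec_mem (z : ℍ) : symVec z ∈ posCone :=
  ⟨one_div_pos.2 z.im_pos, by rw [hypForm_symVec]; exact one_pos⟩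

lemma smul_mem_posCone {t : ℝ} (ht : 0 < t) {v : ℝ × ℝ × ℝ} (hv : v ∈ posCone) :
    t • v ∈ posCone := by
  refine ⟨mul_pos ht hv.1, ?_⟩
  rw [hypForm_smul_left, hypForm_smul_right]
  exact mul_pos ht (mul_pos ht hv.2)

lemma posCone_fst_pos {v : ℝ × ℝ × ℝ} (hv : v ∈ posCone) : 0 < v.1 := by
  obtain ⟨h1, h2⟩ := hv
  unfold hypForm at h2
  by_contra h
  nlinarith [mul_nonneg (neg_nonneg.2 (not_lt.1 h)) h1.le, sq_nonneg v.2.1]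

/-- Reversed Cauchy–Schwarz inequality: each off-diagonal square is below the product of the
diagonal entries, and the mixed diagonal term is bounded below by the arithmetic–geometric mean
inequality. -/
lemma hypForm_pos {v w : ℝ × ℝ × ℝ} (hv : v ∈ posCone) (hw : w ∈ posCone) : 0 < hypForm v w := by
  have hv1 := posCone_fst_pos hv
  have hw1 := posCone_fst_pos hw
  obtain ⟨hv3, hv2⟩ := hv
  obtain ⟨hw3, hw2⟩ := hw
  unfold hypForm at *
  have h1 : v.2.1 ^ 2 * w.2.1 ^ 2 < (v.1 * v.2.2) * (w.1 * w.2.2) := by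
    apply mul_lt_mul'' <;> first | positivity | nlinarith
  have h2 : (v.2.1 * w.2.1) ^ 2 < ((v.1 * w.2.2 + v.2.2 * w.1) / 2) ^ 2 := by
    nlinarith [sq_nonneg (v.1 * w.2.2 - v.2.2 * w.1)]
  have := abs_lt_of_sq_lt_sq h2 (by positivity)
  linarith [(abs_lt.1 this).2]

/-- The form of two unit vectors is the hyperbolic cosine of the distance `1 + |z - w|² / (2 Im z Im
w)`. -/
lemma one_le_hypForm_symVec (z w : ℍ) : 1 ≤ hypForm (symVec z) (symVec w) := by
  have h1 := z.im_pos
  have h2 := w.im_pos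
  have : hypForm (symVec z) (symVec w) - 1
      = ((z.re - w.re) ^ 2 + (z.im - w.im) ^ 2) / (2 * z.im * w.im) := by
    simp only [hypForm, symVec]; field_simp; ring
  have h3 : 0 ≤ ((z.re - w.re) ^ 2 + (z.im - w.im) ^ 2) / (2 * z.im * w.im) := by positivity
  linarith

lemma add_mem_posCone {v w : ℝ × ℝ × ℝ} (hv : v ∈ posCone) (hw : w ∈ posCone) :
    v + w ∈ posCone := by
  refine ⟨add_pos hv.1 hw.1, ?_⟩
  rw [hypForm_add_left, hypForm_add_right, hypForm_add_right]
  linarith [hv.2, hw.2, hypForm_pos hv hw, hypForm_pos hw hv]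

/-- The vectors of positive norm form two opposite nappes, and the sign of the pairing with a vector
of `posCone` tells them apart. -/
lemma mem_posCone_of_hypForm_pos {v w : ℝ × ℝ × ℝ} (hw : w ∈ posCone) (hv : 0 < hypForm v v)
    (hvw : 0 < hypForm v w) : v ∈ posCone := by
  refine ⟨?_, hv⟩
  rcases lt_trichotomy v.2.2 0 with h | h | h
  · have hneg : (-1 : ℝ) • v ∈ posCone := by
      refine ⟨?_, ?_⟩
      · simp only [Prod.smul_snd, smul_eq_mul]; linarith
      · rw [hypForm_smul_left, hypForm_smul_right]; linarith
    have := hypForm_pos hneg hw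
    rw [hypForm_smul_left] at this
    linarith
  · unfold hypForm at hv
    rw [h] at hv
    nlinarith [sq_nonneg v.2.1]
  · exact h

lemma vecAct_mem_posCone (g : SL(2, ℝ)) {v : ℝ × ℝ × ℝ} (hv : v ∈ posCone) :
    vecAct g v ∈ posCone := by
  have hv1 := posCone_fst_pos hv
  obtain ⟨h3, h2⟩ := hv
  refine ⟨?_, by rwa [hypForm_vecAct]⟩
  simp only [vecAct, LinearMap.coe_mk, AddHom.coe_mk]
  have hd := SL2_det g
  unfold hypForm at h2
  have key : v.2.2 * (g 1 0 ^ 2 * v.1 + 2 * (g 1 0 * g 1 1) * v.2.1 + g 1 1 ^ 2 * v.2.2)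
      = (g 1 1 * v.2.2 + g 1 0 * v.2.1) ^ 2
        + g 1 0 ^ 2 * ((v.1 * v.2.2 + v.2.2 * v.1) / 2 - v.2.1 * v.2.1) := by ring
  have hpos : 0 < v.2.2 * (g 1 0 ^ 2 * v.1 + 2 * (g 1 0 * g 1 1) * v.2.1 + g 1 1 ^ 2 * v.2.2) := by
    rw [key]
    by_cases h : g 1 0 = 0
    · have h11 : g 1 1 ≠ 0 := by
        intro h'; rw [h, h'] at hd; simp at hd
      rw [h]; have := mul_ne_zero h11 h3.ne'; simp only [zero_mul, add_zero, zero_pow two_ne_zero]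
      positivity
    · positivity
  exact pos_of_mul_pos_right hpos h3.le

lemma sqrt_div_pos_of_mem {v : ℝ × ℝ × ℝ} (hv : v ∈ posCone) :
    0 < √(hypForm v v) / v.2.2 := div_pos (Real.sqrt_pos.2 hv.2) hv.1

lemma symVec_ofVec {v : ℝ × ℝ × ℝ} (hv : v ∈ posCone) :
    symVec (ofVec v) = (√(hypForm v v))⁻¹ • v := by
  have h3 := hv.1.ne'
  have hs := (Real.sqrt_pos.2 hv.2).ne'
  have hq := Real.sq_sqrt hv.2.le
  rw [ofVec, dif_pos (sqrt_div_pos_of_mem hv)]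
  ext
  · simp only [symVec, UpperHalfPlane.re, UpperHalfPlane.im, Prod.smul_fst, smul_eq_mul]
    field_simp
    rw [hq]; unfold hypForm; ring
  · simp only [symVec, UpperHalfPlane.re, UpperHalfPlane.im, Prod.smul_fst, Prod.smul_snd,
      smul_eq_mul]
    field_simp
  · simp only [symVec, UpperHalfPlane.im, Prod.smul_snd, smul_eq_mul]
    field_simp

lemma symVec_injective : Function.Injective symVec := by
  intro z w h
  simp only [symVec, Prod.mk.injEq] at h
  obtain ⟨-, h1, h2⟩ := h
  have hz := z.im_pos.ne'
  have hw := w.im_pos.ne'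
  have him : z.im = w.im := by field_simp at h2; exact h2.symm
  have hre : z.re = w.re := by rw [him] at h1; field_simp at h1; exact h1
  exact UpperHalfPlane.ext_re_im hre him

lemma ofVec_smul_symVec {t : ℝ} (ht : 0 < t) (z : ℍ) : ofVec (t • symVec z) = z := by
  apply symVec_injective
  rw [symVec_ofVec (smul_mem_posCone ht (symVec_mem z)), hypForm_smul_left, hypForm_smul_right,
    hypForm_symVec, mul_one, Real.sqrt_mul_self ht.le, smul_smul, inv_mul_cancel₀ ht.ne', one_smul]

lemma ofVec_symVec (z : ℍ) : ofVec (symVec z) = z := by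
  simpa using ofVec_smul_symVec one_pos z

lemma eq_smul_symVec_ofVec {v : ℝ × ℝ × ℝ} (hv : v ∈ posCone) :
    v = √(hypForm v v) • symVec (ofVec v) := by
  rw [symVec_ofVec hv, smul_smul, mul_inv_cancel₀ (Real.sqrt_pos.2 hv.2).ne', one_smul]

lemma ofVec_smul {t : ℝ} (ht : 0 < t) {v : ℝ × ℝ × ℝ} (hv : v ∈ posCone) :
    ofVec (t • v) = ofVec v := by
  conv_lhs => rw [eq_smul_symVec_ofVec hv, smul_smul]
  exact ofVec_smul_symVec (mul_pos ht (Real.sqrt_pos.2 hv.2)) _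

lemma ofVec_eq_iff {v w : ℝ × ℝ × ℝ} (hv : v ∈ posCone) (hw : w ∈ posCone) :
    ofVec v = ofVec w ↔ ∃ t : ℝ, 0 < t ∧ v = t • w := by
  constructor
  · intro h
    refine ⟨√(hypForm v v) / √(hypForm w w),
      div_pos (Real.sqrt_pos.2 hv.2) (Real.sqrt_pos.2 hw.2), ?_⟩
    conv_lhs => rw [eq_smul_symVec_ofVec hv, h, symVec_ofVec hw, smul_smul]
    rw [div_eq_mul_inv]
  · rintro ⟨t, ht, rfl⟩
    exact ofVec_smul ht hw

/-- Equivariance of the two models. Together with `symVec_injective` it turns equalities between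
points of the plane into polynomial identities. -/
lemma symVec_smul (g : SL(2, ℝ)) (z : ℍ) : symVec (g • z) = vecAct g (symVec z) := by
  have hz := z.im_pos
  have hd := SL2_det g
  have hN : 0 < (g 1 0 * z.re + g 1 1) ^ 2 + (g 1 0 * z.im) ^ 2 := by
    by_cases h : g 1 0 = 0
    · have h11 : g 1 1 ≠ 0 := by
        intro h'; rw [h, h'] at hd; simp at hd
      rw [h]; simp; positivity
    · positivity
  have hc : ((g • z : ℍ) : ℂ) = (g 0 0 * z + g 0 1) / (g 1 0 * z + g 1 1) := by
    simpa using UpperHalfPlane.coe_specialLinearGroup_apply g z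
  have hre : (g • z).re = ((g 0 0 * z.re + g 0 1) * (g 1 0 * z.re + g 1 1)
      + g 0 0 * g 1 0 * z.im ^ 2) / ((g 1 0 * z.re + g 1 1) ^ 2 + (g 1 0 * z.im) ^ 2) := by
    rw [← UpperHalfPlane.coe_re, hc, Complex.div_re]
    simp only [Complex.normSq_apply, Complex.add_re, Complex.mul_re, Complex.ofReal_re,
      Complex.ofReal_im, Complex.add_im, Complex.mul_im, UpperHalfPlane.coe_re,
      UpperHalfPlane.coe_im]
    rw [← add_div]; congr 1 <;> ring
  have him : (g • z).im = z.im / ((g 1 0 * z.re + g 1 1) ^ 2 + (g 1 0 * z.im) ^ 2) := by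
    rw [← UpperHalfPlane.coe_im, hc, Complex.div_im]
    simp only [Complex.normSq_apply, Complex.add_re, Complex.mul_re, Complex.ofReal_re,
      Complex.ofReal_im, Complex.add_im, Complex.mul_im, UpperHalfPlane.coe_re,
      UpperHalfPlane.coe_im]
    rw [← sub_div]; congr 1
    · linear_combination z.im * hd
    · ring
  simp only [symVec, vecAct, LinearMap.coe_mk, AddHom.coe_mk, hre, him]
  generalize hM : (g 1 0 * z.re + g 1 1) ^ 2 + (g 1 0 * z.im) ^ 2 = N at hN
  have hN' := hN.ne'
  have hz' := hz.ne'
  ext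
  · simp only
    field_simp
    -- Multiplicativity of the absolute value for `(az + b)` times the conjugate of `(cz + d)`,
    -- whose imaginary part is `Im z` because the determinant is one.
    have : (((g 0 0 * z.re + g 0 1) * (g 1 0 * z.re + g 1 1) + g 0 0 * g 1 0 * z.im ^ 2) ^ 2
        + z.im ^ 2) = N * ((g 0 0 * z.re + g 0 1) ^ 2 + (g 0 0 * z.im) ^ 2) := by
      rw [← hM]
      linear_combination (-z.im ^ 2 * (g 0 0 * g 1 1 - g 0 1 * g 1 0 + 1)) * hd
    linear_combination this
  · simp only
    field_simp; ring
  · simp only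
    field_simp; rw [← hM]; ring

lemma ofVec_vecAct (g : SL(2, ℝ)) {v : ℝ × ℝ × ℝ} (hv : v ∈ posCone) :
    ofVec (vecAct g v) = g • ofVec v := by
  apply symVec_injective
  rw [symVec_smul, symVec_ofVec hv, symVec_ofVec (vecAct_mem_posCone g hv), hypForm_vecAct,
    map_smul]

lemma continuous_symVec : Continuous symVec := by
  have h1 : Continuous fun z : ℍ => z.re := UpperHalfPlane.continuous_re
  have h2 : Continuous fun z : ℍ => z.im := UpperHalfPlane.continuous_im
  unfold symVec
  refine Continuous.prodMk ?_ (Continuous.prodMk ?_ ?_)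
  · exact ((h1.pow 2).add (h2.pow 2)).div h2 fun z => z.im_pos.ne'
  · exact h1.div h2 fun z => z.im_pos.ne'
  · exact continuous_const.div h2 fun z => z.im_pos.ne'

lemma continuous_hypForm : Continuous fun p : (ℝ × ℝ × ℝ) × (ℝ × ℝ × ℝ) => hypForm p.1 p.2 := by
  unfold hypForm; fun_prop

lemma continuousOn_ofVec : ContinuousOn ofVec posCone := by
  rw [UpperHalfPlane.isEmbedding_coe.continuousOn_iff]
  have : ContinuousOn (fun v : ℝ × ℝ × ℝ =>
      ((v.2.1 / v.2.2 : ℝ) : ℂ) + ((√(hypForm v v) / v.2.2 : ℝ) : ℂ) * Complex.I) posCone := by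
    have hq : Continuous fun v : ℝ × ℝ × ℝ => √(hypForm v v) :=
      (continuous_hypForm.comp (continuous_id.prodMk continuous_id)).sqrt
    have h1 : ContinuousOn (fun v : ℝ × ℝ × ℝ => v.2.1 / v.2.2) posCone :=
      ContinuousOn.div (by fun_prop) (by fun_prop) fun v hv => hv.1.ne'
    have h2 : ContinuousOn (fun v : ℝ × ℝ × ℝ => √(hypForm v v) / v.2.2) posCone :=
      ContinuousOn.div hq.continuousOn (by fun_prop) fun v hv => hv.1.ne'
    exact (Complex.continuous_ofReal.comp_continuousOn h1).add
      ((Complex.continuous_ofReal.comp_continuousOn h2).mul continuousOn_const)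
  refine this.congr fun v hv => ?_
  simp only [Function.comp_apply, ofVec, dif_pos (sqrt_div_pos_of_mem hv)]
  apply Complex.ext <;> simp

/-! ### Half-turns -/

/-- A matrix that acts as the half-turn about the point `z`. -/
def halfTurn (z : ℍ) : SL(2, ℝ) :=
  ⟨!![(symVec z).2.1, -(symVec z).1; (symVec z).2.2, -(symVec z).2.1], by
    have := hypForm_symVec z
    unfold hypForm at this
    rw [Matrix.det_fin_two_of]
    linarith⟩

/-- The half-turn is the linear map that fixes the vector of `z` and is `-1` on its orthogonal
complement, the tangent plane at `z`. -/
lemma vecAct_halfTurn (z : ℍ) (v : ℝ × ℝ × ℝ) :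
    vecAct (halfTurn z) v = -v + (2 * hypForm v (symVec z)) • symVec z := by
  have := hypForm_symVec z
  unfold hypForm at this
  simp only [vecAct, halfTurn, hypForm, LinearMap.coe_mk, AddHom.coe_mk, Matrix.of_apply,
    Matrix.cons_val', Matrix.cons_val_zero, Matrix.cons_val_one, Matrix.cons_val_fin_one]
  generalize symVec z = w at *
  ext
  · simp; linear_combination (-v.1) * this
  · simp; linear_combination (-v.2.1) * this
  · simp; linear_combination (-v.2.2) * this

/-- The entries of a traceless matrix of determinant one form a vector of norm one. It or its
negative lies in `posCone`, according to the sign of the lower left entry. -/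
lemma exists_halfTurn_of_trace_eq_zero (g : SL(2, ℝ)) (h : g 0 0 + g 1 1 = 0) :
    ∃ z : ℍ, g = halfTurn z ∨ g = -halfTurn z := by
  have hd := SL2_det g
  have h11 : g 1 1 = - g 0 0 := by linarith
  have h10 : g 1 0 ≠ 0 := by
    intro h'; rw [h', h11] at hd; nlinarith [sq_nonneg (g 0 0)]
  have hQ : hypForm (-g 0 1, g 0 0, g 1 0) (-g 0 1, g 0 0, g 1 0) = 1 := by
    simp only [hypForm]; rw [h11] at hd; linarith
  rcases lt_or_gt_of_ne h10 with h0 | h0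
  · have hmem : (g 0 1, -g 0 0, -g 1 0) ∈ posCone :=
      ⟨neg_pos.2 h0, by simp only [hypForm] at *; linarith⟩
    have hs : symVec (ofVec (g 0 1, -g 0 0, -g 1 0)) = (g 0 1, -g 0 0, -g 1 0) := by
      have hQ' : hypForm (g 0 1, -g 0 0, -g 1 0) (g 0 1, -g 0 0, -g 1 0) = 1 := by
        simp only [hypForm] at hQ ⊢; linarith
      rw [symVec_ofVec hmem, hQ']; simp
    refine ⟨ofVec (g 0 1, -g 0 0, -g 1 0), Or.inr ?_⟩
    ext i j
    rw [Matrix.SpecialLinearGroup.coe_neg, Matrix.neg_apply]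
    fin_cases i <;> fin_cases j <;> simp [halfTurn, hs, h11]
  · have hmem : (-g 0 1, g 0 0, g 1 0) ∈ posCone := ⟨h0, by rw [hQ]; exact one_pos⟩
    have hs : symVec (ofVec (-g 0 1, g 0 0, g 1 0)) = (-g 0 1, g 0 0, g 1 0) := by
      rw [symVec_ofVec hmem, hQ]; simp
    refine ⟨ofVec (-g 0 1, g 0 0, g 1 0), Or.inl ?_⟩
    ext i j
    fin_cases i <;> fin_cases j <;> simp [halfTurn, hs, h11]

lemma convex_posCone : Convex ℝ posCone := by
  intro v hv w hw s t hs ht hst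
  rcases hs.eq_or_lt with rfl | hs
  · have : t = 1 := by linarith
    simpa [this] using hw
  rcases ht.eq_or_lt with rfl | ht
  · have : s = 1 := by linarith
    simpa [this] using hv
  exact add_mem_posCone (smul_mem_posCone hs hv) (smul_mem_posCone ht hw)

/-! ### Parallelograms given by midpoints -/

/-- The centre `j` of a hyperbolic parallelogram together with the midpoints `m`, `n` of two
adjacent sides. The first condition says that they do not lie on a line, and the second that
the lines that are to contain the sides intersect. -/
structure MidpointTriple where
  /-- the midpoint of the left side -/
  m : ℍ
  /-- the midpoint of the bottom side -/
  n : ℍ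
  /-- the centre -/
  j : ℍ
  gram_pos : 0 < 1 + 2 * hypForm (symVec m) (symVec n) * hypForm (symVec j) (symVec n) *
    hypForm (symVec m) (symVec j) - hypForm (symVec m) (symVec n) ^ 2 -
    hypForm (symVec j) (symVec n) ^ 2 - hypForm (symVec m) (symVec j) ^ 2
  gram_lt_one : 1 + 2 * hypForm (symVec m) (symVec n) * hypForm (symVec j) (symVec n) *
    hypForm (symVec m) (symVec j) - hypForm (symVec m) (symVec n) ^ 2 -
    hypForm (symVec j) (symVec n) ^ 2 - hypForm (symVec m) (symVec j) ^ 2 < 1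

namespace MidpointTriple

/-- The hyperbolic cosine of the distance from `m` to `n`. -/
def a (T : MidpointTriple) : ℝ := hypForm (symVec T.m) (symVec T.n)

/-- The hyperbolic cosine of the distance from `j` to `n`. -/
def b (T : MidpointTriple) : ℝ := hypForm (symVec T.j) (symVec T.n)

/-- The hyperbolic cosine of the distance from `m` to `j`. -/
def c (T : MidpointTriple) : ℝ := hypForm (symVec T.m) (symVec T.j)

/-- The Gram determinant. -/
def gramDet (T : MidpointTriple) : ℝ :=
  1 + 2 * T.a * T.b * T.c - T.a ^ 2 - T.b ^ 2 - T.c ^ 2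

/-- Interchange of the two midpoints. -/
def swap (T : MidpointTriple) : MidpointTriple where
  m := T.n
  n := T.m
  j := T.j
  gram_pos := by
    have := T.gram_pos
    rw [hypForm_comm (symVec T.n) (symVec T.m), hypForm_comm (symVec T.n) (symVec T.j),
      hypForm_comm (symVec T.j) (symVec T.m)]
    linarith
  gram_lt_one := by
    have := T.gram_lt_one
    rw [hypForm_comm (symVec T.n) (symVec T.m), hypForm_comm (symVec T.n) (symVec T.j),
      hypForm_comm (symVec T.j) (symVec T.m)]
    linarith

variable (T : MidpointTriple)

lemma swap_a : T.swap.a = T.a := hypForm_comm _ _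

lemma swap_b : T.swap.b = T.c := hypForm_comm _ _

lemma swap_c : T.swap.c = T.b := hypForm_comm _ _

lemma gramDet_pos : 0 < T.gramDet := T.gram_pos

lemma gramDet_lt_one : T.gramDet < 1 := T.gram_lt_one

lemma one_le_a : 1 ≤ T.a := one_le_hypForm_symVec _ _

lemma one_le_b : 1 ≤ T.b := one_le_hypForm_symVec _ _

lemma one_le_c : 1 ≤ T.c := one_le_hypForm_symVec _ _

lemma a_pos : 0 < T.a := one_pos.trans_le T.one_le_a

lemma b_pos : 0 < T.b := one_pos.trans_le T.one_le_b

lemma c_pos : 0 < T.c := one_pos.trans_le T.one_le_c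

/-- Positivity of the Gram determinant reads `(a - bc)² < (b² - 1)(c² - 1)`, and the right-hand side
is less than `(bc)²`. The quantity `2bc - a` is the hyperbolic cosine of the distance from `n` to
the image of `m` under the half-turn about `j`. -/
lemma a_lt : T.a < 2 * T.b * T.c := by
  have h := T.gramDet_pos
  have hb := T.one_le_b
  have hc := T.one_le_c
  unfold gramDet at h
  have h2 : (T.a - T.b * T.c) ^ 2 < (T.b * T.c) ^ 2 := by nlinarith
  have := (abs_lt.1 (abs_lt_of_sq_lt_sq h2 (by positivity))).2
  linarith

/-- The vector with the given coordinates with respect to `m`, `n`, `j`. -/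
def toVec : (ℝ × ℝ × ℝ) →ₗ[ℝ] (ℝ × ℝ × ℝ) where
  toFun v := v.1 • symVec T.m + v.2.1 • symVec T.n + v.2.2 • symVec T.j
  map_add' v w := by simp only [Prod.fst_add, Prod.snd_add, add_smul]; abel
  map_smul' t v := by simp only [Prod.smul_fst, Prod.smul_snd, smul_eq_mul, mul_smul, smul_add,
    RingHom.id_apply]

/-- The form in the coordinates with respect to `m`, `n`, `j`. -/
def form (v w : ℝ × ℝ × ℝ) : ℝ :=
  v.1 * w.1 + v.2.1 * w.2.1 + v.2.2 * w.2.2 + T.a * (v.1 * w.2.1 + v.2.1 * w.1)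
    + T.b * (v.2.1 * w.2.2 + v.2.2 * w.2.1) + T.c * (v.1 * w.2.2 + v.2.2 * w.1)

lemma hypForm_toVec (v w : ℝ × ℝ × ℝ) : hypForm (T.toVec v) (T.toVec w) = T.form v w := by
  simp only [toVec, LinearMap.coe_mk, AddHom.coe_mk, hypForm_add_left, hypForm_add_right,
    hypForm_smul_left, hypForm_smul_right, hypForm_symVec, form, a, b, c]
  rw [hypForm_comm (symVec T.n) (symVec T.m), hypForm_comm (symVec T.n) (symVec T.j),
    hypForm_comm (symVec T.j) (symVec T.m)]
  ring

/-- A vector of the kernel is annihilated by the Gram matrix; the combinations below are the rows of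
the adjugate matrix. -/
lemma toVec_injective : Function.Injective T.toVec := by
  rw [← LinearMap.ker_eq_bot, LinearMap.ker_eq_bot']
  intro v hv
  have key : ∀ w, T.form v w = 0 := fun w => by
    rw [← T.hypForm_toVec, hv]; simp [hypForm]
  have h1 := key (1, 0, 0)
  have h2 := key (0, 1, 0)
  have h3 := key (0, 0, 1)
  simp only [form] at h1 h2 h3
  have hD := T.gramDet_pos.ne'
  have e1 : T.gramDet * v.1 = 0 := by
    unfold gramDet
    linear_combination (1 - T.b ^ 2) * h1 + (T.b * T.c - T.a) * h2 + (T.a * T.b - T.c) * h3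
  have e2 : T.gramDet * v.2.1 = 0 := by
    unfold gramDet
    linear_combination (T.b * T.c - T.a) * h1 + (1 - T.c ^ 2) * h2 + (T.a * T.c - T.b) * h3
  have e3 : T.gramDet * v.2.2 = 0 := by
    unfold gramDet
    linear_combination (T.a * T.b - T.c) * h1 + (T.a * T.c - T.b) * h2 + (1 - T.a ^ 2) * h3
  ext
  · exact (mul_eq_zero.1 e1).resolve_left hD
  · exact (mul_eq_zero.1 e2).resolve_left hD
  · exact (mul_eq_zero.1 e3).resolve_left hD

/-- The coordinates of a point with respect to `m`, `n`, `j`. -/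
def coords (z : ℍ) : ℝ × ℝ × ℝ :=
  (LinearEquiv.ofInjectiveEndo T.toVec T.toVec_injective).symm (symVec z)

lemma toVec_coords (z : ℍ) : T.toVec (T.coords z) = symVec z :=
  (LinearEquiv.ofInjectiveEndo T.toVec T.toVec_injective).apply_symm_apply (symVec z)

lemma continuous_coords : Continuous T.coords :=
  (LinearMap.continuous_of_finiteDimensional
    (LinearEquiv.ofInjectiveEndo T.toVec T.toVec_injective).symm.toLinearMap).comp
    continuous_symVec

lemma continuous_toVec : Continuous T.toVec := LinearMap.continuous_of_finiteDimensional _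

/-- The cone of positive vectors in coordinates. -/
def cone : Set (ℝ × ℝ × ℝ) := T.toVec ⁻¹' posCone

/-- The point represented by a positive vector. -/
def pt (v : ℝ × ℝ × ℝ) : ℍ := ofVec (T.toVec v)

lemma coords_mem (z : ℍ) : T.coords z ∈ T.cone := by
  rw [cone, Set.mem_preimage, toVec_coords]; exact symVec_mem z

lemma pt_coords (z : ℍ) : T.pt (T.coords z) = z := by
  rw [pt, toVec_coords, ofVec_symVec]

lemma convex_cone : Convex ℝ T.cone := convex_posCone.linear_preimage _

lemma smul_mem_cone {t : ℝ} (ht : 0 < t) {v : ℝ × ℝ × ℝ} (hv : v ∈ T.cone) : t • v ∈ T.cone := by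
  rw [cone, Set.mem_preimage, map_smul]; exact smul_mem_posCone ht hv

lemma continuousOn_pt : ContinuousOn T.pt T.cone :=
  continuousOn_ofVec.comp T.continuous_toVec.continuousOn fun _ h => h

lemma pt_smul {t : ℝ} (ht : 0 < t) {v : ℝ × ℝ × ℝ} (hv : v ∈ T.cone) : T.pt (t • v) = T.pt v := by
  rw [pt, map_smul, ofVec_smul ht hv, pt]

lemma pt_eq_iff {v w : ℝ × ℝ × ℝ} (hv : v ∈ T.cone) (hw : w ∈ T.cone) :
    T.pt v = T.pt w ↔ ∃ t : ℝ, 0 < t ∧ v = t • w := by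
  rw [pt, pt, ofVec_eq_iff hv hw]
  simp only [← map_smul, T.toVec_injective.eq_iff]

lemma coords_pt {v : ℝ × ℝ × ℝ} (hv : v ∈ T.cone) :
    ∃ t : ℝ, 0 < t ∧ T.coords (T.pt v) = t • v :=
  (T.pt_eq_iff (T.coords_mem _) hv).1 (T.pt_coords _)

/-- The expression in `hj` is the pairing with `j`, which selects the positive nappe. -/
lemma mem_cone_of_form_pos {v : ℝ × ℝ × ℝ} (hv : 0 < T.form v v)
    (hj : 0 < v.2.2 + T.b * v.2.1 + T.c * v.1) : v ∈ T.cone := by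
  have h0 : T.toVec (0, 0, 1) = symVec T.j := by simp [toVec]
  refine mem_posCone_of_hypForm_pos (symVec_mem T.j) (by rwa [hypForm_toVec]) ?_
  rw [← h0, hypForm_toVec]
  simp only [form]; linarith

/-! ### Half-turns in the basis `m`, `n`, `j`. -/

/-- The half-turn about `m` in coordinates. -/
def turnM : (ℝ × ℝ × ℝ) →ₗ[ℝ] (ℝ × ℝ × ℝ) where
  toFun v := (v.1 + 2 * T.a * v.2.1 + 2 * T.c * v.2.2, -v.2.1, -v.2.2)
  map_add' v w := by ext <;> simp <;> ring
  map_smul' t v := by ext <;> simp; ring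

/-- The half-turn about `n` in coordinates. -/
def turnN : (ℝ × ℝ × ℝ) →ₗ[ℝ] (ℝ × ℝ × ℝ) where
  toFun v := (-v.1, v.2.1 + 2 * T.a * v.1 + 2 * T.b * v.2.2, -v.2.2)
  map_add' v w := by ext <;> simp <;> ring
  map_smul' t v := by ext <;> simp; ring

/-- The half-turn about `j` in coordinates. -/
def turnJ : (ℝ × ℝ × ℝ) →ₗ[ℝ] (ℝ × ℝ × ℝ) where
  toFun v := (-v.1, -v.2.1, v.2.2 + 2 * T.c * v.1 + 2 * T.b * v.2.1)
  map_add' v w := by ext <;> simp <;> ring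
  map_smul' t v := by ext <;> simp; ring

lemma turnM_apply (v : ℝ × ℝ × ℝ) :
    T.turnM v = (v.1 + 2 * T.a * v.2.1 + 2 * T.c * v.2.2, -v.2.1, -v.2.2) := rfl

lemma turnN_apply (v : ℝ × ℝ × ℝ) :
    T.turnN v = (-v.1, v.2.1 + 2 * T.a * v.1 + 2 * T.b * v.2.2, -v.2.2) := rfl

lemma turnJ_apply (v : ℝ × ℝ × ℝ) :
    T.turnJ v = (-v.1, -v.2.1, v.2.2 + 2 * T.c * v.1 + 2 * T.b * v.2.1) := rfl

lemma turnM_turnM (v : ℝ × ℝ × ℝ) : T.turnM (T.turnM v) = v := by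
  ext <;> simp [turnM_apply]; ring

lemma turnJ_turnJ (v : ℝ × ℝ × ℝ) : T.turnJ (T.turnJ v) = v := by
  ext <;> simp [turnJ_apply]; ring

lemma vecAct_toVec_M (v : ℝ × ℝ × ℝ) : vecAct (halfTurn T.m) (T.toVec v) = T.toVec (T.turnM v) := by
  have h : symVec T.m = T.toVec (1, 0, 0) := by simp [toVec]
  rw [vecAct_halfTurn]
  conv_lhs => rw [h, hypForm_toVec, ← map_neg, ← map_smul, ← map_add]
  congr 1
  ext <;> simp [form, turnM_apply]; ring

lemma vecAct_toVec_N (v : ℝ × ℝ × ℝ) : vecAct (halfTurn T.n) (T.toVec v) = T.toVec (T.turnN v) := by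
  have h : symVec T.n = T.toVec (0, 1, 0) := by simp [toVec]
  rw [vecAct_halfTurn]
  conv_lhs => rw [h, hypForm_toVec, ← map_neg, ← map_smul, ← map_add]
  congr 1
  ext <;> simp [form, turnN_apply]; ring

lemma vecAct_toVec_J (v : ℝ × ℝ × ℝ) : vecAct (halfTurn T.j) (T.toVec v) = T.toVec (T.turnJ v) := by
  have h : symVec T.j = T.toVec (0, 0, 1) := by simp [toVec]
  rw [vecAct_halfTurn]
  conv_lhs => rw [h, hypForm_toVec, ← map_neg, ← map_smul, ← map_add]
  congr 1
  ext <;> simp [form, turnJ_apply]; ring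

variable {T} in
lemma turnM_mem {v : ℝ × ℝ × ℝ} (hv : v ∈ T.cone) : T.turnM v ∈ T.cone := by
  rw [cone, Set.mem_preimage, ← vecAct_toVec_M]; exact vecAct_mem_posCone _ hv

variable {T} in
lemma turnN_mem {v : ℝ × ℝ × ℝ} (hv : v ∈ T.cone) : T.turnN v ∈ T.cone := by
  rw [cone, Set.mem_preimage, ← vecAct_toVec_N]; exact vecAct_mem_posCone _ hv

variable {T} in
lemma turnJ_mem {v : ℝ × ℝ × ℝ} (hv : v ∈ T.cone) : T.turnJ v ∈ T.cone := by
  rw [cone, Set.mem_preimage, ← vecAct_toVec_J]; exact vecAct_mem_posCone _ hv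

variable {T} in
lemma pt_turnM {v : ℝ × ℝ × ℝ} (hv : v ∈ T.cone) : T.pt (T.turnM v) = halfTurn T.m • T.pt v := by
  rw [pt, ← vecAct_toVec_M, ofVec_vecAct _ hv, pt]

variable {T} in
lemma pt_turnN {v : ℝ × ℝ × ℝ} (hv : v ∈ T.cone) : T.pt (T.turnN v) = halfTurn T.n • T.pt v := by
  rw [pt, ← vecAct_toVec_N, ofVec_vecAct _ hv, pt]

variable {T} in
lemma pt_turnJ {v : ℝ × ℝ × ℝ} (hv : v ∈ T.cone) : T.pt (T.turnJ v) = halfTurn T.j • T.pt v := by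
  rw [pt, ← vecAct_toVec_J, ofVec_vecAct _ hv, pt]

lemma swap_pt (v : ℝ × ℝ × ℝ) : T.swap.pt (v.2.1, v.1, v.2.2) = T.pt v := by
  simp only [pt, toVec, swap, LinearMap.coe_mk, AddHom.coe_mk]
  rw [add_comm (v.2.1 • symVec T.n)]

/-! ### The bilinear parametrisation of the parallelogram -/

/-- A vector over the point with the given bilinear coordinates in the parallelogram. -/
def quad (x y : ℝ) : ℝ × ℝ × ℝ :=
  (T.b * (1 - 2 * x), T.c * (1 - 2 * y),
    4 * T.b * T.c * x * y - T.a * (1 - 2 * x) * (1 - 2 * y))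

/-- The linear form that vanishes on the bottom side. -/
def lBot (v : ℝ × ℝ × ℝ) : ℝ := T.a * v.1 + T.b * v.2.2

/-- The linear form that vanishes on the left side. -/
def lLeft (v : ℝ × ℝ × ℝ) : ℝ := T.a * v.2.1 + T.c * v.2.2

/-- The linear form that vanishes on the top side. -/
def lTop (v : ℝ × ℝ × ℝ) : ℝ := T.lBot (T.turnJ v)

/-- The linear form that vanishes on the right side. -/
def lRight (v : ℝ × ℝ × ℝ) : ℝ := T.lLeft (T.turnJ v)

lemma lBot_smul (t : ℝ) (v : ℝ × ℝ × ℝ) : T.lBot (t • v) = t * T.lBot v := by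
  simp [lBot]; ring

lemma lLeft_smul (t : ℝ) (v : ℝ × ℝ × ℝ) : T.lLeft (t • v) = t * T.lLeft v := by
  simp [lLeft]; ring

lemma lTop_smul (t : ℝ) (v : ℝ × ℝ × ℝ) : T.lTop (t • v) = t * T.lTop v := by
  rw [lTop, map_smul, lBot_smul, lTop]

lemma lRight_smul (t : ℝ) (v : ℝ × ℝ × ℝ) : T.lRight (t • v) = t * T.lRight v := by
  rw [lRight, map_smul, lLeft_smul, lRight]

lemma lLeft_turnM (v : ℝ × ℝ × ℝ) : T.lLeft (T.turnM v) = -T.lLeft v := by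
  simp [lLeft, turnM_apply]; ring

lemma lBot_turnN (v : ℝ × ℝ × ℝ) : T.lBot (T.turnN v) = -T.lBot v := by
  simp [lBot, turnN_apply]; ring

/-- `quad` interpolates bilinearly between `(b, c, -a)`, which spans the intersection of the left
and the bottom line, and its images under the half-turns. With these lengths of the corner vectors
the half-turns act on the vectors themselves, and not merely on rays, as symmetries of the unit
square. -/
lemma turnJ_quad (x y : ℝ) : T.turnJ (T.quad x y) = T.quad (1 - x) (1 - y) := by
  ext <;> simp [turnJ_apply, quad] <;> ring

lemma turnM_quad (y : ℝ) : T.turnM (T.quad 0 y) = T.quad 0 (1 - y) := by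
  ext <;> simp [turnM_apply, quad] <;> ring

lemma turnN_quad (x : ℝ) : T.turnN (T.quad x 0) = T.quad (1 - x) 0 := by
  ext <;> simp [turnN_apply, quad] <;> ring

/-- The last factor interpolates between the positive numbers `a` and `2bc - a`, so for `x` in the
unit interval the sign is that of `y`. The other three sides behave likewise. -/
lemma lBot_quad (x y : ℝ) :
    T.lBot (T.quad x y) = 2 * T.b * y * (T.a * (1 - x) + (2 * T.b * T.c - T.a) * x) := by
  simp only [lBot, quad]; ring

lemma lLeft_quad (x y : ℝ) :
    T.lLeft (T.quad x y) = 2 * T.c * x * (T.a * (1 - y) + (2 * T.b * T.c - T.a) * y) := by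
  simp only [lLeft, quad]; ring

lemma lTop_quad (x y : ℝ) : T.lTop (T.quad x y) =
    2 * T.b * (1 - y) * (T.a * x + (2 * T.b * T.c - T.a) * (1 - x)) := by
  rw [lTop, turnJ_quad, lBot_quad]; ring

lemma lRight_quad (x y : ℝ) : T.lRight (T.quad x y) =
    2 * T.c * (1 - x) * (T.a * y + (2 * T.b * T.c - T.a) * (1 - y)) := by
  rw [lRight, turnJ_quad, lLeft_quad]; ring

lemma interp_pos {x : ℝ} (hx : x ∈ Set.Icc (0 : ℝ) 1) :
    0 < T.a * (1 - x) + (2 * T.b * T.c - T.a) * x := by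
  have h1 := T.a_pos
  have h2 : 0 < 2 * T.b * T.c - T.a := sub_pos.2 T.a_lt
  rcases hx.1.eq_or_lt with h | h
  · rw [← h]; linarith
  · have := mul_pos h2 h
    have := mul_nonneg h1.le (sub_nonneg.2 hx.2)
    linarith

lemma interp_pos' {x : ℝ} (hx : x ∈ Set.Icc (0 : ℝ) 1) :
    0 < T.a * x + (2 * T.b * T.c - T.a) * (1 - x) := by
  have := T.interp_pos (x := 1 - x) ⟨by linarith [hx.2], by linarith [hx.1]⟩
  rwa [sub_sub_cancel] at this

/-- Convexity of the cone reduces this to the corners, and half-turns reduce the corners to one. -/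
lemma quad_mem {x y : ℝ} (hx : x ∈ Set.Icc (0 : ℝ) 1) (hy : y ∈ Set.Icc (0 : ℝ) 1) :
    T.quad x y ∈ T.cone := by
  have hA : T.quad 0 0 ∈ T.cone := by
    -- The vector `(b, c, -a)` has norm `1 - D`, where `D` is the Gram determinant, and its pairing
    -- with `j` is `2bc - a`.
    apply T.mem_cone_of_form_pos
    · have := T.gramDet_lt_one
      unfold gramDet at this
      simp only [form, quad]; nlinarith
    · have := T.a_lt
      simp only [quad]; nlinarith
  have hB : T.quad 1 0 ∈ T.cone := by
    have := turnN_mem hA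
    rwa [turnN_quad, sub_zero] at this
  have hD : T.quad 0 1 ∈ T.cone := by
    have := turnM_mem hA
    rwa [turnM_quad, sub_zero] at this
  have hC : T.quad 1 1 ∈ T.cone := by
    have := turnJ_mem hA
    rwa [turnJ_quad, sub_zero] at this
  have h0 : T.quad x 0 ∈ T.cone := by
    convert T.convex_cone hA hB (sub_nonneg.2 hx.2) hx.1 (sub_add_cancel 1 x) using 1
    ext <;> simp [quad] <;> ring
  have h1 : T.quad x 1 ∈ T.cone := by
    convert T.convex_cone hD hC (sub_nonneg.2 hx.2) hx.1 (sub_add_cancel 1 x) using 1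
    ext <;> simp [quad] <;> ring
  convert T.convex_cone h0 h1 (sub_nonneg.2 hy.2) hy.1 (sub_add_cancel 1 y) using 1
  ext <;> simp [quad] <;> ring

/-- The first two coordinates say that the centred parameters `(1 - 2x, 1 - 2y)` are scaled by `t`.
The third one then gives `(1 - t)(bc - (bc - a)tpq) = 0`; as `|tpq| ≤ 1`, the second factor lies
between `a` and `2bc - a`, so it is positive and `t = 1`. -/
lemma quad_injective {x y x' y' t : ℝ} (hx : x ∈ Set.Icc (0 : ℝ) 1) (hy : y ∈ Set.Icc (0 : ℝ) 1)
    (hx' : x' ∈ Set.Icc (0 : ℝ) 1) (hy' : y' ∈ Set.Icc (0 : ℝ) 1)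
    (h : T.quad x y = t • T.quad x' y') : x = x' ∧ y = y' := by
  have hb := T.b_pos
  have hc := T.c_pos
  have ha := T.a_pos
  have hlt := T.a_lt
  simp only [quad, Prod.smul_mk, smul_eq_mul, Prod.mk.injEq] at h
  obtain ⟨h1, h2, h3⟩ := h
  have e1 : 1 - 2 * x = t * (1 - 2 * x') := by
    apply mul_left_cancel₀ hb.ne'; linear_combination h1
  have e2 : 1 - 2 * y = t * (1 - 2 * y') := by
    apply mul_left_cancel₀ hc.ne'; linear_combination h2
  obtain ⟨p, hp⟩ : ∃ p, p = 1 - 2 * x' := ⟨_, rfl⟩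
  obtain ⟨q, hq⟩ : ∃ q, q = 1 - 2 * y' := ⟨_, rfl⟩
  have ex : x = (1 - t * p) / 2 := by rw [hp]; linarith
  have ey : y = (1 - t * q) / 2 := by rw [hq]; linarith
  have ex' : x' = (1 - p) / 2 := by linarith
  have ey' : y' = (1 - q) / 2 := by linarith
  obtain ⟨hx0, hx1⟩ := hx
  obtain ⟨hy0, hy1⟩ := hy
  obtain ⟨hx0', hx1'⟩ := hx'
  obtain ⟨hy0', hy1'⟩ := hy'
  have hp1 : |p| ≤ 1 := abs_le.2 ⟨by linarith, by linarith⟩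
  have hq1 : |q| ≤ 1 := abs_le.2 ⟨by linarith, by linarith⟩
  have htp1 : |t * p| ≤ 1 := abs_le.2 ⟨by linarith, by linarith⟩
  have htq1 : |t * q| ≤ 1 := abs_le.2 ⟨by linarith, by linarith⟩
  have hpq : |t * p * q| ≤ 1 := by
    rw [abs_mul]; exact mul_le_one₀ htp1 (abs_nonneg _) hq1
  subst ex ey ex' ey'
  have key : (1 - t) * (T.b * T.c - (T.b * T.c - T.a) * (t * p * q)) = 0 := by
    linear_combination h3
  have hne : T.b * T.c - (T.b * T.c - T.a) * (t * p * q) ≠ 0 := by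
    obtain ⟨g1, g2⟩ := abs_le.1 hpq
    have hbc := mul_pos hb hc
    apply ne_of_gt
    rcases le_total (T.b * T.c) T.a with h' | h' <;> nlinarith
  have ht1 : t = 1 := by
    have := (mul_eq_zero.1 key).resolve_right hne
    linarith
  rw [ht1]; simp

/-- For a given scale `t` the first two coordinates determine `x` and `y`, and the third becomes a
quadratic equation for `t`. The intermediate value theorem solves it between `t = 0` and the scale
at which `(x, y)` reaches the boundary of the unit square. -/
lemma exists_quad_eq {v : ℝ × ℝ × ℝ} (hv : v ∈ T.cone) (h1 : 0 ≤ T.lBot v) (h2 : 0 ≤ T.lLeft v)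
    (h3 : 0 ≤ T.lTop v) (h4 : 0 ≤ T.lRight v) :
    ∃ x ∈ Set.Icc (0 : ℝ) 1, ∃ y ∈ Set.Icc (0 : ℝ) 1, ∃ t : ℝ, 0 < t ∧ T.quad x y = t • v := by
  have hb := T.b_pos
  have hc := T.c_pos
  obtain ⟨X, Y, Z⟩ := v
  have hw : 0 < T.c * X + T.b * Y + Z := by
    have h0 : T.toVec (0, 0, 1) = symVec T.j := by simp [toVec]
    have := hypForm_pos hv (symVec_mem T.j)
    rw [← h0, hypForm_toVec] at this
    simp only [form] at this; linarith
  simp only [lBot, lLeft, lTop, lRight, turnJ_apply] at h1 h2 h3 h4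
  -- A quarter of the difference of the third coordinates after `x` and `y` have been eliminated.
  set g : ℝ → ℝ := fun t => T.b * T.c - t * (T.c * X + T.b * Y + Z)
    + t ^ 2 * (X * Y) * (1 - T.a / (T.b * T.c)) with hg
  suffices h : ∃ t : ℝ, 0 < t ∧ g t = 0 ∧ |t * X| ≤ T.b ∧ |t * Y| ≤ T.c by
    obtain ⟨t, ht, hgt, hX, hY⟩ := h
    obtain ⟨hX1, hX2⟩ := abs_le.1 hX
    obtain ⟨hY1, hY2⟩ := abs_le.1 hY
    refine ⟨(1 - t * X / T.b) / 2, ⟨?_, ?_⟩, (1 - t * Y / T.c) / 2, ⟨?_, ?_⟩, t, ht, ?_⟩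
    · have := (div_le_one hb).2 hX2; linarith
    · have : -1 ≤ t * X / T.b := by rw [le_div_iff₀ hb]; linarith
      linarith
    · have := (div_le_one hc).2 hY2; linarith
    · have : -1 ≤ t * Y / T.c := by rw [le_div_iff₀ hc]; linarith
      linarith
    · simp only [hg] at hgt
      ext
      · simp [quad]; field_simp; ring
      · simp [quad]; field_simp; ring
      · simp [quad]; field_simp at hgt ⊢; linear_combination 4 * hgt
  have hgc : Continuous g := by fun_prop
  have hg0 : 0 < g 0 := by simp only [hg]; simp; positivity
  have main : ∀ t₁ : ℝ, 0 < t₁ → g t₁ ≤ 0 → |t₁ * X| ≤ T.b → |t₁ * Y| ≤ T.c →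
      ∃ t : ℝ, 0 < t ∧ g t = 0 ∧ |t * X| ≤ T.b ∧ |t * Y| ≤ T.c := by
    intro t₁ ht₁ hg₁ hX hY
    obtain ⟨t, ⟨ht0, ht1⟩, hgt⟩ := intermediate_value_Icc' ht₁.le hgc.continuousOn ⟨hg₁, hg0.le⟩
    have htpos : 0 < t := by
      rcases ht0.eq_or_lt with h | h
      · rw [← h] at hgt; exact absurd hgt hg0.ne'
      · exact h
    refine ⟨t, htpos, hgt, ?_, ?_⟩
    · rw [abs_mul, abs_of_pos htpos]
      rw [abs_mul, abs_of_pos ht₁] at hX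
      exact (mul_le_mul_of_nonneg_right ht1 (abs_nonneg _)).trans hX
    · rw [abs_mul, abs_of_pos htpos]
      rw [abs_mul, abs_of_pos ht₁] at hY
      exact (mul_le_mul_of_nonneg_right ht1 (abs_nonneg _)).trans hY
  -- In this case the boundary is never reached; the point is the centre and the equation is linear.
  by_cases hXY : X = 0 ∧ Y = 0
  · obtain ⟨rfl, rfl⟩ := hXY
    have hZ : 0 < Z := by simpa using hw
    refine ⟨T.b * T.c / Z, by positivity, ?_, ?_, ?_⟩
    · simp only [hg]; field_simp; ring
    · simp [hb.le]
    · simp [hc.le]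
  rcases le_total (|Y| * T.b) (|X| * T.c) with hle | hle
  · have hX0 : 0 < |X| := by
      rcases (abs_nonneg X).eq_or_lt with h | h
      · exfalso; rw [← h, zero_mul] at hle
        have : |Y| = 0 := by nlinarith [abs_nonneg Y]
        exact hXY ⟨abs_eq_zero.1 h.symm, abs_eq_zero.1 this⟩
      · exact h
    -- At this scale `x` is `0` or `1`, and `g` is a negative multiple of the form of the left or
    -- the right side.
    refine main (T.b / |X|) (by positivity) ?_ ?_ ?_
    · rcases abs_choice X with h | h <;> rw [h] at hX0 ⊢
      · have : g (T.b / X) = -(T.b * (T.a * Y + T.c * Z)) / (T.c * X) := by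
          have := hX0.ne'
          simp only [hg]; field_simp; ring
        rw [this]
        exact div_nonpos_of_nonpos_of_nonneg (by nlinarith) (by positivity)
      · have hX1 : X ≠ 0 := by linarith
        have : g (T.b / -X) = -(T.b * (T.a * -Y + T.c * (Z + 2 * T.c * X + 2 * T.b * Y)))
            / (T.c * -X) := by
          simp only [hg]; field_simp; ring
        rw [this]
        exact div_nonpos_of_nonpos_of_nonneg (by nlinarith) (by positivity)
    · rw [abs_mul, abs_of_pos (show 0 < T.b / |X| by positivity), div_mul_cancel₀ _ hX0.ne']
    · rw [abs_mul, abs_of_pos (show 0 < T.b / |X| by positivity), div_mul_eq_mul_div,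
        div_le_iff₀ hX0]
      linarith
  · have hY0 : 0 < |Y| := by
      rcases (abs_nonneg Y).eq_or_lt with h | h
      · exfalso; rw [← h, zero_mul] at hle
        have : |X| = 0 := by nlinarith [abs_nonneg X]
        exact hXY ⟨abs_eq_zero.1 this, abs_eq_zero.1 h.symm⟩
      · exact h
    refine main (T.c / |Y|) (by positivity) ?_ ?_ ?_
    · rcases abs_choice Y with h | h <;> rw [h] at hY0 ⊢
      · have : g (T.c / Y) = -(T.c * (T.a * X + T.b * Z)) / (T.b * Y) := by
          have := hY0.ne'
          simp only [hg]; field_simp; ring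
        rw [this]
        exact div_nonpos_of_nonpos_of_nonneg (by nlinarith) (by positivity)
      · have hY1 : Y ≠ 0 := by linarith
        have : g (T.c / -Y) = -(T.c * (T.a * -X + T.b * (Z + 2 * T.c * X + 2 * T.b * Y)))
            / (T.b * -Y) := by
          simp only [hg]; field_simp; ring
        rw [this]
        exact div_nonpos_of_nonpos_of_nonneg (by nlinarith) (by positivity)
    · rw [abs_mul, abs_of_pos (show 0 < T.c / |Y| by positivity), div_mul_eq_mul_div,
        div_le_iff₀ hY0]
      linarith
    · rw [abs_mul, abs_of_pos (show 0 < T.c / |Y| by positivity), div_mul_cancel₀ _ hY0.ne']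

end MidpointTriple

namespace MidpointTriple
variable (T : MidpointTriple)

/-! ### Two adjacent copies of the parallelogram -/

/-- The vectors over the parallelogram and its image under the half-turn about the midpoint of its
left side. -/
def stripVec (q : ℝ × ℝ) : ℝ × ℝ × ℝ :=
  if 0 ≤ q.1 then T.quad q.1 q.2 else T.turnM (T.quad (-q.1) (1 - q.2))

/-- The parametrisation of the union of the parallelogram and its image under the half-turn about
the midpoint of its left side. -/
def strip (q : ℝ × ℝ) : ℍ := T.pt (T.stripVec q)

/-- The domain of `strip`. -/
def closedBox : Set (ℝ × ℝ) := Set.Icc (-1) 1 ×ˢ Set.Icc 0 1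

/-- The interior of the domain of `strip`. -/
def openBox : Set (ℝ × ℝ) := Set.Ioo (-1) 1 ×ˢ Set.Ioo 0 1

lemma openBox_subset : openBox ⊆ closedBox :=
  Set.prod_mono Set.Ioo_subset_Icc_self Set.Ioo_subset_Icc_self

lemma neg_mem_closedBox {q : ℝ × ℝ} (hq : q ∈ closedBox) : (-q.1, 1 - q.2) ∈ closedBox := by
  obtain ⟨⟨h1, h2⟩, h3, h4⟩ := hq
  exact ⟨⟨by simpa using h2, by simp only; linarith⟩, by simpa using h4, by simpa using h3⟩

lemma stripVec_of_nonneg {q : ℝ × ℝ} (h : 0 ≤ q.1) : T.stripVec q = T.quad q.1 q.2 := if_pos h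

lemma stripVec_of_nonpos {q : ℝ × ℝ} (h : q.1 ≤ 0) :
    T.stripVec q = T.turnM (T.quad (-q.1) (1 - q.2)) := by
  rcases h.eq_or_lt with h | h
  · rw [stripVec_of_nonneg _ h.ge, h, neg_zero, turnM_quad, sub_sub_cancel]
  · exact if_neg (not_le.2 h)

lemma stripVec_mem {q : ℝ × ℝ} (hq : q ∈ closedBox) : T.stripVec q ∈ T.cone := by
  obtain ⟨⟨h1, h2⟩, h3, h4⟩ := hq
  rcases le_total 0 q.1 with h | h
  · rw [stripVec_of_nonneg _ h]; exact T.quad_mem ⟨h, h2⟩ ⟨h3, h4⟩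
  · rw [stripVec_of_nonpos _ h]
    exact turnM_mem (T.quad_mem ⟨by linarith, by linarith⟩ ⟨by linarith, by linarith⟩)

lemma stripVec_neg (q : ℝ × ℝ) : T.stripVec (-q.1, 1 - q.2) = T.turnM (T.stripVec q) := by
  rcases le_total 0 q.1 with h | h
  · rw [stripVec_of_nonneg _ h, stripVec_of_nonpos _ (by simpa using h)]; simp
  · rw [stripVec_of_nonpos _ h, stripVec_of_nonneg _ (by simpa using h), turnM_turnM]

lemma strip_neg {q : ℝ × ℝ} (hq : q ∈ closedBox) :
    T.strip (-q.1, 1 - q.2) = halfTurn T.m • T.strip q := by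
  rw [strip, stripVec_neg, pt_turnM (T.stripVec_mem hq), strip]

/-- As `J` preserves the parallelogram, the second copy is also its image under `MJ`. In this form
the parameters are merely translated, which is the relation needed for charts of the torus. -/
lemma stripVec_sub_one {q : ℝ × ℝ} (hq : q.1 ∈ Set.Icc (0 : ℝ) 1) :
    T.stripVec (q.1 - 1, q.2) = T.turnM (T.turnJ (T.stripVec q)) := by
  rw [stripVec_of_nonneg _ hq.1, stripVec_of_nonpos _ (by simpa using hq.2), turnJ_quad]
  simp

lemma strip_sub_one {q : ℝ × ℝ} (h1 : q.1 ∈ Set.Icc (0 : ℝ) 1) (h2 : q.2 ∈ Set.Icc (0 : ℝ) 1) :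
    T.strip (q.1 - 1, q.2) = halfTurn T.m • halfTurn T.j • T.strip q := by
  have hm : T.stripVec q ∈ T.cone := T.stripVec_mem ⟨⟨by linarith [h1.1], h1.2⟩, h2⟩
  rw [strip, T.stripVec_sub_one h1, pt_turnM (turnJ_mem hm), pt_turnJ hm, strip]

lemma lLeft_stripVec_pos {q : ℝ × ℝ} (hq : q ∈ closedBox) (h : 0 < q.1) :
    0 < T.lLeft (T.stripVec q) := by
  rw [stripVec_of_nonneg _ h.le, lLeft_quad]
  have := T.interp_pos hq.2
  have := T.c_pos
  positivity

lemma lLeft_stripVec_zero {q : ℝ × ℝ} (h : q.1 = 0) : T.lLeft (T.stripVec q) = 0 := by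
  rw [stripVec_of_nonneg _ h.ge, lLeft_quad, h]; simp

lemma lLeft_stripVec_neg {q : ℝ × ℝ} (hq : q ∈ closedBox) (h : q.1 < 0) :
    T.lLeft (T.stripVec q) < 0 := by
  have := T.lLeft_stripVec_pos (neg_mem_closedBox hq) (by simpa using h)
  rw [stripVec_neg, lLeft_turnM] at this
  linarith

/-- The sign of `lLeft` tells the two copies apart; within a copy `quad_injective` applies. -/
lemma stripVec_injective {q q' : ℝ × ℝ} (hq : q ∈ closedBox) (hq' : q' ∈ closedBox) {t : ℝ}
    (ht : 0 < t) (h : T.stripVec q = t • T.stripVec q') : q = q' := by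
  have hl : T.lLeft (T.stripVec q) = t * T.lLeft (T.stripVec q') := by rw [h, lLeft_smul]
  have hpos : 0 ≤ q.1 → 0 ≤ q'.1 := by
    intro h0
    by_contra h1
    have h2 := mul_neg_of_pos_of_neg ht (T.lLeft_stripVec_neg hq' (not_le.1 h1))
    rcases h0.eq_or_lt with h0 | h0
    · have := T.lLeft_stripVec_zero h0.symm; linarith
    · have := T.lLeft_stripVec_pos hq h0; linarith
  have hneg : q.1 ≤ 0 → q'.1 ≤ 0 := by
    intro h0
    by_contra h1
    have h2 := mul_pos ht (T.lLeft_stripVec_pos hq' (not_le.1 h1))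
    rcases h0.eq_or_lt with h0 | h0
    · have := T.lLeft_stripVec_zero h0; linarith
    · have := T.lLeft_stripVec_neg hq h0; linarith
  obtain ⟨⟨h1, h2⟩, h3, h4⟩ := hq
  obtain ⟨⟨h1', h2'⟩, h3', h4'⟩ := hq'
  rcases le_total 0 q.1 with h0 | h0
  · rw [stripVec_of_nonneg _ h0, stripVec_of_nonneg _ (hpos h0)] at h
    obtain ⟨e1, e2⟩ := T.quad_injective ⟨h0, h2⟩ ⟨h3, h4⟩ ⟨hpos h0, h2'⟩ ⟨h3', h4'⟩ h
    exact Prod.ext e1 e2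
  · rw [stripVec_of_nonpos _ h0, stripVec_of_nonpos _ (hneg h0), ← map_smul] at h
    have h := congrArg T.turnM h
    rw [turnM_turnM, turnM_turnM] at h
    have := hneg h0
    obtain ⟨e1, e2⟩ := T.quad_injective (by constructor <;> linarith) (by constructor <;> linarith)
      (by constructor <;> linarith) (by constructor <;> linarith) h
    exact Prod.ext (by linarith) (by linarith)

lemma injOn_strip : Set.InjOn T.strip closedBox := by
  intro q hq q' hq' h
  obtain ⟨t, ht, h⟩ := (T.pt_eq_iff (T.stripVec_mem hq) (T.stripVec_mem hq')).1 h
  exact T.stripVec_injective hq hq' ht h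

lemma continuous_quad : Continuous fun q : ℝ × ℝ => T.quad q.1 q.2 := by
  unfold quad; fun_prop

lemma continuous_turnM : Continuous T.turnM := LinearMap.continuous_of_finiteDimensional _

lemma continuous_turnJ : Continuous T.turnJ := LinearMap.continuous_of_finiteDimensional _

lemma continuous_stripVec : Continuous T.stripVec := by
  refine Continuous.if_le T.continuous_quad ?_ continuous_const continuous_fst ?_
  · exact T.continuous_turnM.comp (T.continuous_quad.comp
      (continuous_fst.neg.prodMk (continuous_const.sub continuous_snd)))
  · intro q hq
    rw [← stripVec_of_nonneg T hq.le, stripVec_of_nonpos T hq.ge]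

lemma continuousOn_strip : ContinuousOn T.strip closedBox :=
  T.continuousOn_pt.comp T.continuous_stripVec.continuousOn fun _ h => T.stripVec_mem h

lemma isCompact_closedBox : IsCompact closedBox := isCompact_Icc.prod isCompact_Icc

/-! ### The image of the strip -/

lemma quad_interior_iff {x y : ℝ} (hx : x ∈ Set.Icc (0 : ℝ) 1) (hy : y ∈ Set.Icc (0 : ℝ) 1) :
    (0 < T.lBot (T.quad x y) ↔ 0 < y) ∧ (0 < T.lTop (T.quad x y) ↔ y < 1) ∧
      (0 < T.lRight (T.quad x y) ↔ x < 1) := by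
  have hb := T.b_pos
  have hc := T.c_pos
  rw [lBot_quad, lTop_quad, lRight_quad]
  refine ⟨?_, ?_, ?_⟩
  · rw [mul_pos_iff_of_pos_right (T.interp_pos hx), mul_pos_iff_of_pos_left (by positivity)]
  · rw [mul_pos_iff_of_pos_right (T.interp_pos' hx), mul_pos_iff_of_pos_left (by positivity),
      sub_pos]
  · rw [mul_pos_iff_of_pos_right (T.interp_pos' hy), mul_pos_iff_of_pos_left (by positivity),
      sub_pos]

/-- The vectors on the inner side of the bottom, top and right sides. -/
def inner : Set (ℝ × ℝ × ℝ) := {v | 0 < T.lBot v ∧ 0 < T.lTop v ∧ 0 < T.lRight v}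

lemma isOpen_inner : IsOpen T.inner := by
  have h1 : Continuous T.lBot := by unfold lBot; fun_prop
  have h2 : Continuous T.lLeft := by unfold lLeft; fun_prop
  exact (isOpen_lt continuous_const h1).inter ((isOpen_lt continuous_const
    (h1.comp T.continuous_turnJ)).inter (isOpen_lt continuous_const (h2.comp T.continuous_turnJ)))

lemma exists_strip_eq {v : ℝ × ℝ × ℝ} (hv : v ∈ T.cone) (hl : 0 ≤ T.lLeft v)
    (h : 0 ≤ T.lBot v ∧ 0 ≤ T.lTop v ∧ 0 ≤ T.lRight v) :
    ∃ q ∈ closedBox, 0 ≤ q.1 ∧ T.strip q = T.pt v ∧ ∃ t : ℝ, 0 < t ∧ T.quad q.1 q.2 = t • v := by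
  obtain ⟨x, hx, y, hy, t, ht, hq⟩ := T.exists_quad_eq hv h.1 hl h.2.1 h.2.2
  refine ⟨(x, y), ⟨⟨by linarith [hx.1], hx.2⟩, hy⟩, hx.1, ?_, t, ht, hq⟩
  rw [strip, stripVec_of_nonneg _ hx.1, hq, pt_smul _ ht hv]

lemma exists_strip_eq_of_inner {v : ℝ × ℝ × ℝ} (hv : v ∈ T.cone) (hl : 0 ≤ T.lLeft v)
    (h : v ∈ T.inner) : ∃ q ∈ openBox, T.strip q = T.pt v := by
  obtain ⟨q, hq, h0, h1, t, ht, hqt⟩ := T.exists_strip_eq hv hl ⟨h.1.le, h.2.1.le, h.2.2.le⟩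
  obtain ⟨g1, g2, g3⟩ := T.quad_interior_iff ⟨h0, hq.1.2⟩ hq.2
  rw [hqt, lBot_smul] at g1
  rw [hqt, lTop_smul] at g2
  rw [hqt, lRight_smul] at g3
  exact ⟨q, ⟨⟨by linarith, g3.1 (mul_pos ht h.2.2)⟩, g1.1 (mul_pos ht h.1),
    g2.1 (mul_pos ht h.2.1)⟩, h1⟩

lemma exists_strip_eq_of_inner' {v : ℝ × ℝ × ℝ} (hv : v ∈ T.cone) (hl : T.lLeft v ≤ 0)
    (h : T.turnM v ∈ T.inner) : ∃ q ∈ openBox, T.strip q = T.pt v := by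
  obtain ⟨q, hq, h1⟩ := T.exists_strip_eq_of_inner (turnM_mem hv)
    (by rw [lLeft_turnM]; linarith) h
  refine ⟨(-q.1, 1 - q.2), ?_, ?_⟩
  · obtain ⟨⟨g1, g2⟩, g3, g4⟩ := hq
    exact ⟨⟨by simpa using g2, by simp only; linarith⟩, by simpa using g4, by simpa using g3⟩
  · rw [T.strip_neg (openBox_subset hq), h1, ← pt_turnM (turnM_mem hv), turnM_turnM]

lemma quad_mem_inner {x y : ℝ} (hx : x ∈ Set.Ico (0 : ℝ) 1) (hy : y ∈ Set.Ioo (0 : ℝ) 1) :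
    T.quad x y ∈ T.inner := by
  obtain ⟨h1, h2, h3⟩ := T.quad_interior_iff ⟨hx.1, hx.2.le⟩ ⟨hy.1.le, hy.2.le⟩
  exact ⟨h1.2 hy.1, h2.2 hy.2, h3.2 hx.2⟩

lemma smul_mem_inner {t : ℝ} (ht : 0 < t) {v : ℝ × ℝ × ℝ} (hv : v ∈ T.inner) : t • v ∈ T.inner := by
  refine ⟨?_, ?_, ?_⟩
  · rw [lBot_smul]; exact mul_pos ht hv.1
  · rw [lTop_smul]; exact mul_pos ht hv.2.1
  · rw [lRight_smul]; exact mul_pos ht hv.2.2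

/-- The strict inequalities for the outer sides persist for nearby points. At a point of the common
side they hold for both copies, and the sign of `lLeft` decides which of the copies contains a
nearby point. -/
lemma isOpen_strip_image_openBox : IsOpen (T.strip '' openBox) := by
  rw [isOpen_iff_mem_nhds]
  rintro _ ⟨q, hq, rfl⟩
  have hcone := T.stripVec_mem (openBox_subset hq)
  obtain ⟨t, ht, hc⟩ := T.coords_pt hcone
  have hll : Continuous T.lLeft := by unfold lLeft; fun_prop
  have hev : ∀ {U : Set (ℝ × ℝ × ℝ)}, IsOpen U → t • T.stripVec q ∈ U →
      ∀ᶠ z in 𝓝 (T.strip q), T.coords z ∈ U := fun {U} hU h =>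
    T.continuous_coords.continuousAt.eventually_mem (hU.mem_nhds (by rwa [strip, hc]))
  have hmem : ∀ z, (T.coords z ∈ T.inner ∧ 0 ≤ T.lLeft (T.coords z) ∨
      T.turnM (T.coords z) ∈ T.inner ∧ T.lLeft (T.coords z) ≤ 0) → z ∈ T.strip '' openBox := by
    rintro z (⟨h1, h2⟩ | ⟨h1, h2⟩)
    · obtain ⟨q', hq', h⟩ := T.exists_strip_eq_of_inner (T.coords_mem z) h2 h1
      exact ⟨q', hq', by rw [h, pt_coords]⟩
    · obtain ⟨q', hq', h⟩ := T.exists_strip_eq_of_inner' (T.coords_mem z) h2 h1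
      exact ⟨q', hq', by rw [h, pt_coords]⟩
  have hin1 : 0 ≤ q.1 → t • T.stripVec q ∈ T.inner := fun h0 => by
    rw [stripVec_of_nonneg _ h0]
    exact T.smul_mem_inner ht (T.quad_mem_inner ⟨h0, hq.1.2⟩ hq.2)
  have hin2 : q.1 ≤ 0 → t • T.stripVec q ∈ T.turnM ⁻¹' T.inner := fun h0 => by
    rw [stripVec_of_nonpos _ h0, Set.mem_preimage, map_smul, turnM_turnM]
    exact T.smul_mem_inner ht (T.quad_mem_inner ⟨by linarith, by linarith [hq.1.1]⟩
      ⟨by linarith [hq.2.2], by linarith [hq.2.1]⟩)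
  rcases lt_trichotomy q.1 0 with h0 | h0 | h0
  · filter_upwards [hev (T.isOpen_inner.preimage T.continuous_turnM) (hin2 h0.le),
      hev ((isOpen_Iio (a := (0 : ℝ))).preimage hll) (by
        rw [Set.mem_preimage, lLeft_smul]
        exact mul_neg_of_pos_of_neg ht (T.lLeft_stripVec_neg (openBox_subset hq) h0))] with z h1 h2
    exact hmem z (Or.inr ⟨h1, (show _ < _ from h2).le⟩)
  · filter_upwards [hev (T.isOpen_inner.preimage T.continuous_turnM) (hin2 h0.le),
      hev T.isOpen_inner (hin1 h0.ge)] with z h1 h2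
    exact hmem z ((le_total 0 (T.lLeft (T.coords z))).imp (fun h => ⟨h2, h⟩) fun h => ⟨h1, h⟩)
  · filter_upwards [hev T.isOpen_inner (hin1 h0.le),
      hev ((isOpen_Ioi (a := (0 : ℝ))).preimage hll) (by
        rw [Set.mem_preimage, lLeft_smul]
        exact mul_pos ht (T.lLeft_stripVec_pos (openBox_subset hq) h0))] with z h1 h2
    exact hmem z (Or.inl ⟨h1, (show _ < _ from h2).le⟩)

/-- By injectivity the image of `W` is the open image of the whole box minus the compact image of
the complement of `W`. -/
lemma isOpen_strip_image {W : Set (ℝ × ℝ)} (hW : IsOpen W) (hWb : W ⊆ openBox) :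
    IsOpen (T.strip '' W) := by
  have hcl : IsClosed (T.strip '' (closedBox \ W)) :=
    ((isCompact_closedBox.diff hW).image_of_continuousOn
      (T.continuousOn_strip.mono Set.sdiff_subset)).isClosed
  have : T.strip '' W = T.strip '' openBox \ T.strip '' (closedBox \ W) := by
    ext z
    constructor
    · rintro ⟨q, hq, rfl⟩
      refine ⟨⟨q, hWb hq, rfl⟩, ?_⟩
      rintro ⟨q', hq', h⟩
      have := T.injOn_strip hq'.1 (openBox_subset (hWb hq)) h
      exact hq'.2 (this ▸ hq)
    · rintro ⟨⟨q, hq, rfl⟩, h⟩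
      by_contra hn
      exact h ⟨q, ⟨openBox_subset hq, fun hqW => hn ⟨q, hqW, rfl⟩⟩, rfl⟩
  rw [this]
  exact T.isOpen_strip_image_openBox.sdiff hcl

end MidpointTriple

/-! ### Three simply connected open sets that cover the punctured torus -/

/-- The index type of the three charts of the punctured torus: the open unit square, and its
translates centred at the midpoints of the left and the bottom side. -/
inductive TorusChart
  | square
  | left
  | bottom

namespace TorusChart

/-- The lower left corner of the unit square that is projected to the torus. -/
def corner : TorusChart → ℝ × ℝ
  | square => (0, 0)
  | left => (-1 / 2, 0)
  | bottom => (0, -1 / 2)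

/-- The open unit square that is projected to the torus. -/
def box (i : TorusChart) : Set (ℝ × ℝ) :=
  Set.Ioo i.corner.1 (i.corner.1 + 1) ×ˢ Set.Ioo i.corner.2 (i.corner.2 + 1)

/-- The image of the unit square in the punctured torus. -/
def base (i : TorusChart) : Set PuncturedTorus :=
  {p | p.1.1 ≠ (i.corner.1 : UnitAddCircle) ∧ p.1.2 ≠ (i.corner.2 : UnitAddCircle)}

end TorusChart

/-- The projection of the plane to the torus. -/
def torusProj (q : ℝ × ℝ) : Torus := ((q.1 : UnitAddCircle), (q.2 : UnitAddCircle))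

lemma continuous_torusProj : Continuous torusProj :=
  ((AddCircle.continuous_mk' (1 : ℝ)).comp continuous_fst).prodMk
    ((AddCircle.continuous_mk' (1 : ℝ)).comp continuous_snd)

lemma isOpenMap_torusProj : IsOpenMap torusProj :=
  (QuotientAddGroup.isOpenMap_coe (N := AddSubgroup.zmultiples (1 : ℝ))).prodMap
    (QuotientAddGroup.isOpenMap_coe (N := AddSubgroup.zmultiples (1 : ℝ)))

lemma torusProj_zero : torusProj 0 = 0 := rfl

lemma torusProj_eq_iff {q q' : ℝ × ℝ} : torusProj q = torusProj q' ↔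
    (∃ k : ℤ, q'.1 = q.1 + k) ∧ ∃ k : ℤ, q'.2 = q.2 + k := by
  have key : ∀ s t : ℝ, (s : UnitAddCircle) = t ↔ ∃ k : ℤ, t = s + k := by
    intro s t
    rw [eq_comm, ← sub_eq_zero, ← AddCircle.coe_sub, AddCircle.coe_eq_zero_iff]
    simp only [zsmul_eq_mul, mul_one]
    exact exists_congr fun k => ⟨fun h => by linarith, fun h => by linarith⟩
  rw [torusProj, torusProj, Prod.mk.injEq, key, key]

lemma torusProj_injOn_box {u v : ℝ} :
    Set.InjOn torusProj (Set.Ico u (u + 1) ×ˢ Set.Ico v (v + 1)) := by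
  have key : ∀ {u s t : ℝ} {k : ℤ}, s ∈ Set.Ico u (u + 1) → t ∈ Set.Ico u (u + 1) →
      t = s + k → s = t := by
    intro u s t k hs ht h
    have h1 : ((k : ℤ) : ℝ) < 1 := by linarith [hs.1, ht.2]
    have h2 : (-1 : ℝ) < k := by linarith [hs.2, ht.1]
    have h1' : k < 1 := by exact_mod_cast h1
    have h2' : -1 < k := by exact_mod_cast h2
    have : k = 0 := by omega
    rw [h, this]; simp
  intro q hq q' hq' h
  obtain ⟨⟨k, hk⟩, l, hl⟩ := torusProj_eq_iff.1 h
  exact Prod.ext (key hq.1 hq'.1 hk) (key hq.2 hq'.2 hl)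

lemma TorusChart.isOpen_base (i : TorusChart) : IsOpen i.base :=
  (isOpen_ne.preimage (continuous_fst.comp continuous_subtype_val)).inter
    (isOpen_ne.preimage (continuous_snd.comp continuous_subtype_val))

/-- The projection of an open unit square to the torus. -/
def boxCoe (u v : ℝ) : OpenPartialHomeomorph (ℝ × ℝ) Torus :=
  (AddCircle.openPartialHomeomorphCoe 1 u).prod (AddCircle.openPartialHomeomorphCoe 1 v)

lemma boxCoe_apply (u v : ℝ) (q : ℝ × ℝ) : boxCoe u v q = torusProj q := rfl

lemma mem_boxCoe_target {u v : ℝ} {p : Torus} :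
    p ∈ (boxCoe u v).target ↔ p.1 ≠ (u : UnitAddCircle) ∧ p.2 ≠ (v : UnitAddCircle) := Iff.rfl

lemma TorusChart.mem_base_iff {i : TorusChart} {p : PuncturedTorus} :
    p ∈ i.base ↔ ∃ q ∈ i.box, torusProj q = p.1 := by
  constructor
  · intro h
    have h' : p.1 ∈ (boxCoe i.corner.1 i.corner.2).target := mem_boxCoe_target.2 h
    exact ⟨_, (boxCoe i.corner.1 i.corner.2).map_target h',
      (boxCoe i.corner.1 i.corner.2).right_inv h'⟩
  · rintro ⟨q, hq, h⟩
    have := (boxCoe i.corner.1 i.corner.2).map_source hq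
    rw [boxCoe_apply, h] at this
    exact mem_boxCoe_target.1 this

/-- The covering of the punctured torus glued from the products of the three open sets with the
free group is described by these elements, which compare each of the three sets with the square. -/
def TorusChart.cocycle (i : TorusChart) (p : PuncturedTorus) : TorusGroup :=
  open Classical in
  match i with
  | square => 1
  | left => if p.1.1 ∈ ((↑) : ℝ → UnitAddCircle) '' Set.Ioo (1 / 2) 1 then genX⁻¹ else 1
  | bottom => if p.1.2 ∈ ((↑) : ℝ → UnitAddCircle) '' Set.Ioo (1 / 2) 1 then genY⁻¹ else 1

lemma unitAddCircle_coe_mem_iff {t : ℝ} (ht : t ∈ Set.Ioo (0 : ℝ) 1) :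
    (t : UnitAddCircle) ∈ ((↑) : ℝ → UnitAddCircle) '' Set.Ioo (1 / 2) 1 ↔ 1 / 2 < t := by
  constructor
  · rintro ⟨s, hs, hst⟩
    have h : torusProj (s, 0) = torusProj (t, 0) := by simp only [torusProj, hst]
    have := torusProj_injOn_box (u := 0) (v := 0)
      ⟨⟨by linarith [hs.1], by linarith [hs.2]⟩, by norm_num, by norm_num⟩
      ⟨⟨by linarith [ht.1], by linarith [ht.2]⟩, by norm_num, by norm_num⟩ h
    have hst' : s = t := congrArg Prod.fst this
    exact hst' ▸ hs.1
  · intro h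
    exact ⟨t, ⟨h, ht.2⟩, rfl⟩

/-- The points `0` and `1/2` divide the circle into two open arcs; `-1/2` and `1/2` are the same
point. -/
lemma eventually_mem_iff_upper_half {x : UnitAddCircle} (h0 : x ≠ ((0 : ℝ) : UnitAddCircle))
    (h1 : x ≠ ((-1 / 2 : ℝ) : UnitAddCircle)) : ∀ᶠ y in 𝓝 x,
      (y ∈ ((↑) : ℝ → UnitAddCircle) '' Set.Ioo (1 / 2) 1 ↔
        x ∈ ((↑) : ℝ → UnitAddCircle) '' Set.Ioo (1 / 2) 1) := by
  have hop : IsOpenMap ((↑) : ℝ → UnitAddCircle) :=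
    QuotientAddGroup.isOpenMap_coe (N := AddSubgroup.zmultiples (1 : ℝ))
  by_cases hx : x ∈ ((↑) : ℝ → UnitAddCircle) '' Set.Ioo (1 / 2) 1
  · filter_upwards [(hop _ isOpen_Ioo).mem_nhds hx] with y hy
    exact iff_of_true hy hx
  · obtain ⟨t, ht, rfl⟩ : x ∈ ((↑) : ℝ → UnitAddCircle) '' Set.Ioo 0 1 := by
      have := (AddCircle.openPartialHomeomorphCoe 1 (0 : ℝ)).map_target (x := x) h0
      refine ⟨_, ?_, (AddCircle.openPartialHomeomorphCoe 1 (0 : ℝ)).right_inv (x := x) h0⟩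
      simpa [AddCircle.openPartialHomeomorphCoe] using this
    have ht' : t < 1 / 2 := by
      rw [unitAddCircle_coe_mem_iff ht, not_lt] at hx
      refine hx.lt_of_ne ?_
      rintro rfl
      apply h1
      have : ((1 / 2 : ℝ) : UnitAddCircle) - ((-1 / 2 : ℝ) : UnitAddCircle) = 0 := by
        rw [← AddCircle.coe_sub, AddCircle.coe_eq_zero_iff]
        exact ⟨1, by norm_num⟩
      exact sub_eq_zero.1 this
    filter_upwards [(hop _ isOpen_Ioo).mem_nhds ⟨t, ⟨ht.1, ht'⟩, rfl⟩] with y hy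
    refine iff_of_false ?_ hx
    obtain ⟨s, hs, rfl⟩ := hy
    rw [unitAddCircle_coe_mem_iff ⟨hs.1, by linarith [hs.2]⟩]
    exact not_lt.2 hs.2.le

namespace TorusChart

lemma eventually_cocycle_eq {i : TorusChart} {p : PuncturedTorus} (hi : p ∈ i.base)
    (hs : p ∈ square.base) : ∀ᶠ y in 𝓝 p, i.cocycle y = i.cocycle p := by
  cases i with
  | square => exact Filter.Eventually.of_forall fun y => rfl
  | left =>
    have := (continuous_fst.comp continuous_subtype_val).continuousAt.eventually
      (eventually_mem_iff_upper_half hs.1 hi.1)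
    filter_upwards [this] with y hy
    simp only [cocycle]
    congr 1
    exact propext hy
  | bottom =>
    have := (continuous_snd.comp continuous_subtype_val).continuousAt.eventually
      (eventually_mem_iff_upper_half hs.2 hi.2)
    filter_upwards [this] with y hy
    simp only [cocycle]
    congr 1
    exact propext hy

/-- All overlaps of distinct charts lie in the square, so it suffices to compare each chart with the
square. -/
lemma mem_square_of_mem {i j : TorusChart} (hij : i ≠ j) {p : PuncturedTorus} (hi : p ∈ i.base)
    (hj : p ∈ j.base) : p ∈ square.base := by
  cases i <;> cases j <;> first | exact absurd rfl hij | exact hi | exact hj | skip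
  · exact ⟨hj.1, hi.2⟩
  · exact ⟨hi.1, hj.2⟩

lemma coe_neg_half_ne_zero : ((-1 / 2 : ℝ) : UnitAddCircle) ≠ ((0 : ℝ) : UnitAddCircle) := by
  rw [neg_div, AddCircle.coe_neg, AddCircle.coe_zero]
  exact neg_ne_zero.2 half_ne_zero_unitAddCircle

/-- A chart whose domain contains the given point, the square wherever possible. -/
def indexAt (p : PuncturedTorus) : TorusChart :=
  open Classical in
  if p ∈ square.base then square else if p ∈ left.base then left else bottom

lemma mem_base_indexAt (p : PuncturedTorus) : p ∈ (indexAt p).base := by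
  unfold indexAt
  split_ifs with h1 h2
  · exact h1
  · exact h2
  · have hx : p.1.1 ≠ ((0 : ℝ) : UnitAddCircle) := by
      intro hx
      refine h2 ⟨by rw [hx]; exact coe_neg_half_ne_zero.symm, fun hy => p.2 ?_⟩
      exact Prod.ext hx hy
    refine ⟨hx, fun hy => h1 ⟨hx, ?_⟩⟩
    rw [hy]; exact coe_neg_half_ne_zero

lemma indexAt_of_mem {p : PuncturedTorus} (hp : p ∈ square.base) : indexAt p = square :=
  if_pos hp

end TorusChart

/-! ### The universal covering of the punctured torus -/

instance : TopologicalSpace TorusGroup := ⊥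

instance : DiscreteTopology TorusGroup := ⟨rfl⟩

/-- The bundle with fibre the free group that is glued by means of `TorusChart.cocycle`. -/
def torusBundle : FiberBundleCore TorusChart PuncturedTorus TorusGroup where
  baseSet := TorusChart.base
  isOpen_baseSet := TorusChart.isOpen_base
  indexAt := TorusChart.indexAt
  mem_baseSet_at := TorusChart.mem_base_indexAt
  coordChange i j p g := g * i.cocycle p * (j.cocycle p)⁻¹
  coordChange_self i p _ g := mul_inv_cancel_right _ _
  continuousOn_coordChange i j := by
    rintro ⟨p, g⟩ ⟨⟨hi, hj⟩, -⟩
    apply ContinuousAt.continuousWithinAt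
    -- A cocycle jumps where a path crosses a side of the square, but such a point lies in one chart
    -- only, and for equal indices the two factors cancel. Elsewhere the cocycles are locally
    -- constant.
    by_cases hij : i = j
    · subst hij
      simpa only [mul_inv_cancel_right] using continuousAt_snd
    · have hs := TorusChart.mem_square_of_mem hij hi hj
      have h1 := (continuousAt_fst (p := (p, g))).eventually
        ((TorusChart.eventually_cocycle_eq hi hs).and (TorusChart.eventually_cocycle_eq hj hs))
      have h2 : ∀ᶠ y : PuncturedTorus × TorusGroup in 𝓝 (p, g), y.2 = g :=
        (continuousAt_snd (p := (p, g))).eventually (p := fun x => x = g)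
          (by rw [nhds_discrete]; exact Filter.eventually_pure.2 rfl)
      refine ContinuousAt.congr (f := fun _ => g * i.cocycle p * (j.cocycle p)⁻¹)
        continuousAt_const ?_
      filter_upwards [h1, h2] with y hy1 hy2
      rw [hy1.1, hy1.2, hy2]
  coordChange_comp i j k p _ g := by group

lemma isCoveringMap_torusBundle :
    IsCoveringMap (Bundle.TotalSpace.proj : torusBundle.TotalSpace → PuncturedTorus) :=
  FiberBundle.isCoveringMap

/-! ### Lifts of paths and monodromy. -/

/-- The point of the covering over `p` that is given by the element `g` in the chart at `p`. -/
def torusBundleMk (p : PuncturedTorus) (g : TorusGroup) : torusBundle.TotalSpace := ⟨p, g⟩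

/-- Fibre elements are recorded in the chart preferred at their own base point. Continuity means
that after passage to the chart preferred at `f x` they are locally constant, the fibre being
discrete. -/
lemma continuousAt_torusBundle_iff {X : Type*} [TopologicalSpace X] {f : X → PuncturedTorus}
    {g : X → TorusGroup} {x : X} : ContinuousAt (fun y => torusBundleMk (f y) (g y)) x ↔
      ContinuousAt f x ∧ ∀ᶠ y in 𝓝 x, g y * (TorusChart.indexAt (f y)).cocycle (f y) *
        ((TorusChart.indexAt (f x)).cocycle (f y))⁻¹ = g x := by
  rw [FiberBundle.continuousAt_totalSpace TorusGroup]
  refine and_congr Iff.rfl ?_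
  have h : ∀ y, (trivializationAt TorusGroup torusBundle.Fiber (torusBundleMk (f x) (g x)).proj
      (torusBundleMk (f y) (g y))).2 = g y * (TorusChart.indexAt (f y)).cocycle (f y) *
        ((TorusChart.indexAt (f x)).cocycle (f y))⁻¹ := fun y => rfl
  simp only [h]
  rw [ContinuousAt, nhds_discrete TorusGroup, Filter.tendsto_pure, mul_inv_cancel_right]

lemma monodromy_eq_of_lift {γ : Path torusBase torusBase} {g : unitInterval → TorusGroup}
    (h : Continuous fun t => torusBundleMk (γ t) (g t)) :
    isCoveringMap_torusBundle.monodromy (Path.Homotopic.Quotient.mk γ)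
      ⟨torusBundleMk torusBase (g 0), rfl⟩ = ⟨torusBundleMk torusBase (g 1), rfl⟩ := by
  have h0 : torusBundleMk (γ 0) (g 0) = torusBundleMk torusBase (g 0) := by rw [γ.source]
  have h1 : torusBundleMk (γ 1) (g 1) = torusBundleMk torusBase (g 1) := by rw [γ.target]
  apply Subtype.ext
  have := (isCoveringMap_torusBundle.eq_liftPath_iff (γ := (γ : C(unitInterval, PuncturedTorus)))
    (e := torusBundleMk torusBase (g 0)) (γ_0 := γ.source)).2 ⟨h, rfl, h0⟩
  exact (congrFun this 1).symm.trans h1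

/-- A loop that leaves the square only at time `1/2`, inside chart `i`. Its lift is recorded as `g`
before and as `g * x` from that time on; the jump of the cocycle of `i` compensates, so that read in
chart `i` the lift is constantly `g * x` near the crossing. -/
lemma monodromy_of_crossing {γ : Path torusBase torusBase} {i : TorusChart} {x : TorusGroup}
    (hsq : ∀ t : unitInterval, (t : ℝ) ≠ 1 / 2 → γ t ∈ TorusChart.square.base)
    (hi : ∀ t : unitInterval, (t : ℝ) = 1 / 2 → TorusChart.indexAt (γ t) = i)
    (hlt : ∀ t : unitInterval, 0 < (t : ℝ) → (t : ℝ) < 1 / 2 → i.cocycle (γ t) = x⁻¹)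
    (hgt : ∀ t : unitInterval, 1 / 2 < (t : ℝ) → (t : ℝ) < 1 → i.cocycle (γ t) = 1)
    (g : TorusGroup) :
    isCoveringMap_torusBundle.monodromy (Path.Homotopic.Quotient.mk γ)
      ⟨torusBundleMk torusBase g, rfl⟩ = ⟨torusBundleMk torusBase (g * x), rfl⟩ := by
  have hcont : Continuous fun t : unitInterval =>
      torusBundleMk (γ t) (if (t : ℝ) < 1 / 2 then g else g * x) := by
    rw [continuous_iff_continuousAt]
    intro t
    rw [continuousAt_torusBundle_iff]
    refine ⟨γ.continuous.continuousAt, ?_⟩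
    have hv : ContinuousAt (fun s : unitInterval => (s : ℝ)) t := continuousAt_subtype_val
    have hsq' : ∀ s : unitInterval, (s : ℝ) ≠ 1 / 2 →
        (TorusChart.indexAt (γ s)).cocycle (γ s) = 1 := fun s hs => by
      rw [TorusChart.indexAt_of_mem (hsq s hs)]; rfl
    rcases lt_trichotomy (t : ℝ) (1 / 2) with ht | ht | ht
    · filter_upwards [hv.eventually (gt_mem_nhds ht)] with s hs
      rw [hsq' s hs.ne, TorusChart.indexAt_of_mem (hsq t ht.ne), if_pos hs, if_pos ht]
      simp [TorusChart.cocycle]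
    · filter_upwards [hv.eventually (lt_mem_nhds (show (0 : ℝ) < t by rw [ht]; norm_num)),
        hv.eventually (gt_mem_nhds (show (t : ℝ) < 1 by rw [ht]; norm_num))] with s hs0 hs1
      rw [hi t ht, if_neg ht.not_lt]
      rcases lt_trichotomy (s : ℝ) (1 / 2) with hs | hs | hs
      · rw [hsq' s hs.ne, hlt s hs0 hs, if_pos hs]; simp
      · rw [hi s hs, if_neg hs.not_lt, mul_inv_cancel_right]
      · rw [hsq' s hs.ne', hgt s hs hs1, if_neg hs.le.not_gt]; simp
    · filter_upwards [hv.eventually (lt_mem_nhds ht)] with s hs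
      rw [hsq' s (ne_of_gt hs), TorusChart.indexAt_of_mem (hsq t ht.ne'), if_neg (not_lt.2 hs.le),
        if_neg ht.le.not_gt]
      simp [TorusChart.cocycle]
  have h := monodromy_eq_of_lift hcont
  simp only [Set.Icc.coe_zero, Set.Icc.coe_one, if_pos (show (0 : ℝ) < 1 / 2 by norm_num),
    if_neg (show ¬ (1 : ℝ) < 1 / 2 by norm_num)] at h
  exact h

lemma unitAddCircle_coe_eq_iff {s t : ℝ} :
    (s : UnitAddCircle) = t ↔ ∃ k : ℤ, t = s + k := by
  rw [eq_comm, ← sub_eq_zero, ← AddCircle.coe_sub, AddCircle.coe_eq_zero_iff]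
  simp only [zsmul_eq_mul, mul_one]
  exact exists_congr fun k => ⟨fun h => by linarith, fun h => by linarith⟩

lemma half_add_coe_ne_zero {t : unitInterval} (ht : (t : ℝ) ≠ 1 / 2) :
    ((1 / 2 + (t : ℝ) : ℝ) : UnitAddCircle) ≠ ((0 : ℝ) : UnitAddCircle) := by
  intro h
  obtain ⟨k, hk⟩ := unitAddCircle_coe_eq_iff.1 h
  have h1 : (k : ℝ) < 0 := by linarith [t.2.1]
  have h2 : (-2 : ℝ) < k := by linarith [t.2.2]
  have h1' : k < 0 := by exact_mod_cast h1
  have h2' : -2 < k := by exact_mod_cast h2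
  have : k = -1 := by omega
  rw [this] at hk; push_cast at hk; exact ht (by linarith)

lemma half_coe_ne_zero : ((1 / 2 : ℝ) : UnitAddCircle) ≠ ((0 : ℝ) : UnitAddCircle) :=
  half_ne_zero_unitAddCircle

lemma half_coe_eq : ((1 / 2 : ℝ) : UnitAddCircle) = ((-1 / 2 : ℝ) : UnitAddCircle) :=
  unitAddCircle_coe_eq_iff.2 ⟨-1, by norm_num⟩

lemma half_add_half_coe {t : unitInterval} (ht : (t : ℝ) = 1 / 2) :
    ((1 / 2 + (t : ℝ) : ℝ) : UnitAddCircle) = ((0 : ℝ) : UnitAddCircle) :=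
  unitAddCircle_coe_eq_iff.2 ⟨-1, by rw [ht]; norm_num⟩

lemma half_add_coe_mem {t : unitInterval} (h0 : 0 < (t : ℝ)) (h1 : (t : ℝ) < 1 / 2) :
    ((1 / 2 + (t : ℝ) : ℝ) : UnitAddCircle) ∈ ((↑) : ℝ → UnitAddCircle) '' Set.Ioo (1 / 2) 1 :=
  ⟨1 / 2 + t, ⟨by linarith, by linarith⟩, rfl⟩

lemma half_add_coe_notMem {t : unitInterval} (h0 : 1 / 2 < (t : ℝ)) (h1 : (t : ℝ) < 1) :
    ((1 / 2 + (t : ℝ) : ℝ) : UnitAddCircle) ∉ ((↑) : ℝ → UnitAddCircle) '' Set.Ioo (1 / 2) 1 := by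
  have h : ((1 / 2 + (t : ℝ) : ℝ) : UnitAddCircle) = (((t : ℝ) - 1 / 2 : ℝ) : UnitAddCircle) :=
    unitAddCircle_coe_eq_iff.2 ⟨-1, by push_cast; ring⟩
  rw [h, unitAddCircle_coe_mem_iff ⟨by linarith, by linarith⟩]
  linarith

lemma monodromy_torusLoopX (g : TorusGroup) :
    isCoveringMap_torusBundle.monodromy (Path.Homotopic.Quotient.mk torusLoopX)
      ⟨torusBundleMk torusBase g, rfl⟩ = ⟨torusBundleMk torusBase (g * genX), rfl⟩ := by
  refine monodromy_of_crossing (γ := torusLoopX) (i := .left) (x := genX)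
    (fun t ht => ⟨half_add_coe_ne_zero ht, half_coe_ne_zero⟩) (fun t ht => ?_)
    (fun t h0 h1 => if_pos (half_add_coe_mem h0 h1))
    (fun t h0 h1 => if_neg (half_add_coe_notMem h0 h1)) g
  have h1 : torusLoopX t ∉ TorusChart.square.base := fun h => h.1 (half_add_half_coe ht)
  have h2 : torusLoopX t ∈ TorusChart.left.base :=
    ⟨fun h => TorusChart.coe_neg_half_ne_zero (h.symm.trans (half_add_half_coe ht)),
      half_coe_ne_zero⟩
  rw [TorusChart.indexAt, if_neg h1, if_pos h2]

lemma monodromy_torusLoopY (g : TorusGroup) :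
    isCoveringMap_torusBundle.monodromy (Path.Homotopic.Quotient.mk torusLoopY)
      ⟨torusBundleMk torusBase g, rfl⟩ = ⟨torusBundleMk torusBase (g * genY), rfl⟩ := by
  refine monodromy_of_crossing (γ := torusLoopY) (i := .bottom) (x := genY)
    (fun t ht => ⟨half_coe_ne_zero, half_add_coe_ne_zero ht⟩) (fun t ht => ?_)
    (fun t h0 h1 => if_pos (half_add_coe_mem h0 h1))
    (fun t h0 h1 => if_neg (half_add_coe_notMem h0 h1)) g
  have h1 : torusLoopY t ∉ TorusChart.square.base := fun h => h.2 (half_add_half_coe ht)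
  have h2 : torusLoopY t ∉ TorusChart.left.base := fun h => h.1 half_coe_eq
  rw [TorusChart.indexAt, if_neg h1, if_neg h2]

/-- Right multiplication performs `v` and then `w` for the product `v * w`; this is why the marking
takes values in the opposite group. -/
lemma monodromy_torusMarking (w g : TorusGroup) :
    isCoveringMap_torusBundle.monodromyPerm torusBase (torusMarking w).unop
      ⟨torusBundleMk torusBase g, rfl⟩ = ⟨torusBundleMk torusBase (g * w), rfl⟩ := by
  have hof : ∀ (i : Fin 2) (g : TorusGroup),
      isCoveringMap_torusBundle.monodromyPerm torusBase (torusMarking (FreeGroup.of i)).unop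
        ⟨torusBundleMk torusBase g, rfl⟩ =
        ⟨torusBundleMk torusBase (g * FreeGroup.of i), rfl⟩ := by
    intro i g
    rw [torusMarking, FreeGroup.lift_apply_of]
    fin_cases i
    · exact monodromy_torusLoopX g
    · exact monodromy_torusLoopY g
  induction w using FreeGroup.induction_on generalizing g with
  | C1 => rw [map_one, MulOpposite.unop_one, map_one, mul_one, Equiv.Perm.one_apply]
  | of i => exact hof i g
  | inv_of i _ =>
    rw [map_inv, MulOpposite.unop_inv, map_inv, Equiv.Perm.inv_eq_iff_eq, hof]
    simp
  | mul v w hv hw =>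
    rw [map_mul, MulOpposite.unop_mul, map_mul, Equiv.Perm.mul_apply, hv, hw, mul_assoc]

/-- Monodromy depends only on the homotopy class, so the endpoint of the lift of any loop in the
class of `w` is known from the two generators. -/
lemma exists_lift_of_torusMarking_eq {w : TorusGroup} {γ : Path torusBase torusBase}
    (h : torusMarking w =
      MulOpposite.op (FundamentalGroup.fromPath (Path.Homotopic.Quotient.mk γ))) :
    ∃ g : unitInterval → TorusGroup, (Continuous fun t => torusBundleMk (γ t) (g t)) ∧
      g 0 = 1 ∧ g 1 = w := by
  have hm := monodromy_torusMarking w 1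
  rw [h, one_mul] at hm
  obtain ⟨Γ, hΓ, h0⟩ := isCoveringMap_torusBundle.exists_path_lifts
    (γ : C(unitInterval, PuncturedTorus)) (torusBundleMk torusBase 1) γ.source
  have hp : ∀ t, (Γ t).proj = γ t := fun t => congrFun hΓ t
  have heq : ∀ t, torusBundleMk (γ t) (Γ t).2 = Γ t := fun t => by rw [← hp t]; rfl
  have hg0 : (Γ 0).2 = (1 : TorusGroup) := by rw [h0]; rfl
  have hcont : Continuous fun t => torusBundleMk (γ t) ((Γ t).2 : TorusGroup) := by
    simp only [heq]; exact Γ.continuous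
  refine ⟨fun t => (Γ t).2, hcont, hg0, ?_⟩
  have hl := monodromy_eq_of_lift hcont
  rw [hg0] at hl
  have := congrArg (fun z => (z.1.2 : TorusGroup)) (hl.symm.trans hm)
  exact this

/-! ### Changes of charts of hyperbolic surfaces -/

section HyperbolicSurface

variable {M : Type*} [TopologicalSpace M]

lemma symm_trans_mem_hypGroupoid {e e' : OpenPartialHomeomorph M ℍ}
    (h : ∀ p ∈ e.source, p ∈ e'.source → ∃ g : SL(2, ℝ), ∀ᶠ y in 𝓝 p, e' y = g • e y) :
    e.symm.trans e' ∈ hypGroupoid := by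
  have key : ∀ {e e' : OpenPartialHomeomorph M ℍ},
      (∀ p ∈ e.source, p ∈ e'.source → ∃ g : SL(2, ℝ), ∀ᶠ y in 𝓝 p, e' y = g • e y) →
      hypPregroupoid.property (e.symm.trans e') (e.symm.trans e').source := by
    intro e e' h x hx
    rw [OpenPartialHomeomorph.trans_source, OpenPartialHomeomorph.symm_source] at hx
    obtain ⟨g, hg⟩ := h (e.symm x) (e.map_target hx.1) hx.2
    refine ⟨g, ?_⟩
    filter_upwards [(e.continuousAt_symm hx.1).eventually hg,
      e.open_target.mem_nhds hx.1] with y hy hyt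
    rw [OpenPartialHomeomorph.trans_apply, hy, e.right_inv hyt]
  refine mem_groupoid_of_pregroupoid.2 ⟨key h, ?_⟩
  have h' := key (e := e') (e' := e) fun p hp' hp => by
    obtain ⟨g, hg⟩ := h p hp hp'
    exact ⟨g⁻¹, hg.mono fun y hy => by rw [hy, inv_smul_smul]⟩
  rw [← OpenPartialHomeomorph.symm_source, OpenPartialHomeomorph.trans_symm_eq_symm_trans_symm,
    OpenPartialHomeomorph.symm_symm]
  exact h'

lemma exists_smul_of_symm_trans_mem {e e' : OpenPartialHomeomorph M ℍ}
    (h : e.symm.trans e' ∈ hypGroupoid) {p : M} (hp : p ∈ e.source) (hp' : p ∈ e'.source) :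
    ∃ g : SL(2, ℝ), ∀ᶠ y in 𝓝 p, e' y = g • e y := by
  obtain ⟨g, hg⟩ := (mem_groupoid_of_pregroupoid.1 h).1 (e p) (by
    rw [OpenPartialHomeomorph.trans_source, OpenPartialHomeomorph.symm_source]
    exact ⟨e.map_source hp, by rwa [Set.mem_preimage, e.left_inv hp]⟩)
  refine ⟨g, ?_⟩
  filter_upwards [(e.continuousAt hp).eventually hg, e.open_source.mem_nhds hp] with y hy hye
  rwa [OpenPartialHomeomorph.trans_apply, e.left_inv hye] at hy

lemma mem_maximalAtlas_of_smul [ChartedSpace ℍ M] {e : OpenPartialHomeomorph M ℍ}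
    (h : ∀ e' ∈ atlas ℍ M, ∀ p ∈ e.source, p ∈ e'.source →
      ∃ g : SL(2, ℝ), ∀ᶠ y in 𝓝 p, e' y = g • e y) : e ∈ hypGroupoid.maximalAtlas M := by
  refine mem_maximalAtlas_iff.2 fun e' he' => ⟨symm_trans_mem_hypGroupoid (h e' he'),
    symm_trans_mem_hypGroupoid fun p hp' hp => ?_⟩
  obtain ⟨g, hg⟩ := h e' he' p hp hp'
  exact ⟨g⁻¹, hg.mono fun y hy => by rw [hy, inv_smul_smul]⟩

end HyperbolicSurface

/-- A chart followed by an isometry. -/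
def smulChart {M : Type*} [TopologicalSpace M] (g : SL(2, ℝ)) (e : OpenPartialHomeomorph M ℍ) :
    OpenPartialHomeomorph M ℍ := e.trans (Homeomorph.smul g).toOpenPartialHomeomorph

lemma smulChart_apply {M : Type*} [TopologicalSpace M] (g : SL(2, ℝ))
    (e : OpenPartialHomeomorph M ℍ) (p : M) : smulChart g e p = g • e p := rfl

lemma smulChart_source {M : Type*} [TopologicalSpace M] (g : SL(2, ℝ))
    (e : OpenPartialHomeomorph M ℍ) : (smulChart g e).source = e.source := by
  simp [smulChart]

/-- Stated for the action because the square of the matrix is `-1`. -/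
lemma halfTurn_smul_halfTurn_smul (z w : ℍ) : halfTurn z • halfTurn z • w = w := by
  apply symVec_injective
  rw [symVec_smul, symVec_smul, vecAct_halfTurn, vecAct_halfTurn, hypForm_add_left,
    hypForm_smul_left, hypForm_symVec, ← neg_one_smul ℝ (symVec w), hypForm_smul_left]
  module

namespace MidpointTriple
variable (T : MidpointTriple)

/-! ### The hyperbolic structure on the punctured torus -/

/-- The parametrisation of the strip as an open partial homeomorphism. -/
def stripHomeo : OpenPartialHomeomorph (ℝ × ℝ) ℍ :=
  OpenPartialHomeomorph.ofContinuousOpenRestrict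
    ((T.injOn_strip.mono openBox_subset).toPartialEquiv T.strip openBox)
    (T.continuousOn_strip.mono openBox_subset)
    (by
      intro W hW
      have key : ∀ V : Set openBox, IsOpen V → IsOpen ((fun q : openBox => T.strip q) '' V) := by
        intro V hV
        rw [← Set.image_image T.strip]
        exact T.isOpen_strip_image ((isOpen_Ioo.prod isOpen_Ioo).isOpenMap_subtype_val V hV)
          (Subtype.coe_image_subset _ _)
      exact key W hW)
    (isOpen_Ioo.prod isOpen_Ioo)

lemma stripHomeo_source : T.stripHomeo.source = openBox := rfl

/-- The developing map on the three squares. -/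
def dev : TorusChart → OpenPartialHomeomorph (ℝ × ℝ) ℍ
  | .square => T.stripHomeo
  | .left => T.stripHomeo
  | .bottom => (Homeomorph.prodComm ℝ ℝ).toOpenPartialHomeomorph.trans T.swap.stripHomeo

lemma dev_square (q : ℝ × ℝ) : T.dev .square q = T.strip q := rfl

lemma dev_left (q : ℝ × ℝ) : T.dev .left q = T.strip q := rfl

lemma dev_bottom (q : ℝ × ℝ) : T.dev .bottom q = T.swap.strip q.swap := rfl

lemma box_subset_dev_source (i : TorusChart) : i.box ⊆ (T.dev i).source := by
  rintro ⟨x, y⟩ ⟨⟨h1, h2⟩, h3, h4⟩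
  cases i
  · simp only [TorusChart.corner] at h1 h2 h3 h4
    exact ⟨⟨by linarith, by linarith⟩, by linarith, by linarith⟩
  · simp only [TorusChart.corner] at h1 h2 h3 h4
    exact ⟨⟨by linarith, by linarith⟩, by linarith, by linarith⟩
  · simp only [TorusChart.corner] at h1 h2 h3 h4
    have : ((y, x) : ℝ × ℝ) ∈ openBox := ⟨⟨by linarith, by linarith⟩, by linarith, by linarith⟩
    simpa [dev, stripHomeo_source] using this

instance : Nonempty PuncturedTorus := ⟨torusBase⟩

lemma isOpenEmbedding_puncturedTorus_val :
    Topology.IsOpenEmbedding (Subtype.val : PuncturedTorus → Torus) :=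
  IsOpen.isOpenEmbedding_subtypeVal isOpen_ne

/-- The charts of the punctured torus. -/
def chart (i : TorusChart) : OpenPartialHomeomorph PuncturedTorus ℍ :=
  (isOpenEmbedding_puncturedTorus_val.toOpenPartialHomeomorph _).trans
    ((boxCoe i.corner.1 i.corner.2).symm.trans (T.dev i))

lemma chart_source (i : TorusChart) : (T.chart i).source = i.base := by
  ext p
  rw [chart, OpenPartialHomeomorph.trans_source, OpenPartialHomeomorph.trans_source]
  constructor
  · rintro ⟨-, h, -⟩
    exact h
  · intro h
    exact ⟨trivial, h, T.box_subset_dev_source i ((boxCoe i.corner.1 i.corner.2).map_target h)⟩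

lemma chart_apply {i : TorusChart} {q : ℝ × ℝ} (hq : q ∈ i.box) {p : PuncturedTorus}
    (h : p.1 = torusProj q) : T.chart i p = T.dev i q := by
  have : (boxCoe i.corner.1 i.corner.2).symm p.1 = q := by
    rw [h, ← boxCoe_apply i.corner.1 i.corner.2]
    exact (boxCoe i.corner.1 i.corner.2).left_inv hq
  rw [chart, OpenPartialHomeomorph.trans_apply, OpenPartialHomeomorph.trans_apply]
  exact congrArg (T.dev i) this

/-- A representation under which `X` and `Y` act on the hyperbolic plane by the side pairings of
the parallelogram. -/
def IsSidePairing (ρ : TorusGroup →* SL(2, ℝ)) : Prop :=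
  (∀ z : ℍ, ρ genX • z = halfTurn T.j • halfTurn T.m • z) ∧
    ∀ z : ℍ, ρ genY • z = halfTurn T.j • halfTurn T.n • z

/-- Over the square itself the strips extended to the left and to the bottom agree, so facts about
the bottom side follow from those about the left side by interchanging `m` and `n`. -/
lemma swap_strip {q : ℝ × ℝ} (h1 : 0 ≤ q.1) (h2 : 0 ≤ q.2) : T.swap.strip q.swap = T.strip q := by
  rw [strip, strip, stripVec_of_nonneg _ h1, stripVec_of_nonneg _ (by exact h2), ← T.swap_pt]
  congr 1
  simp only [quad, swap_a, swap_b, swap_c, Prod.fst_swap, Prod.snd_swap]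
  ext <;> simp; ring

lemma _root_.TorusChart.cocycle_left {p : PuncturedTorus} {q : ℝ × ℝ} (h : p.1 = torusProj q)
    (hq : q.1 ∈ Set.Ioo (0 : ℝ) 1) :
    TorusChart.left.cocycle p = if 1 / 2 < q.1 then genX⁻¹ else 1 := by
  simp only [TorusChart.cocycle, h, torusProj, unitAddCircle_coe_mem_iff hq]

lemma _root_.TorusChart.cocycle_bottom {p : PuncturedTorus} {q : ℝ × ℝ} (h : p.1 = torusProj q)
    (hq : q.2 ∈ Set.Ioo (0 : ℝ) 1) :
    TorusChart.bottom.cocycle p = if 1 / 2 < q.2 then genY⁻¹ else 1 := by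
  simp only [TorusChart.cocycle, h, torusProj, unitAddCircle_coe_mem_iff hq]

-- On the far half of the square the left (or bottom) chart uses the parameters translated by `-1`.
-- There its value is obtained by applying `MJ` (or `NJ`), the inverse of the action of `X` (or
-- `Y`).
variable {T} in
lemma chart_eq_cocycle_smul {ρ : TorusGroup →* SL(2, ℝ)} (hρ : T.IsSidePairing ρ)
    {i : TorusChart} {p : PuncturedTorus} (hi : p ∈ i.base) (hs : p ∈ TorusChart.square.base) :
    T.chart i p = ρ (i.cocycle p) • T.chart .square p := by
  obtain ⟨q, hq, hqp⟩ := TorusChart.mem_base_iff.1 hs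
  have hq' := hq
  obtain ⟨⟨h1, h2⟩, h3, h4⟩ := hq'
  simp only [TorusChart.corner] at h1 h2 h3 h4
  rw [zero_add] at h2 h4
  rw [T.chart_apply hq hqp.symm, dev_square]
  have hshift : ∀ z w : ℍ, halfTurn T.j • halfTurn z • halfTurn z • halfTurn T.j • w = w :=
    fun z w => by rw [halfTurn_smul_halfTurn_smul, halfTurn_smul_halfTurn_smul]
  cases i with
  | square =>
    rw [T.chart_apply hq hqp.symm, dev_square]
    simp [TorusChart.cocycle]
  | left =>
    rw [TorusChart.cocycle_left hqp.symm ⟨h1, h2⟩]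
    have hne : q.1 ≠ 1 / 2 := fun h => hi.1 (by
      rw [← hqp]; simp only [torusProj, h]; exact half_coe_eq)
    rcases hne.lt_or_gt with h | h
    · rw [if_neg h.le.not_gt, T.chart_apply (i := .left) (q := q) ?_ hqp.symm, dev_left]
      · simp
      · refine ⟨⟨?_, ?_⟩, ?_, ?_⟩ <;> simp only [TorusChart.corner] <;> linarith
    · rw [if_pos h, T.chart_apply (i := .left) (q := (q.1 - 1, q.2)) ?_ ?_, dev_left,
        T.strip_sub_one ⟨h1.le, h2.le⟩ ⟨h3.le, h4.le⟩, map_inv, eq_inv_smul_iff, hρ.1, hshift]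
      · refine ⟨⟨?_, ?_⟩, ?_, ?_⟩ <;> simp only [TorusChart.corner] <;> linarith
      · rw [← hqp]
        exact torusProj_eq_iff.2 ⟨⟨-1, by push_cast; ring⟩, 0, by simp⟩
  | bottom =>
    rw [TorusChart.cocycle_bottom hqp.symm ⟨h3, h4⟩]
    have hne : q.2 ≠ 1 / 2 := fun h => hi.2 (by
      rw [← hqp]; simp only [torusProj, h]; exact half_coe_eq)
    rcases hne.lt_or_gt with h | h
    · rw [if_neg h.le.not_gt, T.chart_apply (i := .bottom) (q := q) ?_ hqp.symm, dev_bottom,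
        T.swap_strip h1.le h3.le]
      · simp
      · refine ⟨⟨?_, ?_⟩, ?_, ?_⟩ <;> simp only [TorusChart.corner] <;> linarith
    · rw [if_pos h, T.chart_apply (i := .bottom) (q := (q.1, q.2 - 1)) ?_ ?_, dev_bottom,
        map_inv, eq_inv_smul_iff, hρ.2, ← T.swap_strip h1.le h3.le]
      · have := T.swap.strip_sub_one (q := q.swap) ⟨h3.le, h4.le⟩ ⟨h1.le, h2.le⟩
        simp only [Prod.fst_swap, Prod.snd_swap] at this
        rw [Prod.swap_prod_mk, this]
        exact hshift _ _
      · refine ⟨⟨?_, ?_⟩, ?_, ?_⟩ <;> simp only [TorusChart.corner] <;> linarith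
      · rw [← hqp]
        exact torusProj_eq_iff.2 ⟨⟨0, by simp⟩, -1, by push_cast; ring⟩

variable {T} in
lemma eventually_smul_chart_eq {ρ : TorusGroup →* SL(2, ℝ)} (hρ : T.IsSidePairing ρ)
    {i j : TorusChart} {p : PuncturedTorus} (hi : p ∈ i.base) (hj : p ∈ j.base) :
    ∀ᶠ y in 𝓝 p, T.chart i y = ρ (i.cocycle p * (j.cocycle p)⁻¹) • T.chart j y := by
  by_cases hij : i = j
  · subst hij
    simp
  · have hs := TorusChart.mem_square_of_mem hij hi hj
    filter_upwards [i.isOpen_base.mem_nhds hi, j.isOpen_base.mem_nhds hj,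
      (TorusChart.isOpen_base _).mem_nhds hs, TorusChart.eventually_cocycle_eq hi hs,
      TorusChart.eventually_cocycle_eq hj hs] with y hyi hyj hys h1 h2
    rw [chart_eq_cocycle_smul hρ hyi hys, chart_eq_cocycle_smul hρ hyj hys, h1, h2, ← mul_smul,
      ← map_mul, inv_mul_cancel_right]

/-- The hyperbolic structure on the punctured torus obtained from the parallelogram. -/
@[reducible]
def chartedSpace : ChartedSpace ℍ PuncturedTorus where
  atlas := Set.range T.chart
  chartAt p := T.chart (TorusChart.indexAt p)
  mem_chart_source p := by rw [chart_source]; exact TorusChart.mem_base_indexAt p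
  chart_mem_atlas p := ⟨_, rfl⟩

lemma exists_isSidePairing : ∃ ρ : TorusGroup →* SL(2, ℝ), T.IsSidePairing ρ :=
  ⟨FreeGroup.lift ![halfTurn T.j * halfTurn T.m, halfTurn T.j * halfTurn T.n],
    fun z => by simp [genX, mul_smul], fun z => by simp [genY, mul_smul]⟩

lemma smulChart_mem_maximalAtlas (g : SL(2, ℝ)) (i : TorusChart) :
    letI := T.chartedSpace
    smulChart g (T.chart i) ∈ hypGroupoid.maximalAtlas PuncturedTorus := by
  let := T.chartedSpace
  apply mem_maximalAtlas_of_smul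
  rintro _ ⟨j, rfl⟩ p hp hp'
  rw [smulChart_source, chart_source] at hp
  rw [chart_source] at hp'
  obtain ⟨ρ, hρ⟩ := T.exists_isSidePairing
  exact ⟨ρ (j.cocycle p * (i.cocycle p)⁻¹) * g⁻¹, (eventually_smul_chart_eq hρ hp' hp).mono
    fun y hy => by rw [hy, smulChart_apply, mul_smul, inv_smul_smul]⟩

lemma hasGroupoid :
    letI := T.chartedSpace
    HasGroupoid PuncturedTorus hypGroupoid := by
  let := T.chartedSpace
  refine ⟨?_⟩
  rintro _ _ ⟨i, rfl⟩ ⟨j, rfl⟩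
  apply symm_trans_mem_hypGroupoid
  intro p hp hp'
  rw [chart_source] at hp hp'
  obtain ⟨ρ, hρ⟩ := T.exists_isSidePairing
  exact ⟨_, eventually_smul_chart_eq hρ hp' hp⟩

/-! ### The holonomy -/

lemma torusBase_mem_square : torusBase ∈ TorusChart.square.base :=
  ⟨half_coe_ne_zero, half_coe_ne_zero⟩

variable {T} in
lemma isHolonomy {ρ : TorusGroup →* SL(2, ℝ)} (hρ : T.IsSidePairing ρ) :
    letI := T.chartedSpace
    IsHolonomy torusMarking ρ := by
  let := T.chartedSpace
  have hsrc : torusBase ∈ (smulChart 1 (T.chart .square)).source := by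
    rw [smulChart_source, chart_source]; exact torusBase_mem_square
  -- The factor `1` makes the continuation at time `0` equal to this chart as a partial
  -- homeomorphism, since the lift starts at `g 0 = 1`.
  refine ⟨smulChart 1 (T.chart .square), T.smulChart_mem_maximalAtlas _ _, hsrc, fun w γ hw => ?_⟩
  obtain ⟨g, hg, hg0, hg1⟩ := exists_lift_of_torusMarking_eq hw
  -- The lift is constant up to cocycle factors, and the charts change by `ρ` of the same factors;
  -- hence the germs of these charts fit together along the loop.
  refine ⟨fun t => smulChart (ρ (g t)) (T.chart (TorusChart.indexAt (γ t))), ?_, fun t =>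
    ⟨T.smulChart_mem_maximalAtlas _ _, ?_⟩, fun t => ?_, ?_⟩
  · simp only [hg0, map_one, γ.source, TorusChart.indexAt_of_mem torusBase_mem_square]
  · rw [smulChart_source, chart_source]; exact TorusChart.mem_base_indexAt _
  · obtain ⟨hγ, hgt⟩ := continuousAt_torusBundle_iff.1 (hg.continuousAt (x := t))
    filter_upwards [hgt, hγ.eventually ((TorusChart.isOpen_base _).mem_nhds
      (TorusChart.mem_base_indexAt (γ t)))] with s hs hbase
    filter_upwards [eventually_smul_chart_eq hρ (TorusChart.mem_base_indexAt (γ s)) hbase]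
      with y hy
    rw [smulChart_apply, smulChart_apply, hy, ← mul_smul, ← map_mul, ← mul_assoc, hs]
  · refine Filter.Eventually.of_forall fun y => ?_
    simp only [smulChart_apply, hg1, γ.target, one_smul,
      TorusChart.indexAt_of_mem torusBase_mem_square]

end MidpointTriple

/-! ### The parallelogram of a pair of matrices with elliptic commutator -/

lemma neg_smul_upperHalfPlane (g : SL(2, ℝ)) (z : ℍ) : (-g) • z = g • z := by
  apply symVec_injective
  rw [symVec_smul, symVec_smul, vecAct_neg]

lemma exists_sign_halfTurn (g : SL(2, ℝ)) (h : g 0 0 + g 1 1 = 0) :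
    ∃ (z : ℍ) (ε : ℝ), ε ^ 2 = 1 ∧ (∀ i k, g i k = ε * halfTurn z i k) ∧
      ∀ w : ℍ, g • w = halfTurn z • w := by
  obtain ⟨z, rfl | rfl⟩ := exists_halfTurn_of_trace_eq_zero g h
  · exact ⟨z, 1, by norm_num, fun i k => by ring, fun w => rfl⟩
  · refine ⟨z, -1, by norm_num, fun i k => ?_, fun w => neg_smul_upperHalfPlane _ _⟩
    rw [Matrix.SpecialLinearGroup.coe_neg, Matrix.neg_apply]; ring

/-- Fricke's identity `x² + y² + z² - xyz - 2`, where `z` is the trace of `g * h`. -/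
lemma trace_commutator (g h : SL(2, ℝ)) :
    ((g * h * g⁻¹ * h⁻¹ : SL(2, ℝ)) : Matrix (Fin 2) (Fin 2) ℝ).trace =
      (g 0 0 + g 1 1) ^ 2 + (h 0 0 + h 1 1) ^ 2 +
        (g 0 0 * h 0 0 + g 0 1 * h 1 0 + g 1 0 * h 0 1 + g 1 1 * h 1 1) ^ 2 -
        (g 0 0 + g 1 1) * (h 0 0 + h 1 1) *
          (g 0 0 * h 0 0 + g 0 1 * h 1 0 + g 1 0 * h 0 1 + g 1 1 * h 1 1) - 2 := by
  have hg := SL2_det g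
  have hh := SL2_det h
  simp only [Matrix.trace_fin_two, Matrix.SpecialLinearGroup.coe_mul,
    Matrix.SpecialLinearGroup.coe_inv, Matrix.adjugate_fin_two, Matrix.mul_apply,
    Fin.sum_univ_two, Matrix.of_apply, Matrix.cons_val', Matrix.cons_val_zero,
    Matrix.cons_val_one, Matrix.cons_val_fin_one]
  generalize g 0 0 = a at *
  generalize g 0 1 = b at *
  generalize g 1 0 = c at *
  generalize g 1 1 = d at *
  generalize h 0 0 = a' at *
  generalize h 0 1 = b' at *
  generalize h 1 0 = c' at *
  generalize h 1 1 = d' at *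
  linear_combination ((a' + d') ^ 2 - 2 * (a' * d' - b' * c')) * hg + ((a + d) ^ 2 - 2) * hh

lemma inv_mul_trace (u g : SL(2, ℝ)) : (u⁻¹ * g) 0 0 + (u⁻¹ * g) 1 1 =
    u 1 1 * g 0 0 - u 0 1 * g 1 0 - u 1 0 * g 0 1 + u 0 0 * g 1 1 := by
  simp only [Matrix.SpecialLinearGroup.coe_mul, Matrix.SpecialLinearGroup.coe_inv,
    Matrix.adjugate_fin_two, Matrix.mul_apply, Fin.sum_univ_two, Matrix.of_apply,
    Matrix.cons_val', Matrix.cons_val_zero, Matrix.cons_val_one, Matrix.cons_val_fin_one]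
  ring

/-- The element is the bracket `gh - hg` divided by the root of its determinant, which equals two
minus the trace of the commutator. The inverse of a traceless `u` of determinant one is `-u`, and
the bracket times `g` or `h` has trace zero by cyclicity. -/
lemma exists_commuting_half_turn (g h : SL(2, ℝ))
    (ht : ((g * h * g⁻¹ * h⁻¹ : SL(2, ℝ)) : Matrix (Fin 2) (Fin 2) ℝ).trace < 2) :
    ∃ u : SL(2, ℝ), u 0 0 + u 1 1 = 0 ∧ (u⁻¹ * g) 0 0 + (u⁻¹ * g) 1 1 = 0 ∧
      (u⁻¹ * h) 0 0 + (u⁻¹ * h) 1 1 = 0 := by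
  rw [trace_commutator] at ht
  have hg := SL2_det g
  have hh := SL2_det h
  obtain ⟨u, hu⟩ : ∃ u, u = g 0 1 * h 1 0 - h 0 1 * g 1 0 := ⟨_, rfl⟩
  obtain ⟨v, hv⟩ : ∃ v, v = g 0 0 * h 0 1 + g 0 1 * h 1 1 - h 0 0 * g 0 1 - h 0 1 * g 1 1 :=
    ⟨_, rfl⟩
  obtain ⟨w, hw⟩ : ∃ w, w = g 1 0 * h 0 0 + g 1 1 * h 1 0 - h 1 0 * g 0 0 - h 1 1 * g 1 0 :=
    ⟨_, rfl⟩
  have hpos : 0 < -u ^ 2 - v * w := by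
    have : -u ^ 2 - v * w = 2 - ((g 0 0 + g 1 1) ^ 2 + (h 0 0 + h 1 1) ^ 2 +
        (g 0 0 * h 0 0 + g 0 1 * h 1 0 + g 1 0 * h 0 1 + g 1 1 * h 1 1) ^ 2 -
        (g 0 0 + g 1 1) * (h 0 0 + h 1 1) *
          (g 0 0 * h 0 0 + g 0 1 * h 1 0 + g 1 0 * h 0 1 + g 1 1 * h 1 1) - 2) := by
      rw [hu, hv, hw]
      generalize g 0 0 = a at *
      generalize g 0 1 = b at *
      generalize g 1 0 = c at *
      generalize g 1 1 = d at *
      generalize h 0 0 = a' at *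
      generalize h 0 1 = b' at *
      generalize h 1 0 = c' at *
      generalize h 1 1 = d' at *
      linear_combination (-(a' + d') ^ 2 + 4 * (a' * d' - b' * c')) * hg + (-(a + d) ^ 2 + 4) * hh
    linarith
  set r := √(-u ^ 2 - v * w) with hr
  have hr0 : r ≠ 0 := (Real.sqrt_pos.2 hpos).ne'
  have hr2 : r ^ 2 = -u ^ 2 - v * w := Real.sq_sqrt hpos.le
  obtain ⟨U, h00, h01, h10, h11⟩ : ∃ U : SL(2, ℝ),
      U 0 0 = u / r ∧ U 0 1 = v / r ∧ U 1 0 = w / r ∧ U 1 1 = -u / r := by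
    refine ⟨⟨!![u / r, v / r; w / r, -u / r], ?_⟩, rfl, rfl, rfl, rfl⟩
    have : u / r * (-u / r) - v / r * (w / r) = (-u ^ 2 - v * w) / r ^ 2 := by ring
    rw [Matrix.det_fin_two_of, this, hr2, div_self hpos.ne']
  refine ⟨U, by rw [h00, h11]; ring, ?_, ?_⟩
  all_goals
    rw [inv_mul_trace, h00, h01, h10, h11, hu, hv, hw]
    ring

lemma trace_halfTurn_mul (z w : ℍ) :
    halfTurn z 0 0 * halfTurn w 0 0 + halfTurn z 0 1 * halfTurn w 1 0 +
      (halfTurn z 1 0 * halfTurn w 0 1 + halfTurn z 1 1 * halfTurn w 1 1) =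
      -2 * hypForm (symVec z) (symVec w) := by
  simp [halfTurn, hypForm]; ring

lemma trace_halfTurn_mul_halfTurn_mul (z w x : ℍ) :
    (halfTurn z * halfTurn w) 0 0 * (halfTurn z * halfTurn x) 0 0 +
      (halfTurn z * halfTurn w) 0 1 * (halfTurn z * halfTurn x) 1 0 +
      (halfTurn z * halfTurn w) 1 0 * (halfTurn z * halfTurn x) 0 1 +
      (halfTurn z * halfTurn w) 1 1 * (halfTurn z * halfTurn x) 1 1 =
      4 * hypForm (symVec z) (symVec x) * hypForm (symVec w) (symVec z) -
        2 * hypForm (symVec w) (symVec x) := by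
  have h := hypForm_symVec z
  simp only [Matrix.SpecialLinearGroup.coe_mul, Matrix.mul_apply, Fin.sum_univ_two]
  simp only [halfTurn, hypForm, Matrix.of_apply, Matrix.cons_val', Matrix.cons_val_zero,
    Matrix.cons_val_one, Matrix.cons_val_fin_one] at h ⊢
  generalize symVec z = v at *
  generalize symVec w = w at *
  generalize symVec x = x at *
  linear_combination (-(w.1 * x.2.2 + w.2.2 * x.1) + 2 * w.2.1 * x.2.1) * h

lemma exists_midpointTriple (ξ η : SL(2, ℝ))
    (h : |((ξ * η * ξ⁻¹ * η⁻¹ : SL(2, ℝ)) : Matrix (Fin 2) (Fin 2) ℝ).trace| < 2) :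
    ∃ T : MidpointTriple, (∀ z : ℍ, ξ • z = halfTurn T.j • halfTurn T.m • z) ∧
      (∀ z : ℍ, η • z = halfTurn T.j • halfTurn T.n • z) ∧
      ((ξ * η * ξ⁻¹ * η⁻¹ : SL(2, ℝ)) : Matrix (Fin 2) (Fin 2) ℝ).trace = 2 - 4 * T.gramDet := by
  obtain ⟨h1, h2⟩ := abs_lt.1 h
  obtain ⟨u, hu, hum, hun⟩ := exists_commuting_half_turn ξ η h2
  obtain ⟨j, εj, hεj, hj, hjz⟩ := exists_sign_halfTurn u hu
  obtain ⟨m, εm, hεm, hm, hmz⟩ := exists_sign_halfTurn _ hum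
  obtain ⟨n, εn, hεn, hn, hnz⟩ := exists_sign_halfTurn _ hun
  have hξ : ∀ i k, ξ i k = εj * εm * (halfTurn j * halfTurn m) i k := fun i k => by
    have : ξ = u * (u⁻¹ * ξ) := by group
    rw [this]
    simp only [Matrix.SpecialLinearGroup.coe_mul u, Matrix.mul_apply, Fin.sum_univ_two, hj, hm,
      Matrix.SpecialLinearGroup.coe_mul (halfTurn j)]
    ring
  have hη : ∀ i k, η i k = εj * εn * (halfTurn j * halfTurn n) i k := fun i k => by
    have : η = u * (u⁻¹ * η) := by group
    rw [this]
    simp only [Matrix.SpecialLinearGroup.coe_mul u, Matrix.mul_apply, Fin.sum_univ_two, hj, hn,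
      Matrix.SpecialLinearGroup.coe_mul (halfTurn j)]
    ring
  have ht1 : ξ 0 0 + ξ 1 1 = εj * εm * (-2 * hypForm (symVec m) (symVec j)) := by
    rw [hξ, hξ, hypForm_comm, ← trace_halfTurn_mul]
    simp only [Matrix.SpecialLinearGroup.coe_mul, Matrix.mul_apply, Fin.sum_univ_two]
    ring
  have ht2 : η 0 0 + η 1 1 = εj * εn * (-2 * hypForm (symVec j) (symVec n)) := by
    rw [hη, hη, ← trace_halfTurn_mul]
    simp only [Matrix.SpecialLinearGroup.coe_mul, Matrix.mul_apply, Fin.sum_univ_two]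
    ring
  have ht3 : ξ 0 0 * η 0 0 + ξ 0 1 * η 1 0 + ξ 1 0 * η 0 1 + ξ 1 1 * η 1 1 =
      εm * εn * (4 * hypForm (symVec j) (symVec n) * hypForm (symVec m) (symVec j)
        - 2 * hypForm (symVec m) (symVec n)) := by
    rw [← trace_halfTurn_mul_halfTurn_mul, hξ, hξ, hξ, hξ, hη, hη, hη, hη]
    linear_combination (εm * εn * ((halfTurn j * halfTurn m) 0 0 * (halfTurn j * halfTurn n) 0 0 +
      (halfTurn j * halfTurn m) 0 1 * (halfTurn j * halfTurn n) 1 0 +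
      (halfTurn j * halfTurn m) 1 0 * (halfTurn j * halfTurn n) 0 1 +
      (halfTurn j * halfTurn m) 1 1 * (halfTurn j * halfTurn n) 1 1)) * hεj
  have htr : ((ξ * η * ξ⁻¹ * η⁻¹ : SL(2, ℝ)) : Matrix (Fin 2) (Fin 2) ℝ).trace =
      2 - 4 * (1 + 2 * hypForm (symVec m) (symVec n) * hypForm (symVec j) (symVec n) *
        hypForm (symVec m) (symVec j) - hypForm (symVec m) (symVec n) ^ 2 -
        hypForm (symVec j) (symVec n) ^ 2 - hypForm (symVec m) (symVec j) ^ 2) := by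
    -- The three traces are `2c`, `2b` and `4bc - 2a` up to signs; each sign occurs an even number
    -- of times in Fricke's polynomial.
    rw [trace_commutator, ht1, ht2, ht3]
    generalize hypForm (symVec m) (symVec n) = a
    generalize hypForm (symVec j) (symVec n) = b
    generalize hypForm (symVec m) (symVec j) = c
    have e1 : (εj * εm * (-2 * c)) ^ 2 = 4 * c ^ 2 := by
      rw [mul_pow, mul_pow, hεj, hεm]; ring
    have e2 : (εj * εn * (-2 * b)) ^ 2 = 4 * b ^ 2 := by
      rw [mul_pow, mul_pow, hεj, hεn]; ring
    have e3 : (εm * εn * (4 * b * c - 2 * a)) ^ 2 = (4 * b * c - 2 * a) ^ 2 := by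
      rw [mul_pow, mul_pow, hεm, hεn]; ring
    have e4 : εj * εm * (-2 * c) * (εj * εn * (-2 * b)) * (εm * εn * (4 * b * c - 2 * a)) =
        4 * c * b * (4 * b * c - 2 * a) := by
      have : εj * εm * (-2 * c) * (εj * εn * (-2 * b)) * (εm * εn * (4 * b * c - 2 * a)) =
        εj ^ 2 * εm ^ 2 * εn ^ 2 * (4 * c * b * (4 * b * c - 2 * a)) := by ring
      rw [this, hεj, hεm, hεn]; ring
    rw [e1, e2, e3, e4]; ring
  -- The bounds `tr < 2` and `tr > -2` are the two conditions on the Gram determinant.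
  refine ⟨⟨m, n, j, by linarith, by linarith⟩, fun z => ?_, fun z => ?_, htr⟩
  · rw [← hmz, ← hjz, ← mul_smul, mul_inv_cancel_left]
  · rw [← hnz, ← hjz, ← mul_smul, mul_inv_cancel_left]

namespace MidpointTriple
variable (T : MidpointTriple)

/-! ### Polar coordinates about the vertex of the parallelogram -/

/-- The sine of a quarter of the cone angle. -/
def sinQuarter : ℝ := √(1 - T.gramDet)

/-- The cosine of a quarter of the cone angle. -/
def cosQuarter : ℝ := √T.gramDet

/-- The hyperbolic sine of the distance of the midpoint of the bottom side from the vertex,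
multiplied by `T.sinQuarter`. -/
def sideLength : ℝ := √(T.c ^ 2 - (1 - T.gramDet))

/-- Half of the cone angle. -/
def halfAngle : ℝ := Real.arccos (2 * T.gramDet - 1)

lemma sinQuarter_pos : 0 < T.sinQuarter := Real.sqrt_pos.2 (sub_pos.2 T.gramDet_lt_one)

lemma cosQuarter_pos : 0 < T.cosQuarter := Real.sqrt_pos.2 T.gramDet_pos

lemma sinQuarter_sq : T.sinQuarter ^ 2 = T.a ^ 2 + T.b ^ 2 + T.c ^ 2 - 2 * T.a * T.b * T.c := by
  rw [sinQuarter, Real.sq_sqrt (sub_pos.2 T.gramDet_lt_one).le, gramDet]; ring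

lemma cosQuarter_sq : T.cosQuarter ^ 2 = 1 - T.sinQuarter ^ 2 := by
  rw [cosQuarter, sinQuarter, Real.sq_sqrt T.gramDet_pos.le,
    Real.sq_sqrt (sub_pos.2 T.gramDet_lt_one).le]; ring

lemma sideLength_radicand_pos : 0 < T.c ^ 2 - (1 - T.gramDet) := by
  nlinarith [T.one_le_c, T.gramDet_pos]

lemma sideLength_pos : 0 < T.sideLength := Real.sqrt_pos.2 T.sideLength_radicand_pos

lemma sideLength_sq : T.sideLength ^ 2 = T.c ^ 2 - T.sinQuarter ^ 2 := by
  rw [sideLength, Real.sq_sqrt T.sideLength_radicand_pos.le, sinQuarter,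
    Real.sq_sqrt (sub_pos.2 T.gramDet_lt_one).le]

lemma cos_halfAngle : Real.cos T.halfAngle = 1 - 2 * T.sinQuarter ^ 2 := by
  rw [halfAngle, Real.cos_arccos (by linarith [T.gramDet_pos]) (by linarith [T.gramDet_lt_one]),
    sinQuarter, Real.sq_sqrt (sub_pos.2 T.gramDet_lt_one).le]
  ring

lemma sin_halfAngle : Real.sin T.halfAngle = 2 * T.sinQuarter * T.cosQuarter := by
  have h1 := T.sinQuarter_pos
  have h2 := T.cosQuarter_pos
  have h3 := Real.sin_sq_add_cos_sq T.halfAngle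
  rw [cos_halfAngle] at h3
  have h4 := Real.sin_nonneg_of_nonneg_of_le_pi (Real.arccos_nonneg (2 * T.gramDet - 1))
    (Real.arccos_le_pi _)
  refine (pow_left_inj₀ h4 (by positivity) two_ne_zero).1 ?_
  change Real.sin T.halfAngle ^ 2 = _
  rw [mul_pow, cosQuarter_sq]
  linear_combination h3

lemma halfAngle_pos : 0 < T.halfAngle := Real.arccos_pos.2 (by linarith [T.gramDet_lt_one])

/-- The wedge spanned at the vertex by the two copies is less than a half-plane, so it is cut out by
two linear inequalities. -/
lemma halfAngle_lt_pi : T.halfAngle < Real.pi := by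
  refine (Real.arccos_le_pi _).lt_of_ne fun h => ?_
  have h1 := T.sin_halfAngle
  rw [halfAngle, h, Real.sin_pi] at h1
  have := mul_pos (mul_pos two_pos T.sinQuarter_pos) T.cosQuarter_pos
  linarith

/-- The unit vector over the vertex. -/
def apex : ℝ × ℝ × ℝ := T.sinQuarter⁻¹ • (T.b, T.c, -T.a)

/-- The unit tangent vector at the vertex along the bottom side. -/
def dirBot : ℝ × ℝ × ℝ := (T.sinQuarter * T.sideLength)⁻¹ •
  -- Gram–Schmidt: a positive multiple of the vector of `n` minus its projection to the apex.
  (-T.c * T.b, T.sinQuarter ^ 2 - T.c ^ 2, T.c * T.a)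

/-- The unit tangent vector at the vertex orthogonal to the bottom side. -/
def dirPerp : ℝ × ℝ × ℝ := (T.cosQuarter * T.sideLength)⁻¹ •
  -- A multiple of the vector that represents `lBot` with respect to the form, with the sign for
  -- which `lBot` is positive on it.
  (T.b * T.c - T.a, T.sinQuarter ^ 2 - T.c ^ 2, T.a * T.c - T.b)

lemma form_smul_left (t : ℝ) (v w : ℝ × ℝ × ℝ) : T.form (t • v) w = t * T.form v w := by
  rw [← hypForm_toVec, ← hypForm_toVec, map_smul, hypForm_smul_left]

lemma form_smul_right (t : ℝ) (v w : ℝ × ℝ × ℝ) : T.form v (t • w) = t * T.form v w := by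
  rw [← hypForm_toVec, ← hypForm_toVec, map_smul, hypForm_smul_right]

lemma form_add_left (u v w : ℝ × ℝ × ℝ) : T.form (u + v) w = T.form u w + T.form v w := by
  simp only [← hypForm_toVec, map_add, hypForm_add_left]

lemma form_comm (v w : ℝ × ℝ × ℝ) : T.form v w = T.form w v := by
  rw [← hypForm_toVec, hypForm_comm, hypForm_toVec]

lemma form_apex_apex : T.form T.apex T.apex = 1 := by
  have h := T.sinQuarter_pos.ne'
  have h2 := T.sinQuarter_sq
  rw [apex, form_smul_left, form_smul_right]
  have : T.form (T.b, T.c, -T.a) (T.b, T.c, -T.a) = T.sinQuarter ^ 2 := by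
    rw [h2]; simp only [form]; ring
  rw [this]; field_simp

lemma form_dirBot_dirBot : T.form T.dirBot T.dirBot = -1 := by
  have h := T.sinQuarter_pos.ne'
  have h1 := T.sideLength_pos.ne'
  have h2 := T.sinQuarter_sq
  have h3 := T.sideLength_sq
  rw [dirBot, form_smul_left, form_smul_right]
  have : T.form (-T.c * T.b, T.sinQuarter ^ 2 - T.c ^ 2, T.c * T.a)
      (-T.c * T.b, T.sinQuarter ^ 2 - T.c ^ 2, T.c * T.a) =
      -(T.sinQuarter * T.sideLength) ^ 2 := by
    rw [mul_pow, h3, h2]; simp only [form]; ring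
  rw [this]; field_simp

lemma form_dirPerp_dirPerp : T.form T.dirPerp T.dirPerp = -1 := by
  have h := T.cosQuarter_pos.ne'
  have h1 := T.sideLength_pos.ne'
  have h2 := T.sinQuarter_sq
  have h3 := T.sideLength_sq
  have h4 := T.cosQuarter_sq
  rw [dirPerp, form_smul_left, form_smul_right]
  have : T.form (T.b * T.c - T.a, T.sinQuarter ^ 2 - T.c ^ 2, T.a * T.c - T.b)
      (T.b * T.c - T.a, T.sinQuarter ^ 2 - T.c ^ 2, T.a * T.c - T.b) =
      -(T.cosQuarter * T.sideLength) ^ 2 := by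
    rw [mul_pow, h3, h4, h2]; simp only [form]; ring
  rw [this]; field_simp

lemma form_apex_dirBot : T.form T.apex T.dirBot = 0 := by
  rw [apex, dirBot, form_smul_left, form_smul_right, mul_eq_zero, mul_eq_zero]
  right; right
  rw [sinQuarter_sq]; simp only [form]; ring

lemma form_apex_dirPerp : T.form T.apex T.dirPerp = 0 := by
  rw [apex, dirPerp, form_smul_left, form_smul_right, mul_eq_zero, mul_eq_zero]
  right; right
  rw [sinQuarter_sq]; simp only [form]; ring

lemma form_dirBot_dirPerp : T.form T.dirBot T.dirPerp = 0 := by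
  rw [dirBot, dirPerp, form_smul_left, form_smul_right, mul_eq_zero, mul_eq_zero]
  right; right
  rw [sinQuarter_sq]; simp only [form]; ring

lemma lBot_add (v w : ℝ × ℝ × ℝ) : T.lBot (v + w) = T.lBot v + T.lBot w := by
  simp [lBot]; ring

lemma lBot_apex : T.lBot T.apex = 0 := by
  rw [apex, lBot_smul, mul_eq_zero]; right; simp only [lBot]; ring

lemma lBot_dirBot : T.lBot T.dirBot = 0 := by
  rw [dirBot, lBot_smul, mul_eq_zero]; right; simp only [lBot]; ring

lemma lBot_dirPerp : T.lBot T.dirPerp = T.sideLength / T.cosQuarter := by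
  have h := T.cosQuarter_pos.ne'
  have h1 := T.sideLength_pos.ne'
  have : T.lBot (T.b * T.c - T.a, T.sinQuarter ^ 2 - T.c ^ 2, T.a * T.c - T.b) =
    T.sideLength ^ 2 := by rw [sideLength_sq, sinQuarter_sq]; simp only [lBot]; ring
  rw [dirPerp, lBot_smul, this]; field_simp

/-- The rotation about the vertex by half of the cone angle. -/
def rot : (ℝ × ℝ × ℝ) →ₗ[ℝ] (ℝ × ℝ × ℝ) := T.turnM ∘ₗ T.turnJ ∘ₗ T.turnN

lemma rot_apply (v : ℝ × ℝ × ℝ) : T.rot v = T.turnM (T.turnJ (T.turnN v)) := rfl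

lemma rot_apex : T.rot T.apex = T.apex := by
  rw [apex, map_smul, rot_apply]
  congr 1
  have : (T.b, T.c, -T.a) = T.quad 0 0 := by simp [quad]
  rw [this, turnN_quad, turnJ_quad]
  simp only [sub_zero, sub_self]
  rw [turnM_quad]; simp

/-- With `cos (θ/2) = 1 - 2s²` and `sin (θ/2) = 2s √(1 - s²)`, where `s = sinQuarter`, a common
factor splits off and a polynomial identity remains. -/
lemma rot_dirBot : T.rot T.dirBot =
    Real.cos T.halfAngle • T.dirBot + Real.sin T.halfAngle • T.dirPerp := by
  have h := T.cosQuarter_pos.ne'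
  have h1 := T.sideLength_pos.ne'
  have h2 := T.sinQuarter_pos.ne'
  rw [cos_halfAngle, sin_halfAngle, dirBot, dirPerp, map_smul, smul_smul, smul_smul]
  have e : 2 * T.sinQuarter * T.cosQuarter * (T.cosQuarter * T.sideLength)⁻¹ =
      2 * T.sinQuarter ^ 2 * (T.sinQuarter * T.sideLength)⁻¹ := by field_simp
  rw [e]
  generalize (T.sinQuarter * T.sideLength)⁻¹ = t
  rw [mul_comm _ t, mul_comm _ t, mul_smul, mul_smul, ← smul_add]
  congr 1
  rw [rot_apply]
  have := T.sinQuarter_sq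
  ext
  · simp [turnM_apply, turnJ_apply, turnN_apply]; rw [this]; ring
  · simp [turnM_apply, turnJ_apply, turnN_apply]; rw [this]; ring
  · simp [turnM_apply, turnJ_apply, turnN_apply]; rw [this]; ring

lemma rot_dirPerp : T.rot T.dirPerp =
    -Real.sin T.halfAngle • T.dirBot + Real.cos T.halfAngle • T.dirPerp := by
  have h := T.cosQuarter_pos.ne'
  have h1 := T.sideLength_pos.ne'
  have h2 := T.sinQuarter_pos.ne'
  rw [cos_halfAngle, sin_halfAngle, dirBot, dirPerp, map_smul, smul_smul, smul_smul]
  have e : -(2 * T.sinQuarter * T.cosQuarter) * (T.sinQuarter * T.sideLength)⁻¹ =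
      -(2 * (1 - T.sinQuarter ^ 2)) * (T.cosQuarter * T.sideLength)⁻¹ := by
    rw [← cosQuarter_sq]; field_simp
  rw [e]
  generalize (T.cosQuarter * T.sideLength)⁻¹ = t
  rw [mul_comm _ t, mul_comm _ t, mul_smul, mul_smul, ← smul_add]
  congr 1
  rw [rot_apply]
  have := T.sinQuarter_sq
  ext
  · simp [turnM_apply, turnJ_apply, turnN_apply]; rw [this]; ring
  · simp [turnM_apply, turnJ_apply, turnN_apply]; rw [this]; ring
  · simp [turnM_apply, turnJ_apply, turnN_apply]; rw [this]; ring

/-! ### Polar coordinates in the hyperboloid model. -/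

/-- The unit vector with the given polar coordinates about the vertex. -/
def polarVec (q : ℝ × ℝ) : ℝ × ℝ × ℝ := Real.cosh q.1 • T.apex +
  Real.sinh q.1 • (Real.cos q.2 • T.dirBot + Real.sin q.2 • T.dirPerp)

lemma continuous_polarVec : Continuous T.polarVec := by
  unfold polarVec
  have h1 : Continuous Real.cosh := Real.continuous_cosh
  have h2 : Continuous Real.sinh := Real.continuous_sinh
  fun_prop

lemma form_comb (x y z : ℝ) (w : ℝ × ℝ × ℝ) :
    T.form (x • T.apex + (y • T.dirBot + z • T.dirPerp)) w =
      x * T.form T.apex w + (y * T.form T.dirBot w + z * T.form T.dirPerp w) := by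
  simp only [form_add_left, form_smul_left]

lemma form_comb_comb (x y z x' y' z' : ℝ) :
    T.form (x • T.apex + (y • T.dirBot + z • T.dirPerp))
      (x' • T.apex + (y' • T.dirBot + z' • T.dirPerp)) = x * x' - y * y' - z * z' := by
  rw [form_comb, form_comm _ T.apex, form_comm _ T.dirBot, form_comm _ T.dirPerp]
  simp only [form_comb]
  rw [form_comm _ T.dirBot T.apex, form_comm _ T.dirPerp T.apex, form_comm _ T.dirPerp T.dirBot,
    form_apex_apex, form_apex_dirBot, form_apex_dirPerp, form_dirBot_dirBot, form_dirBot_dirPerp,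
    form_dirPerp_dirPerp]
  ring

lemma polarVec_eq (q : ℝ × ℝ) : T.polarVec q = Real.cosh q.1 • T.apex +
    ((Real.sinh q.1 * Real.cos q.2) • T.dirBot + (Real.sinh q.1 * Real.sin q.2) • T.dirPerp) := by
  rw [polarVec, smul_add, smul_smul, smul_smul]

lemma comb_injective {x y z x' y' z' : ℝ}
    (h : x • T.apex + (y • T.dirBot + z • T.dirPerp) =
      x' • T.apex + (y' • T.dirBot + z' • T.dirPerp)) : x = x' ∧ y = y' ∧ z = z' := by
  have key : ∀ u v w, x * u - y * v - z * w = x' * u - y' * v - z' * w := fun u v w => by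
    rw [← T.form_comb_comb, h, T.form_comb_comb]
  refine ⟨?_, ?_, ?_⟩
  · linarith [key 1 0 0]
  · linarith [key 0 1 0]
  · linarith [key 0 0 1]

lemma exists_comb (v : ℝ × ℝ × ℝ) :
    ∃ x y z : ℝ, v = x • T.apex + (y • T.dirBot + z • T.dirPerp) := by
  let F : (ℝ × ℝ × ℝ) →ₗ[ℝ] (ℝ × ℝ × ℝ) :=
    { toFun := fun u => u.1 • T.apex + (u.2.1 • T.dirBot + u.2.2 • T.dirPerp)
      map_add' := fun u w => by simp only [Prod.fst_add, Prod.snd_add]; module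
      map_smul' := fun t u => by
        simp only [Prod.smul_fst, Prod.smul_snd, smul_eq_mul, RingHom.id_apply]; module }
  have hF : Function.Injective F := fun u w h => by
    obtain ⟨h1, h2, h3⟩ := T.comb_injective h
    exact Prod.ext h1 (Prod.ext h2 h3)
  obtain ⟨u, hu⟩ := LinearMap.injective_iff_surjective.1 hF v
  exact ⟨u.1, u.2.1, u.2.2, hu.symm⟩

lemma form_polarVec_polarVec (q : ℝ × ℝ) : T.form (T.polarVec q) (T.polarVec q) = 1 := by
  rw [polarVec_eq, form_comb_comb]
  have h1 := Real.cosh_sq q.1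
  have h2 := Real.sin_sq_add_cos_sq q.2
  linear_combination h1 - Real.sinh q.1 ^ 2 * h2

lemma form_polarVec_apex (q : ℝ × ℝ) : T.form (T.polarVec q) T.apex = Real.cosh q.1 := by
  rw [polarVec_eq, form_comb, form_apex_apex, form_comm _ T.dirBot, form_apex_dirBot,
    form_comm _ T.dirPerp, form_apex_dirPerp]
  ring

lemma apex_mem : T.apex ∈ T.cone := by
  have : T.apex = T.sinQuarter⁻¹ • T.quad 0 0 := by simp [quad, apex]
  rw [this]
  exact T.smul_mem_cone (inv_pos.2 T.sinQuarter_pos) (T.quad_mem (by norm_num) (by norm_num))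

lemma mem_cone_of_form_apex {v : ℝ × ℝ × ℝ} (h1 : 0 < T.form v v) (h2 : 0 < T.form v T.apex) :
    v ∈ T.cone := by
  rw [← hypForm_toVec] at h1 h2
  exact mem_posCone_of_hypForm_pos T.apex_mem h1 h2

lemma polarVec_mem (q : ℝ × ℝ) : T.polarVec q ∈ T.cone := by
  apply mem_cone_of_form_apex
  · rw [form_polarVec_polarVec]; exact one_pos
  · rw [form_polarVec_apex]; exact Real.cosh_pos _

lemma rot_polarVec (r φ : ℝ) : T.rot (T.polarVec (r, φ)) = T.polarVec (r, φ + T.halfAngle) := by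
  simp only [polarVec, map_add, map_smul, rot_apex, rot_dirBot, rot_dirPerp, Real.cos_add,
    Real.sin_add]
  module

lemma lBot_polarVec (q : ℝ × ℝ) : T.lBot (T.polarVec q) =
    Real.sinh q.1 * Real.sin q.2 * (T.sideLength / T.cosQuarter) := by
  simp only [polarVec_eq, lBot_add, lBot_smul, lBot_apex, lBot_dirBot, lBot_dirPerp]; ring

/-- This form vanishes on the second edge of the wedge, the bottom side of the second copy. Up to
sign it is `lBot` composed with the inverse of `rot`. -/
lemma lTop_turnM_polarVec (q : ℝ × ℝ) : T.lTop (T.turnM (T.polarVec q)) =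
    Real.sinh q.1 * Real.sin (T.halfAngle - q.2) * (T.sideLength / T.cosQuarter) := by
  have : T.polarVec q = T.rot (T.polarVec (q.1, q.2 - T.halfAngle)) := by
    rw [rot_polarVec, sub_add_cancel]
  rw [this, lTop, rot_apply, turnM_turnM, turnJ_turnJ, lBot_turnN, lBot_polarVec, ← neg_sub,
    Real.sin_neg]
  ring

/-- The forms of the two edges of the wedge and of the left side all vanish at the vertex, hence are
dependent. Positivity of the coefficients lets the sign of `lLeft` and one edge control the other
edge. -/
lemma a_mul_lTop_turnM (v : ℝ × ℝ × ℝ) : T.a * T.lTop (T.turnM v) =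
    (2 * T.b * T.c - T.a) * T.lBot v + 2 * T.sideLength ^ 2 * T.lLeft v := by
  rw [sideLength_sq, sinQuarter_sq]
  simp only [lTop, lBot, lLeft, turnM_apply, turnJ_apply]; ring

lemma exists_polarVec_eq {v : ℝ × ℝ × ℝ} (hv : v ∈ T.cone) (h1 : T.form v v = 1) :
    ∃ r φ : ℝ, 0 ≤ r ∧ φ ∈ Set.Ioc (-Real.pi) Real.pi ∧ T.polarVec (r, φ) = v := by
  obtain ⟨x, y, z, rfl⟩ := T.exists_comb v
  rw [form_comb_comb] at h1
  have hx : 0 < x := by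
    have := hypForm_pos hv T.apex_mem
    rw [hypForm_toVec, form_comb, form_apex_apex, form_comm _ T.dirBot, form_apex_dirBot,
      form_comm _ T.dirPerp, form_apex_dirPerp] at this
    linarith
  set w : ℂ := ⟨y, z⟩ with hw
  have hn : ‖w‖ ^ 2 = y ^ 2 + z ^ 2 := by
    rw [Complex.sq_norm, Complex.normSq_apply]; ring
  refine ⟨Real.arsinh ‖w‖, w.arg, Real.arsinh_nonneg_iff.2 (norm_nonneg _), w.arg_mem_Ioc, ?_⟩
  have hc : √(1 + ‖w‖ ^ 2) = x := by
    rw [hn, ← Real.sqrt_sq hx.le]; congr 1; linarith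
  rw [polarVec_eq]
  simp only [Real.sinh_arsinh, Real.cosh_arsinh, hc, Complex.norm_mul_cos_arg,
    Complex.norm_mul_sin_arg]
  rfl

lemma polarVec_injective {r s φ ψ : ℝ} (hr : 0 < r) (hs : 0 < s)
    (h : T.polarVec (r, φ) = T.polarVec (s, ψ)) :
    r = s ∧ Real.cos φ = Real.cos ψ := by
  rw [polarVec_eq, polarVec_eq] at h
  obtain ⟨h1, h2, -⟩ := T.comb_injective h
  have hrs : r = s := by
    exact Real.cosh_strictMonoOn.injOn hr.le hs.le h1
  subst hrs
  exact ⟨rfl, mul_left_cancel₀ (Real.sinh_pos_iff.2 hr).ne' h2⟩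

end MidpointTriple

namespace MidpointTriple
variable (T : MidpointTriple)

/-! ### A neighbourhood of the vertex in the parametrisation -/

/-- The point with the given polar coordinates about the vertex. -/
def polarPt (q : ℝ × ℝ) : ℍ := T.pt (T.polarVec q)

lemma continuous_polarPt : Continuous T.polarPt :=
  T.continuousOn_pt.comp_continuous T.continuous_polarVec T.polarVec_mem

lemma symVec_polarPt (q : ℝ × ℝ) : symVec (T.polarPt q) = T.toVec (T.polarVec q) := by
  rw [polarPt, pt, symVec_ofVec (T.polarVec_mem q), hypForm_toVec, form_polarVec_polarVec]
  simp

lemma coords_polarPt (q : ℝ × ℝ) : T.coords (T.polarPt q) = T.polarVec q := by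
  apply T.toVec_injective
  rw [toVec_coords, symVec_polarPt]

lemma form_coords (z : ℍ) : T.form (T.coords z) (T.coords z) = 1 := by
  rw [← hypForm_toVec, toVec_coords, hypForm_symVec]

lemma polarPt_add (r φ : ℝ) : T.polarPt (r, φ + T.halfAngle) =
    halfTurn T.m • halfTurn T.j • halfTurn T.n • T.polarPt (r, φ) := by
  have h := T.polarVec_mem (r, φ)
  rw [polarPt, ← rot_polarVec, rot_apply, pt_turnM (turnJ_mem (turnN_mem h)),
    pt_turnJ (turnN_mem h), pt_turnN h, polarPt]

/-- The hyperbolic cosine of the distance of a point from the vertex. -/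
def coshDist (z : ℍ) : ℝ := T.form (T.coords z) T.apex

lemma coshDist_polarPt (q : ℝ × ℝ) : T.coshDist (T.polarPt q) = Real.cosh q.1 := by
  rw [coshDist, coords_polarPt, form_polarVec_apex]

lemma continuous_coshDist : Continuous T.coshDist := by
  have h : Continuous fun v => T.form v T.apex := by unfold form; fun_prop
  exact h.comp T.continuous_coords

lemma strip_zero : T.strip 0 = T.pt T.apex := by
  have : T.apex = T.sinQuarter⁻¹ • T.quad 0 0 := by simp [quad, apex]
  rw [this, pt_smul _ (inv_pos.2 T.sinQuarter_pos) (T.quad_mem (by norm_num) (by norm_num)), strip,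
    stripVec_of_nonneg _ le_rfl]
  rfl

lemma polarPt_zero (φ : ℝ) : T.polarPt (0, φ) = T.strip 0 := by
  rw [strip_zero, polarPt]; simp [polarVec]

/-- The coordinates of a point of the closed strip lie in the wedge at the vertex. -/
lemma wedge_of_strip {q : ℝ × ℝ} (hq : q ∈ closedBox) :
    0 ≤ T.lBot (T.stripVec q) ∧ 0 ≤ T.lTop (T.turnM (T.stripVec q)) := by
  have ha := T.a_pos
  have hb := T.b_pos
  have hlt := sub_pos.2 T.a_lt
  have hid := T.a_mul_lTop_turnM (T.stripVec q)
  have hs := T.sideLength_pos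
  have h1 : ∀ q ∈ closedBox, 0 ≤ q.1 → 0 ≤ T.lBot (T.stripVec q) ∧ 0 ≤ T.lTop (T.stripVec q) := by
    intro q hq h0
    rw [stripVec_of_nonneg _ h0, lBot_quad, lTop_quad]
    have h2 := T.interp_pos ⟨h0, hq.1.2⟩
    have h3 := T.interp_pos' ⟨h0, hq.1.2⟩
    have h4 := hq.2.1
    have h5 := sub_nonneg.2 hq.2.2
    constructor <;> positivity
  rcases lt_trichotomy q.1 0 with h0 | h0 | h0
  · have h2 := (h1 _ (neg_mem_closedBox hq) (by simpa using h0.le)).2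
    rw [stripVec_neg] at h2
    refine ⟨?_, h2⟩
    have h3 := T.lLeft_stripVec_neg hq h0
    have h4 : 0 ≤ (2 * T.b * T.c - T.a) * T.lBot (T.stripVec q) := by
      nlinarith [mul_nonneg ha.le h2, sq_nonneg T.sideLength]
    exact nonneg_of_mul_nonneg_right h4 hlt
  · have h2 := (h1 q hq h0.ge).1
    refine ⟨h2, ?_⟩
    rw [T.lLeft_stripVec_zero h0, mul_zero, add_zero] at hid
    exact nonneg_of_mul_nonneg_right (hid ▸ mul_nonneg hlt.le h2) ha
  · have h2 := (h1 q hq h0.le).1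
    refine ⟨h2, nonneg_of_mul_nonneg_right (a := T.a) ?_ ha⟩
    rw [hid]
    have := T.lLeft_stripVec_pos hq h0
    positivity

/-- The wedge inequalities become `sin φ ≥ 0` and `sin (halfAngle - φ) ≥ 0`, which confine an
argument in `(-π, π]` to the sector. At the vertex the angle is arbitrary and is set to `0`. -/
lemma exists_polarPt_eq_strip {q : ℝ × ℝ} (hq : q ∈ closedBox) :
    ∃ r φ : ℝ, 0 ≤ r ∧ φ ∈ Set.Icc 0 T.halfAngle ∧ T.polarPt (r, φ) = T.strip q := by
  obtain ⟨t, ht, hc⟩ := T.coords_pt (T.stripVec_mem hq)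
  obtain ⟨r, φ, hr, hφ, h⟩ := T.exists_polarVec_eq (T.coords_mem (T.strip q)) (T.form_coords _)
  have heq : T.polarPt (r, φ) = T.strip q := by rw [polarPt, h, pt_coords]
  rcases hr.eq_or_lt with rfl | hr'
  · exact ⟨0, 0, le_rfl, ⟨le_rfl, T.halfAngle_pos.le⟩, by rw [polarPt_zero, ← heq, polarPt_zero]⟩
  have hk : 0 < T.sideLength / T.cosQuarter := div_pos T.sideLength_pos T.cosQuarter_pos
  have hsh := Real.sinh_pos_iff.2 hr'
  obtain ⟨h1, h2⟩ := T.wedge_of_strip hq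
  have hpv : T.polarVec (r, φ) = t • T.stripVec q := by rw [h, ← hc, strip]
  have h3 : 0 ≤ T.lBot (T.polarVec (r, φ)) := by
    rw [hpv, lBot_smul]; positivity
  have h4 : 0 ≤ T.lTop (T.turnM (T.polarVec (r, φ))) := by
    rw [hpv, map_smul, lTop_smul]; positivity
  rw [lBot_polarVec] at h3
  rw [lTop_turnM_polarVec] at h4
  have h5 : 0 ≤ Real.sin φ :=
    nonneg_of_mul_nonneg_right (nonneg_of_mul_nonneg_left h3 hk) hsh
  have h6 : 0 ≤ Real.sin (T.halfAngle - φ) :=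
    nonneg_of_mul_nonneg_right (nonneg_of_mul_nonneg_left h4 hk) hsh
  have h7 : 0 ≤ φ := by
    by_contra hn
    exact absurd (Real.sin_neg_of_neg_of_neg_pi_lt (not_le.1 hn) hφ.1) (not_lt.2 h5)
  refine ⟨r, φ, hr, ⟨h7, ?_⟩, heq⟩
  by_contra hn
  have := Real.sin_neg_of_neg_of_neg_pi_lt (x := T.halfAngle - φ) (by linarith)
    (by linarith [hφ.2, T.halfAngle_pos])
  linarith

/-- The part of the strip near the vertex. -/
def nearBox : Set (ℝ × ℝ) := Set.Ioo (-1 / 2) (1 / 2) ×ˢ Set.Ico 0 (1 / 2)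

lemma nearBox_subset : nearBox ⊆ closedBox := by
  rintro q ⟨⟨h1, h2⟩, h3, h4⟩
  exact ⟨⟨by linarith, by linarith⟩, h3, by linarith⟩

/-- A point of the wedge at the vertex that is close to the vertex lies in the strip. -/
lemma exists_strip_eq_of_wedge {v : ℝ × ℝ × ℝ} (hv : v ∈ T.cone) (h1 : 0 ≤ T.lBot v)
    (h2 : 0 ≤ T.lTop (T.turnM v)) (h3 : 0 ≤ T.lTop v ∧ 0 ≤ T.lRight v)
    (h4 : 0 ≤ T.lBot (T.turnM v) ∧ 0 ≤ T.lRight (T.turnM v)) :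
    ∃ q ∈ closedBox, T.strip q = T.pt v := by
  rcases le_total 0 (T.lLeft v) with h | h
  · obtain ⟨q, hq, -, h, -⟩ := T.exists_strip_eq hv h ⟨h1, h3⟩
    exact ⟨q, hq, h⟩
  · obtain ⟨q, hq, -, h, -⟩ := T.exists_strip_eq (turnM_mem hv)
      (by rw [lLeft_turnM]; linarith) ⟨h4.1, h2, h4.2⟩
    exact ⟨_, neg_mem_closedBox hq, by
      rw [T.strip_neg hq, h, ← pt_turnM (turnM_mem hv), turnM_turnM]⟩

lemma eventually_near_apex : ∀ᶠ v in 𝓝 T.apex, (0 ≤ T.lTop v ∧ 0 ≤ T.lRight v) ∧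
    0 ≤ T.lBot (T.turnM v) ∧ 0 ≤ T.lRight (T.turnM v) := by
  have hB : Continuous T.lBot := by unfold lBot; fun_prop
  have hL : Continuous T.lLeft := by unfold lLeft; fun_prop
  have hT : Continuous T.lTop := hB.comp T.continuous_turnJ
  have hR : Continuous T.lRight := hL.comp T.continuous_turnJ
  have hA : T.apex = T.sinQuarter⁻¹ • T.quad 0 0 := by simp [quad, apex]
  have hs := inv_pos.2 T.sinQuarter_pos
  have hA' : T.turnM T.apex = T.sinQuarter⁻¹ • T.quad 0 1 := by
    rw [hA, map_smul, turnM_quad, sub_zero]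
  obtain ⟨-, i2, i3⟩ := T.quad_interior_iff (x := 0) (y := 0) (by norm_num) (by norm_num)
  obtain ⟨j1, -, j3⟩ := T.quad_interior_iff (x := 0) (y := 1) (by norm_num) (by norm_num)
  have e1 := hT.continuousAt.eventually (lt_mem_nhds (b := T.lTop T.apex) (a := 0) (by
    rw [hA, lTop_smul]; exact mul_pos hs (i2.2 one_pos)))
  have e2 := hR.continuousAt.eventually (lt_mem_nhds (b := T.lRight T.apex) (a := 0) (by
    rw [hA, lRight_smul]; exact mul_pos hs (i3.2 one_pos)))
  have e3 := (hB.comp T.continuous_turnM).continuousAt.eventually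
    (lt_mem_nhds (b := T.lBot (T.turnM T.apex)) (a := 0) (by
      rw [hA', lBot_smul]; exact mul_pos hs (j1.2 one_pos)))
  have e4 := (hR.comp T.continuous_turnM).continuousAt.eventually
    (lt_mem_nhds (b := T.lRight (T.turnM T.apex)) (a := 0) (by
      rw [hA', lRight_smul]; exact mul_pos hs (j3.2 one_pos)))
  filter_upwards [e1, e2, e3, e4] with v h1 h2 h3 h4
  exact ⟨⟨h1.le, h2.le⟩, le_of_lt h3, le_of_lt h4⟩

/-- The parameters far from the origin have a compact image, which misses the vertex by injectivity.
-/
lemma eventually_mem_of_strip_eq : ∀ᶠ z in 𝓝 (T.pt T.apex), ∀ q ∈ closedBox, T.strip q = z →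
    q ∈ nearBox := by
  have hop : IsOpen (Set.Ioo (-1 / 2 : ℝ) (1 / 2) ×ˢ Set.Iio (1 / 2 : ℝ)) :=
    isOpen_Ioo.prod isOpen_Iio
  set U := Set.Ioo (-1 / 2 : ℝ) (1 / 2) ×ˢ Set.Iio (1 / 2 : ℝ)
  have hcl : IsClosed (T.strip '' (closedBox \ U)) :=
    ((isCompact_closedBox.diff hop).image_of_continuousOn
      (T.continuousOn_strip.mono Set.sdiff_subset)).isClosed
  have h0 : (0 : ℝ × ℝ) ∈ closedBox := by
    constructor <;> simp
  have hn : T.pt T.apex ∉ T.strip '' (closedBox \ U) := by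
    rintro ⟨q, hq, h⟩
    rw [← strip_zero] at h
    have := T.injOn_strip hq.1 h0 h
    subst this
    exact hq.2 (by constructor <;> norm_num)
  filter_upwards [hcl.isOpen_compl.mem_nhds hn] with z hz q hq hqz
  by_contra hqn
  refine hz ⟨q, ⟨hq, fun h => hqn ⟨h.1, hq.2.1, h.2⟩⟩, hqz⟩

/-- Compactness of the interval of angles yields one radius for all of them. -/
lemma exists_radius : ∃ R : ℝ, 0 < R ∧ ∀ r ∈ Set.Icc 0 R, ∀ φ ∈ Set.Icc 0 T.halfAngle,
    ∃ q ∈ nearBox, T.strip q = T.polarPt (r, φ) := by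
  have h1 : ∀ᶠ r in 𝓝 (0 : ℝ), ∀ φ ∈ Set.Icc 0 T.halfAngle,
      ((0 ≤ T.lTop (T.polarVec (r, φ)) ∧ 0 ≤ T.lRight (T.polarVec (r, φ))) ∧
      0 ≤ T.lBot (T.turnM (T.polarVec (r, φ))) ∧ 0 ≤ T.lRight (T.turnM (T.polarVec (r, φ)))) ∧
      ∀ q' ∈ closedBox, T.strip q' = T.polarPt (r, φ) → q' ∈ nearBox := by
    refine isCompact_Icc.eventually_forall_of_forall_eventually fun φ _ =>
      Filter.Eventually.and ?_ ?_
    · have := T.eventually_near_apex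
      have h0 : T.polarVec (0, φ) = T.apex := by simp [polarVec]
      rw [← h0] at this
      exact T.continuous_polarVec.continuousAt.eventually this
    · have := T.eventually_mem_of_strip_eq
      rw [← strip_zero, ← T.polarPt_zero φ] at this
      exact T.continuous_polarPt.continuousAt.eventually this
  obtain ⟨ε, hε, hball⟩ := Metric.eventually_nhds_iff.1 h1
  refine ⟨ε / 2, half_pos hε, fun r hr φ hφ => ?_⟩
  obtain ⟨⟨h3, h4⟩, h5⟩ := hball (y := r) (by
    rw [Real.dist_eq, sub_zero, abs_of_nonneg hr.1]
    linarith [hr.2]) φ hφ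
  have hsh := Real.sinh_nonneg_iff.2 hr.1
  have hk : 0 < T.sideLength / T.cosQuarter := div_pos T.sideLength_pos T.cosQuarter_pos
  have hpi := T.halfAngle_lt_pi
  obtain ⟨q, hq, h⟩ := T.exists_strip_eq_of_wedge (T.polarVec_mem (r, φ)) (by
    rw [lBot_polarVec]
    have := Real.sin_nonneg_of_nonneg_of_le_pi hφ.1 (by linarith [hφ.2])
    positivity) (by
    rw [lTop_turnM_polarVec]
    have := Real.sin_nonneg_of_nonneg_of_le_pi (x := T.halfAngle - φ) (by linarith [hφ.2])
      (by linarith [hφ.1])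
    positivity) h3 h4
  exact ⟨q, h5 q hq h, h⟩

end MidpointTriple

namespace MidpointTriple
variable (T : MidpointTriple)

/-! ### The cone -/

lemma stripVec_neg_zero {x : ℝ} (hx : 0 ≤ x) : T.stripVec (-x, 0) = T.rot (T.stripVec (x, 0)) := by
  rw [T.stripVec_of_nonneg (q := (x, 0)) hx,
    T.stripVec_of_nonpos (q := (-x, 0)) (by simpa using hx), rot_apply, turnN_quad, turnJ_quad]
  simp

lemma strip_neg_zero {x : ℝ} (hx : x ∈ Set.Icc (0 : ℝ) 1) :
    T.strip (-x, 0) = halfTurn T.m • halfTurn T.j • halfTurn T.n • T.strip (x, 0) := by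
  have h : T.stripVec (x, 0) ∈ T.cone :=
    T.stripVec_mem ⟨⟨by linarith [hx.1], hx.2⟩, by norm_num⟩
  rw [strip, stripVec_neg_zero _ hx.1, rot_apply, pt_turnM (turnJ_mem (turnN_mem h)),
    pt_turnJ (turnN_mem h), pt_turnN h, strip]

lemma coshDist_rot (z : ℍ) :
    T.coshDist (halfTurn T.m • halfTurn T.j • halfTurn T.n • z) = T.coshDist z := by
  have h : T.coords (halfTurn T.m • halfTurn T.j • halfTurn T.n • z) = T.rot (T.coords z) := by
    apply T.toVec_injective
    rw [toVec_coords, rot_apply, ← vecAct_toVec_M, ← vecAct_toVec_J, ← vecAct_toVec_N,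
      toVec_coords, symVec_smul, symVec_smul, symVec_smul]
  rw [coshDist, h]
  conv_lhs => rw [← rot_apex]
  rw [coshDist, ← hypForm_toVec, ← hypForm_toVec, rot_apply, rot_apply, ← vecAct_toVec_M,
    ← vecAct_toVec_M, hypForm_vecAct, ← vecAct_toVec_J, ← vecAct_toVec_J, hypForm_vecAct,
    ← vecAct_toVec_N, ← vecAct_toVec_N, hypForm_vecAct]

/-- A map that expresses the points of a sector at the vertex by their coordinates in the strip. -/
def IsSectorLift (R : ℝ) (f : ℝ × ℝ → ℝ × ℝ) : Prop :=
  ∀ q ∈ Set.Icc 0 R ×ˢ Set.Icc 0 T.halfAngle, f q ∈ nearBox ∧ T.strip (f q) = T.polarPt q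

lemma exists_isSectorLift : ∃ (R : ℝ) (f : ℝ × ℝ → ℝ × ℝ), 0 < R ∧ T.IsSectorLift R f := by
  obtain ⟨R, hR, h⟩ := T.exists_radius
  have h' : ∀ q : ℝ × ℝ, ∃ q' : ℝ × ℝ, q ∈ Set.Icc 0 R ×ˢ Set.Icc 0 T.halfAngle →
      q' ∈ nearBox ∧ T.strip q' = T.polarPt q := fun q => by
    by_cases hq : q ∈ Set.Icc 0 R ×ˢ Set.Icc 0 T.halfAngle
    · obtain ⟨q', hq'⟩ := h q.1 hq.1 q.2 hq.2
      exact ⟨q', fun _ => hq'⟩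
    · exact ⟨0, fun h => absurd h hq⟩
  choose f hf using h'
  exact ⟨R, f, hR, hf⟩

namespace IsSectorLift
variable {T} {R : ℝ} {f : ℝ × ℝ → ℝ × ℝ} (hf : T.IsSectorLift R f)
include hf

/-- The map `f` is merely chosen pointwise, but `strip` embeds the compact box, so continuity of
`strip ∘ f` suffices. -/
lemma continuousOn : ContinuousOn f (Set.Icc 0 R ×ˢ Set.Icc 0 T.halfAngle) := by
  have : CompactSpace closedBox := isCompact_iff_compactSpace.1 isCompact_closedBox
  have hemb : Topology.IsEmbedding (closedBox.domRestrict T.strip) :=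
    (Continuous.isClosedEmbedding (continuousOn_iff_continuous_domRestrict.1 T.continuousOn_strip)
      (Set.injOn_iff_injective.1 T.injOn_strip)).isEmbedding
  rw [continuousOn_iff_continuous_domRestrict]
  let F : ↥(Set.Icc 0 R ×ˢ Set.Icc 0 T.halfAngle) → closedBox :=
    fun q => ⟨f q, nearBox_subset (hf q q.2).1⟩
  have hF : Continuous F := by
    rw [hemb.continuous_iff]
    refine (T.continuous_polarPt.comp continuous_subtype_val).congr fun q => ?_
    exact (hf q q.2).2.symm
  exact continuous_subtype_val.comp hF

lemma exists_polarVec_eq {q : ℝ × ℝ} (hq : q ∈ Set.Icc 0 R ×ˢ Set.Icc 0 T.halfAngle) :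
    ∃ t : ℝ, 0 < t ∧ T.polarVec q = t • T.stripVec (f q) :=
  (T.pt_eq_iff (T.polarVec_mem q) (T.stripVec_mem (nearBox_subset (hf q hq).1))).1
    (hf q hq).2.symm

lemma eq_of_strip_eq {q q' : ℝ × ℝ} (hq : q ∈ Set.Icc 0 R ×ˢ Set.Icc 0 T.halfAngle)
    (hq' : q' ∈ closedBox) (h : T.strip q' = T.polarPt q) : f q = q' :=
  T.injOn_strip (nearBox_subset (hf q hq).1) hq' ((hf q hq).2.trans h.symm)

lemma apply_zero (hR : 0 ≤ R) {φ : ℝ} (hφ : φ ∈ Set.Icc 0 T.halfAngle) : f (0, φ) = 0 :=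
  hf.eq_of_strip_eq ⟨⟨le_rfl, hR⟩, hφ⟩ (by constructor <;> simp) (T.polarPt_zero φ).symm

lemma snd_pos {r φ : ℝ} (hr : r ∈ Set.Ioc 0 R) (hφ : φ ∈ Set.Ioo 0 T.halfAngle) :
    0 < (f (r, φ)).2 := by
  have hq : (r, φ) ∈ Set.Icc 0 R ×ˢ Set.Icc 0 T.halfAngle :=
    ⟨⟨hr.1.le, hr.2⟩, hφ.1.le, hφ.2.le⟩
  obtain ⟨t, ht, h⟩ := hf.exists_polarVec_eq hq
  have hsh := Real.sinh_pos_iff.2 hr.1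
  have hk : 0 < T.sideLength / T.cosQuarter := div_pos T.sideLength_pos T.cosQuarter_pos
  have hpi := T.halfAngle_lt_pi
  have h1 : 0 < T.lBot (T.polarVec (r, φ)) := by
    rw [lBot_polarVec]
    have := Real.sin_pos_of_pos_of_lt_pi hφ.1 (by linarith [hφ.2])
    positivity
  have h2 : 0 < T.lTop (T.turnM (T.polarVec (r, φ))) := by
    rw [lTop_turnM_polarVec]
    have := Real.sin_pos_of_pos_of_lt_pi (x := T.halfAngle - φ) (by linarith [hφ.2])
      (by linarith [hφ.1])
    positivity
  rw [h, lBot_smul] at h1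
  rw [h, map_smul, lTop_smul] at h2
  replace h1 := pos_of_mul_pos_right h1 ht.le
  replace h2 := pos_of_mul_pos_right h2 ht.le
  obtain ⟨⟨g1, g2⟩, g3, g4⟩ := nearBox_subset (hf _ hq).1
  rcases le_total 0 (f (r, φ)).1 with h0 | h0
  · rw [stripVec_of_nonneg _ h0] at h1
    exact (T.quad_interior_iff ⟨h0, g2⟩ ⟨g3, g4⟩).1.1 h1
  · rw [stripVec_of_nonpos _ h0, turnM_turnM] at h2
    have := (T.quad_interior_iff (x := -(f (r, φ)).1) (y := 1 - (f (r, φ)).2)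
      ⟨by linarith, by linarith⟩ ⟨by linarith, by linarith⟩).2.1.1 h2
    linarith

lemma apply_angle_zero {r : ℝ} (hr : r ∈ Set.Ioc 0 R) : 0 < (f (r, 0)).1 ∧ (f (r, 0)).2 = 0 := by
  have hq : (r, (0 : ℝ)) ∈ Set.Icc 0 R ×ˢ Set.Icc 0 T.halfAngle :=
    ⟨⟨hr.1.le, hr.2⟩, le_rfl, T.halfAngle_pos.le⟩
  obtain ⟨t, ht, h⟩ := hf.exists_polarVec_eq hq
  have hsh := Real.sinh_pos_iff.2 hr.1
  have hk : 0 < T.sideLength / T.cosQuarter := div_pos T.sideLength_pos T.cosQuarter_pos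
  have h1 : T.lBot (T.polarVec (r, 0)) = 0 := by rw [lBot_polarVec]; simp
  have h2 : 0 < T.lTop (T.turnM (T.polarVec (r, 0))) := by
    rw [lTop_turnM_polarVec]
    have := Real.sin_pos_of_pos_of_lt_pi (x := T.halfAngle - 0) (by linarith [T.halfAngle_pos])
      (by linarith [T.halfAngle_lt_pi])
    positivity
  have h3 := T.a_mul_lTop_turnM (T.polarVec (r, 0))
  rw [h1, mul_zero, zero_add] at h3
  have h4 : 0 < T.lLeft (T.polarVec (r, 0)) := by
    have h5 := mul_pos T.a_pos h2
    rw [h3] at h5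
    exact pos_of_mul_pos_right h5 (by positivity)
  rw [h, lLeft_smul] at h4
  rw [h, lBot_smul] at h1
  replace h4 := pos_of_mul_pos_right h4 ht.le
  replace h1 := (mul_eq_zero.1 h1).resolve_left ht.ne'
  have hbox := nearBox_subset (hf _ hq).1
  have h0 : 0 < (f (r, 0)).1 := by
    rcases lt_trichotomy (f (r, 0)).1 0 with h0 | h0 | h0
    · linarith [T.lLeft_stripVec_neg hbox h0]
    · linarith [T.lLeft_stripVec_zero h0]
    · exact h0
  refine ⟨h0, ?_⟩
  rw [stripVec_of_nonneg _ h0.le] at h1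
  have := (T.quad_interior_iff ⟨h0.le, hbox.1.2⟩ hbox.2).1
  rw [h1] at this
  exact le_antisymm (not_lt.1 fun h => lt_irrefl _ (this.2 h)) hbox.2.1

/-- The rotation `MJN` carries the bottom side of the first copy to that of the second, and in
parameters this is `(x, 0) ↦ (-x, 0)`. Hence the sector and its point reflection fit together. -/
lemma apply_halfAngle {r : ℝ} (hr : r ∈ Set.Icc 0 R) : f (r, T.halfAngle) = -f (r, 0) := by
  have hτ := T.halfAngle_pos.le
  rcases hr.1.eq_or_lt with h | h
  · rw [← h, hf.apply_zero (hr.1.trans hr.2) ⟨hτ, le_rfl⟩,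
      hf.apply_zero (hr.1.trans hr.2) ⟨le_rfl, hτ⟩, neg_zero]
  obtain ⟨h1, h2⟩ := hf.apply_angle_zero ⟨h, hr.2⟩
  obtain ⟨g, gs⟩ := hf (r, 0) ⟨hr, le_rfl, hτ⟩
  have hx : (f (r, 0)).1 ∈ Set.Icc (0 : ℝ) 1 := ⟨h1.le, by linarith [g.1.2]⟩
  have e : -f (r, 0) = (-(f (r, 0)).1, 0) := by ext <;> simp [h2]
  rw [e]
  refine hf.eq_of_strip_eq ⟨hr, hτ, le_rfl⟩
    ⟨⟨by linarith [hx.2], by linarith [hx.1]⟩, by norm_num⟩ ?_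
  have e' : ((f (r, 0)).1, (0 : ℝ)) = f (r, 0) := by ext <;> simp [h2]
  rw [T.strip_neg_zero hx, e', gs, ← polarPt_add, zero_add]

end IsSectorLift

/-! ### From the sector to the whole cone. -/

/-- The extension of a map on a sector at the vertex to the whole cone by point reflections. -/
def coneLift (f : ℝ × ℝ → ℝ × ℝ) (q : ℝ × ℝ) : ℝ × ℝ :=
  (-1 : ℝ) ^ ⌊q.2 / T.halfAngle⌋ • f (q.1, q.2 - ⌊q.2 / T.halfAngle⌋ * T.halfAngle)

/-- The open unit square about the origin. -/
def centralBox : Set (ℝ × ℝ) := Set.Ioo (-1 / 2) (1 / 2) ×ˢ Set.Ioo (-1 / 2) (1 / 2)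

lemma nearBox_subset_centralBox : nearBox ⊆ centralBox := by
  rintro q ⟨h1, h2, h3⟩
  exact ⟨h1, by linarith, h3⟩

lemma neg_mem_centralBox {q : ℝ × ℝ} (hq : q ∈ centralBox) : -q ∈ centralBox := by
  obtain ⟨⟨h1, h2⟩, h3, h4⟩ := hq
  refine ⟨⟨?_, ?_⟩, ?_, ?_⟩ <;> simp only [Prod.fst_neg, Prod.snd_neg] <;> linarith

lemma exists_add_int_mul_halfAngle (φ : ℝ) :
    ∃ ψ ∈ Set.Ico 0 T.halfAngle, ∃ n : ℤ, φ = ψ + n * T.halfAngle := by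
  have hτ := T.halfAngle_pos
  refine ⟨φ - ⌊φ / T.halfAngle⌋ * T.halfAngle, ⟨?_, ?_⟩, ⌊φ / T.halfAngle⌋, by ring⟩
  · have := mul_le_mul_of_nonneg_right (Int.floor_le (φ / T.halfAngle)) hτ.le
    rw [div_mul_cancel₀ _ hτ.ne'] at this
    linarith
  · have := mul_lt_mul_of_pos_right (Int.lt_floor_add_one (φ / T.halfAngle)) hτ
    rw [div_mul_cancel₀ _ hτ.ne'] at this
    linarith

lemma coneLift_add (f : ℝ × ℝ → ℝ × ℝ) (r φ : ℝ) (n : ℤ) :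
    T.coneLift f (r, φ + n * T.halfAngle) = (-1 : ℝ) ^ n • T.coneLift f (r, φ) := by
  have hτ := T.halfAngle_pos.ne'
  have h : (φ + n * T.halfAngle) / T.halfAngle = φ / T.halfAngle + n := by field_simp
  simp only [coneLift]
  rw [h, Int.floor_add_intCast, smul_smul, add_comm ⌊_⌋ n, zpow_add₀ (by norm_num)]
  congr 3
  push_cast; ring

lemma coneLift_of_mem_Ico (f : ℝ × ℝ → ℝ × ℝ) {r φ : ℝ} (hφ : φ ∈ Set.Ico 0 T.halfAngle) :
    T.coneLift f (r, φ) = f (r, φ) := by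
  have h : ⌊φ / T.halfAngle⌋ = 0 := by
    rw [Int.floor_eq_zero_iff]
    exact ⟨div_nonneg hφ.1 T.halfAngle_pos.le, (div_lt_one T.halfAngle_pos).2 hφ.2⟩
  simp [coneLift, h]

lemma neg_one_zpow_smul (n : ℤ) (q : ℝ × ℝ) :
    (Even n ∧ (-1 : ℝ) ^ n • q = q) ∨ (¬ Even n ∧ (-1 : ℝ) ^ n • q = -q) := by
  rcases Int.even_or_odd n with h | h
  · exact Or.inl ⟨h, by rw [h.neg_one_zpow, one_smul]⟩
  · exact Or.inr ⟨Int.not_even_iff_odd.2 h, by rw [h.neg_one_zpow, neg_one_smul]⟩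

namespace IsSectorLift
variable {T} {R : ℝ} {f : ℝ × ℝ → ℝ × ℝ} (hf : T.IsSectorLift R f)
include hf

lemma coneLift_eq {r φ : ℝ} (hr : r ∈ Set.Icc 0 R) (hφ : φ ∈ Set.Icc 0 T.halfAngle) :
    T.coneLift f (r, φ) = f (r, φ) := by
  rcases hφ.2.eq_or_lt with rfl | h
  · have := T.coneLift_add f r 0 1
    rw [T.coneLift_of_mem_Ico f ⟨le_rfl, T.halfAngle_pos⟩] at this
    simp only [Int.cast_one, one_mul, zero_add, zpow_one, neg_smul, one_smul] at this
    rw [this, hf.apply_halfAngle hr]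
  · exact T.coneLift_of_mem_Ico f ⟨hφ.1, h⟩

lemma exists_coneLift_eq {r : ℝ} (hr : r ∈ Set.Icc 0 R) (φ : ℝ) :
    ∃ q ∈ nearBox, T.coshDist (T.strip q) = Real.cosh r ∧
      (T.coneLift f (r, φ) = q ∨ T.coneLift f (r, φ) = -q) := by
  obtain ⟨ψ, hψ, n, rfl⟩ := T.exists_add_int_mul_halfAngle φ
  obtain ⟨h1, h2⟩ := hf (r, ψ) ⟨hr, hψ.1, hψ.2.le⟩
  refine ⟨f (r, ψ), h1, by rw [h2, coshDist_polarPt], ?_⟩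
  rw [coneLift_add, coneLift_of_mem_Ico _ _ hψ]
  exact (neg_one_zpow_smul n _).imp And.right And.right

lemma coneLift_mem {r : ℝ} (hr : r ∈ Set.Icc 0 R) (φ : ℝ) : T.coneLift f (r, φ) ∈ centralBox := by
  obtain ⟨q, hq, -, h | h⟩ := hf.exists_coneLift_eq hr φ
  · rw [h]; exact nearBox_subset_centralBox hq
  · rw [h]; exact neg_mem_centralBox (nearBox_subset_centralBox hq)

lemma coneLift_zero (hR : 0 ≤ R) (φ : ℝ) : T.coneLift f (0, φ) = 0 := by
  obtain ⟨ψ, hψ, n, rfl⟩ := T.exists_add_int_mul_halfAngle φ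
  rw [coneLift_add, coneLift_of_mem_Ico _ _ hψ, hf.apply_zero hR ⟨hψ.1, hψ.2.le⟩, smul_zero]

/-- The only doubtful places are the edges of sectors. Two adjacent closed sectors are glued, and
translation by multiples of `halfAngle` moves every angle into their interior. -/
lemma continuousOn_coneLift : ContinuousOn (T.coneLift f) (Set.Icc 0 R ×ˢ Set.univ) := by
  have hτ := T.halfAngle_pos
  have h1 : ContinuousOn (T.coneLift f) (Set.Icc 0 R ×ˢ Set.Icc 0 T.halfAngle) :=
    hf.continuousOn.congr fun q hq => hf.coneLift_eq hq.1 hq.2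
  have shift : ∀ {n : ℤ} {A : Set ℝ}, ContinuousOn (T.coneLift f) (Set.Icc 0 R ×ˢ A) →
      ContinuousOn (T.coneLift f) (Set.Icc 0 R ×ˢ ((fun φ => φ + n * T.halfAngle) ⁻¹' A)) := by
    intro n A hA
    have : ContinuousOn (fun q : ℝ × ℝ => (-1 : ℝ) ^ (-n) •
        T.coneLift f (q.1, q.2 + n * T.halfAngle))
        (Set.Icc 0 R ×ˢ ((fun φ => φ + n * T.halfAngle) ⁻¹' A)) := by
      have hc : Continuous fun q : ℝ × ℝ => (q.1, q.2 + n * T.halfAngle) := by fun_prop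
      have hm : Set.MapsTo (fun q : ℝ × ℝ => (q.1, q.2 + n * T.halfAngle))
          (Set.Icc 0 R ×ˢ ((fun φ => φ + n * T.halfAngle) ⁻¹' A)) (Set.Icc 0 R ×ˢ A) :=
        fun q hq => ⟨hq.1, hq.2⟩
      have h : ContinuousOn (fun q : ℝ × ℝ => T.coneLift f (q.1, q.2 + n * T.halfAngle))
          (Set.Icc 0 R ×ˢ ((fun φ => φ + n * T.halfAngle) ⁻¹' A)) := hA.comp hc.continuousOn hm
      exact h.const_smul ((-1 : ℝ) ^ (-n))
    refine this.congr fun q _ => ?_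
    simp only
    rw [coneLift_add, smul_smul, ← zpow_add₀ (by norm_num), neg_add_cancel, zpow_zero, one_smul]
  have h2 : ContinuousOn (T.coneLift f)
      (Set.Icc 0 R ×ˢ (Set.Icc (-T.halfAngle) 0 ∪ Set.Icc 0 T.halfAngle)) := by
    rw [Set.prod_union]
    refine ContinuousOn.union_of_isClosed ?_ h1 (isClosed_Icc.prod isClosed_Icc)
      (isClosed_Icc.prod isClosed_Icc)
    refine (shift (n := 1) h1).mono (Set.prod_mono le_rfl fun φ hφ => ?_)
    simp only [Int.cast_one, one_mul, Set.mem_preimage]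
    exact ⟨by linarith [hφ.1], by linarith [hφ.2]⟩
  rintro ⟨r, φ⟩ ⟨hr, -⟩
  obtain ⟨ψ, hψ, n, hn⟩ := T.exists_add_int_mul_halfAngle φ
  have h3 := shift (n := -n) h2
  refine (h3 (r, φ) ⟨hr, ?_⟩).mono_of_mem_nhdsWithin ?_
  · right
    push_cast
    exact ⟨by linarith [hψ.1], by linarith [hψ.2]⟩
  · rw [nhdsWithin_prod_eq, nhdsWithin_univ]
    refine Filter.prod_mem_prod self_mem_nhdsWithin ?_
    refine Filter.mem_of_superset (Ioo_mem_nhds (a := φ - ψ - T.halfAngle)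
      (b := φ - ψ + T.halfAngle) (by linarith [hψ.1]) (by linarith [hψ.2])) fun χ hχ => ?_
    simp only [Set.mem_preimage, Set.mem_union, Set.mem_Icc]
    push_cast
    rcases le_total (χ + -n * T.halfAngle) 0 with h | h
    · exact Or.inl ⟨by linarith [hχ.1], h⟩
    · exact Or.inr ⟨h, by linarith [hχ.2]⟩

lemma coneLift_eq_iff {r s : ℝ} (hr : r ∈ Set.Ioc 0 R) (hs : s ∈ Set.Ioc 0 R) (φ ψ : ℝ) :
    T.coneLift f (r, φ) = T.coneLift f (s, ψ) ↔
      r = s ∧ ∃ k : ℤ, ψ = φ + k * (2 * T.halfAngle) := by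
  have hτ := T.halfAngle_pos
  constructor
  · intro h
    obtain ⟨φ', hφ', m, rfl⟩ := T.exists_add_int_mul_halfAngle φ
    obtain ⟨ψ', hψ', n, rfl⟩ := T.exists_add_int_mul_halfAngle ψ
    rw [coneLift_add, coneLift_add, coneLift_of_mem_Ico _ _ hφ', coneLift_of_mem_Ico _ _ hψ'] at h
    -- The half-open sector is mapped into a half-plane that contains exactly one of each pair of
    -- opposite nonzero vectors. Equality of two values thus forces equal parity of the numbers of
    -- reflections, which makes the period twice `halfAngle`.
    have half : ∀ {r φ}, r ∈ Set.Ioc 0 R → φ ∈ Set.Ico 0 T.halfAngle →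
        0 < (f (r, φ)).2 ∨ (0 < (f (r, φ)).1 ∧ (f (r, φ)).2 = 0) := by
      intro r φ hr hφ
      rcases hφ.1.eq_or_lt with h | h
      · rw [← h]; exact Or.inr (hf.apply_angle_zero hr)
      · exact Or.inl (hf.snd_pos hr ⟨h, hφ.2⟩)
    have key : f (r, φ') = f (s, ψ') → r = s ∧ φ' = ψ' := by
      intro he
      obtain ⟨-, e1⟩ := hf (r, φ') ⟨⟨hr.1.le, hr.2⟩, hφ'.1, hφ'.2.le⟩
      obtain ⟨-, e2⟩ := hf (s, ψ') ⟨⟨hs.1.le, hs.2⟩, hψ'.1, hψ'.2.le⟩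
      have e3 : T.polarPt (r, φ') = T.polarPt (s, ψ') := by rw [← e1, ← e2, he]
      have e4 : T.polarVec (r, φ') = T.polarVec (s, ψ') := by
        rw [← coords_polarPt, e3, coords_polarPt]
      obtain ⟨e5, e6⟩ := T.polarVec_injective hr.1 hs.1 e4
      have hpi := T.halfAngle_lt_pi
      exact ⟨e5, Real.injOn_cos ⟨hφ'.1, by linarith [hφ'.2]⟩ ⟨hψ'.1, by linarith [hψ'.2]⟩ e6⟩
    have hpar : ∀ {m n : ℤ}, (Even m ↔ Even n) → ∃ k : ℤ, n = m + k * 2 := by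
      intro m n h
      obtain ⟨k, hk⟩ := Int.even_sub.2 h.symm
      exact ⟨k, by omega⟩
    have fin : (Even m ↔ Even n) → f (r, φ') = f (s, ψ') →
        r = s ∧ ∃ k : ℤ, ψ' + n * T.halfAngle = φ' + m * T.halfAngle + k * (2 * T.halfAngle) := by
      intro hp he
      obtain ⟨e1, e2⟩ := key he
      obtain ⟨k, rfl⟩ := hpar hp
      exact ⟨e1, k, by rw [e2]; push_cast; ring⟩
    have hop : f (r, φ') ≠ -f (s, ψ') := by
      intro he
      have e1 : (f (r, φ')).1 = -(f (s, ψ')).1 := by rw [he]; rfl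
      have e2 : (f (r, φ')).2 = -(f (s, ψ')).2 := by rw [he]; rfl
      rcases half hr hφ' with h1 | ⟨h1, h1'⟩ <;> rcases half hs hψ' with h2 | ⟨h2, h2'⟩ <;> linarith
    rcases neg_one_zpow_smul m (f (r, φ')) with ⟨hm, e1⟩ | ⟨hm, e1⟩ <;>
      rcases neg_one_zpow_smul n (f (s, ψ')) with ⟨hn, e2⟩ | ⟨hn, e2⟩ <;> rw [e1, e2] at h
    · exact fin (iff_of_true hm hn) h
    · exact absurd h hop
    · exact absurd (neg_eq_iff_eq_neg.1 h) hop
    · exact fin (iff_of_false hm hn) (neg_injective h)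
  · rintro ⟨rfl, k, rfl⟩
    have : φ + k * (2 * T.halfAngle) = φ + ((k * 2 : ℤ) : ℝ) * T.halfAngle := by push_cast; ring
    rw [this, coneLift_add, zpow_mul', zpow_ofNat, neg_one_sq, one_zpow, one_smul]

end IsSectorLift
end MidpointTriple

/-! ### Comparison with the polar coordinates of the upper half-plane -/

/-- The vector `(1, 0, 1)` represents `i`, and `h` says that `v` lies in the tangent plane there,
which is rotated by the doubled half-angle. -/
lemma vecAct_rotationAboutI (φ : ℝ) (v : ℝ × ℝ × ℝ) (h : v.2.2 = -v.1) (t : ℝ) :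
    vecAct (rotationAboutI φ) (t • (1, 0, 1) + v) = t • (1, 0, 1) +
      (Real.cos φ * v.1 + Real.sin φ * v.2.1, Real.cos φ * v.2.1 - Real.sin φ * v.1,
        -(Real.cos φ * v.1 + Real.sin φ * v.2.1)) := by
  have h1 : Real.cos φ = Real.cos (φ / 2) ^ 2 - Real.sin (φ / 2) ^ 2 := by
    rw [← Real.cos_two_mul' (φ / 2)]; ring_nf
  have h2 : Real.sin φ = 2 * Real.sin (φ / 2) * Real.cos (φ / 2) := by
    rw [← Real.sin_two_mul]; ring_nf
  have h3 := Real.sin_sq_add_cos_sq (φ / 2)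
  rw [h1, h2]
  simp only [vecAct, rotationAboutI, LinearMap.coe_mk, AddHom.coe_mk, Matrix.of_apply,
    Matrix.cons_val', Matrix.cons_val_zero, Matrix.cons_val_one, Matrix.cons_val_fin_one,
    Prod.fst_add, Prod.snd_add, Prod.smul_fst, Prod.smul_snd, smul_eq_mul, h]
  ext
  · simp; linear_combination t * h3
  · simp; ring
  · simp; linear_combination t * h3

lemma symVec_hypPolar (r φ : ℝ) : symVec (hypPolar (r, φ)) = Real.cosh r • (1, 0, 1) +
    (Real.sinh r * Real.cos φ, -(Real.sinh r * Real.sin φ), -(Real.sinh r * Real.cos φ)) := by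
  have : ∀ h, symVec (⟨(Real.exp r : ℂ) * Complex.I, h⟩ : ℍ) =
      Real.cosh r • (1, 0, 1) + (Real.sinh r, 0, -Real.sinh r) := by
    intro h
    have hr : UpperHalfPlane.re (⟨(Real.exp r : ℂ) * Complex.I, h⟩ : ℍ) = 0 := by
      simp [UpperHalfPlane.re]
    have hi : UpperHalfPlane.im (⟨(Real.exp r : ℂ) * Complex.I, h⟩ : ℍ) = Real.exp r := by
      rw [UpperHalfPlane.im, Complex.im_ofReal_mul, Complex.I_im, mul_one]
    have he := (Real.exp_pos r).ne'
    simp only [symVec, hr, hi, Real.cosh_eq, Real.sinh_eq, Real.exp_neg]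
    ext
    · simp; field_simp; ring
    · simp
    · simp; field_simp; ring
  rw [hypPolar, symVec_smul, this, vecAct_rotationAboutI _ _ rfl]
  congr 1
  ext <;> simp <;> ring

lemma hypPolar_add (r φ α : ℝ) :
    hypPolar (r, φ + α) = rotationAboutI α • hypPolar (r, φ) := by
  apply symVec_injective
  rw [symVec_smul, symVec_hypPolar, symVec_hypPolar, vecAct_rotationAboutI _ _ rfl, Real.cos_add,
    Real.sin_add]
  congr 1
  ext <;> simp <;> ring

namespace MidpointTriple
variable (T : MidpointTriple)

/-- Move `i` to the vertex, then rotate the reference direction to the bottom side. The sign `ε` is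
needed since the parallelogram may have either orientation. -/
lemma exists_polarPt_eq_smul : ∃ (g : SL(2, ℝ)) (ε : ℝ), (ε = 1 ∨ ε = -1) ∧
    ∀ r φ, T.polarPt (r, φ) = g • hypPolar (r, ε * φ) := by
  obtain ⟨g, hg⟩ : ∃ g : SL(2, ℝ), g • UpperHalfPlane.I = T.pt T.apex :=
    ⟨_, UpperHalfPlane.toSL2R_smul_I _⟩
  have hI : symVec UpperHalfPlane.I = (1, 0, 1) := by simp [symVec]
  have h0 : T.toVec T.apex = vecAct g (1, 0, 1) := by
    rw [← hI, ← symVec_smul, hg, pt, symVec_ofVec T.apex_mem, hypForm_toVec, form_apex_apex]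
    simp
  obtain ⟨u, hu⟩ : ∃ u, u = vecAct g⁻¹ (T.toVec T.dirBot) := ⟨_, rfl⟩
  obtain ⟨v, hv⟩ : ∃ v, v = vecAct g⁻¹ (T.toVec T.dirPerp) := ⟨_, rfl⟩
  have hu' : vecAct g u = T.toVec T.dirBot := by rw [hu, vecAct_vecAct_inv]
  have hv' : vecAct g v = T.toVec T.dirPerp := by rw [hv, vecAct_vecAct_inv]
  have f1 : hypForm (1, 0, 1) u = 0 := by
    rw [← hypForm_vecAct g, ← h0, hu', hypForm_toVec, form_apex_dirBot]
  have f2 : hypForm (1, 0, 1) v = 0 := by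
    rw [← hypForm_vecAct g, ← h0, hv', hypForm_toVec, form_apex_dirPerp]
  have f3 : hypForm u u = -1 := by
    rw [← hypForm_vecAct g, hu', hypForm_toVec, form_dirBot_dirBot]
  have f4 : hypForm u v = 0 := by
    rw [← hypForm_vecAct g, hu', hv', hypForm_toVec, form_dirBot_dirPerp]
  have f5 : hypForm v v = -1 := by
    rw [← hypForm_vecAct g, hv', hypForm_toVec, form_dirPerp_dirPerp]
  obtain ⟨p, q, s⟩ := u
  obtain ⟨p', q', s'⟩ := v
  simp only [hypForm] at f1 f2 f3 f4 f5
  obtain rfl : s = -p := by linarith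
  obtain rfl : s' = -p' := by linarith
  obtain ⟨ψ, hc, hs⟩ : ∃ ψ : ℝ, Real.cos ψ = p ∧ Real.sin ψ = -q := by
    have hn : ‖(⟨p, -q⟩ : ℂ)‖ = 1 := by
      refine (pow_left_inj₀ (norm_nonneg _) zero_le_one two_ne_zero).1 ?_
      rw [Complex.sq_norm, Complex.normSq_apply]; simp only; linarith
    refine ⟨(⟨p, -q⟩ : ℂ).arg, ?_, ?_⟩
    · have := Complex.norm_mul_cos_arg (⟨p, -q⟩ : ℂ); rwa [hn, one_mul] at this
    · have := Complex.norm_mul_sin_arg (⟨p, -q⟩ : ℂ); rwa [hn, one_mul] at this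
  -- The determinant of the orthonormal frame in the tangent plane at `i`; it is `1` or `-1`.
  obtain ⟨δ, hδ⟩ : ∃ δ, δ = p * q' - q * p' := ⟨_, rfl⟩
  have hδ2 : δ ^ 2 = 1 := by
    rw [hδ]
    linear_combination (-(p' ^ 2 + q' ^ 2)) * f3 - f5 - (p * p' + q * q') * (-1) * f4
  have hδ3 : δ = 1 ∨ δ = -1 := by rwa [← mul_self_eq_one_iff, ← sq]
  have hp' : p' = -q * δ := by
    rw [hδ]; linear_combination p' * f3 - p * f4
  have hq' : q' = p * δ := by
    rw [hδ]; linear_combination q' * f3 - q * f4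
  refine ⟨g * rotationAboutI ψ, -δ, ?_, fun r φ => ?_⟩
  · rcases hδ3 with h | h <;> simp [h]
  apply symVec_injective
  have e1 : Real.cos (-δ * φ) = Real.cos φ := by
    rcases hδ3 with h | h <;> simp [h]
  have e2 : Real.sin (-δ * φ) = -δ * Real.sin φ := by
    rcases hδ3 with h | h <;> simp [h]
  rw [symVec_polarPt, polarVec, map_add, map_smul, map_smul, map_add, map_smul, map_smul, h0, ← hu',
    ← hv', mul_smul, symVec_smul, symVec_smul, symVec_hypPolar, vecAct_rotationAboutI _ _ rfl, e1,
    e2]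
  simp only [← map_smul, ← map_add]
  congr 2
  rw [hc, hs, hp', hq']
  ext <;> simp <;> ring

end MidpointTriple

namespace MidpointTriple
variable (T : MidpointTriple)

/-! ### The cone point -/

lemma coshDist_strip_neg {q : ℝ × ℝ} (h1 : q.1 ∈ Set.Icc (-1 : ℝ) 1) (h2 : q.2 = 0) :
    T.coshDist (T.strip (-q)) = T.coshDist (T.strip q) := by
  have key : ∀ x ∈ Set.Icc (0 : ℝ) 1,
      T.coshDist (T.strip (-x, 0)) = T.coshDist (T.strip (x, 0)) := fun x hx => by
    rw [T.strip_neg_zero hx, coshDist_rot]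
  obtain ⟨x, y⟩ := q
  obtain rfl : y = 0 := h2
  have e : -(x, (0 : ℝ)) = (-x, 0) := by simp
  rw [e]
  rcases le_total 0 x with h | h
  · exact key x ⟨h, h1.2⟩
  · have := key (-x) ⟨by linarith, by linarith [h1.1]⟩
    rw [neg_neg] at this
    exact this.symm

/-- The hyperbolic cosine of the distance from the cone point. -/
def coneDist (q : ℝ × ℝ) : ℝ := T.coshDist (T.strip (if 0 ≤ q.2 then q else -q))

lemma centralBox_mem_closedBox {q : ℝ × ℝ} (hq : q ∈ centralBox) (h : 0 ≤ q.2) :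
    q ∈ closedBox := by
  obtain ⟨⟨h1, h2⟩, -, h4⟩ := hq
  exact ⟨⟨by linarith, by linarith⟩, h, by linarith⟩

lemma coneDist_neg {q : ℝ × ℝ} (hq : q ∈ centralBox) : T.coneDist (-q) = T.coneDist q := by
  have h1 : q.1 ∈ Set.Icc (-1 : ℝ) 1 := ⟨by linarith [hq.1.1], by linarith [hq.1.2]⟩
  simp only [coneDist, Prod.snd_neg]
  rcases lt_trichotomy q.2 0 with h | h | h
  · rw [if_pos (by linarith), if_neg (by linarith)]
  · rw [if_pos (by linarith), if_pos (by linarith), T.coshDist_strip_neg h1 h]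
  · rw [if_neg (by linarith), if_pos (by linarith), neg_neg]

lemma continuousOn_coneDist : ContinuousOn T.coneDist centralBox := by
  have hstrip : ContinuousOn (fun q => T.coshDist (T.strip q)) closedBox :=
    T.continuous_coshDist.comp_continuousOn T.continuousOn_strip
  have : T.coneDist = fun q : ℝ × ℝ => if 0 ≤ q.2 then T.coshDist (T.strip q) else
      T.coshDist (T.strip (-q)) := by
    funext q; simp only [coneDist]; split_ifs <;> rfl
  rw [this]
  refine ContinuousOn.if ?_ ?_ ?_
  · rintro q ⟨hq, hfr⟩
    have h0 : (0 : ℝ) = q.2 := frontier_le_subset_eq continuous_const continuous_snd hfr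
    exact (T.coshDist_strip_neg ⟨by linarith [hq.1.1], by linarith [hq.1.2]⟩ h0.symm).symm
  · refine hstrip.mono ?_
    rintro q ⟨hq, hcl⟩
    rw [(isClosed_le continuous_const continuous_snd).closure_eq] at hcl
    exact centralBox_mem_closedBox hq hcl
  · refine hstrip.comp continuousOn_neg ?_
    rintro q ⟨hq, hcl⟩
    refine centralBox_mem_closedBox (neg_mem_centralBox hq) ?_
    have : q.2 ≤ 0 := closure_minimal (fun p hp => (not_le.1 hp).le)
      (isClosed_le continuous_snd continuous_const) hcl
    simpa using this

lemma isOpen_centralBox : IsOpen centralBox := isOpen_Ioo.prod isOpen_Ioo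

lemma torusProj_injOn_centralBox : Set.InjOn torusProj centralBox := by
  refine (torusProj_injOn_box (u := -1 / 2) (v := -1 / 2)).mono ?_
  rintro q ⟨⟨h1, h2⟩, h3, h4⟩
  exact ⟨⟨h1.le, by linarith⟩, h3.le, by linarith⟩

/-- The point reflection of the torus is an isometry. -/
lemma exists_dev_neg {i : TorusChart} (hi : i ≠ .square) : ∃ g : SL(2, ℝ), ∀ w ∈ i.box,
    ∃ w' ∈ i.box, torusProj w' = torusProj (-w) ∧ T.dev i w' = g • T.dev i w := by
  cases i with
  | square => exact absurd rfl hi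
  | left =>
    refine ⟨halfTurn T.m, fun w hw => ⟨(-w.1, 1 - w.2), ?_, ?_, ?_⟩⟩
    · obtain ⟨⟨h1, h2⟩, h3, h4⟩ := hw
      simp only [TorusChart.corner] at h1 h2 h3 h4
      refine ⟨⟨?_, ?_⟩, ?_, ?_⟩ <;> simp only [TorusChart.corner] <;> linarith
    · exact torusProj_eq_iff.2 ⟨⟨0, by simp⟩, -1, by simp; ring⟩
    · exact T.strip_neg (openBox_subset (T.box_subset_dev_source .left hw))
  | bottom =>
    refine ⟨halfTurn T.n, fun w hw => ⟨(1 - w.1, -w.2), ?_, ?_, ?_⟩⟩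
    · obtain ⟨⟨h1, h2⟩, h3, h4⟩ := hw
      simp only [TorusChart.corner] at h1 h2 h3 h4
      refine ⟨⟨?_, ?_⟩, ?_, ?_⟩ <;> simp only [TorusChart.corner] <;> linarith
    · exact torusProj_eq_iff.2 ⟨⟨-1, by simp; ring⟩, 0, by simp⟩
    · have h := T.box_subset_dev_source .bottom hw
      have h' : w.swap ∈ openBox := by simpa [dev, stripHomeo_source] using h
      have e := T.swap.strip_neg (openBox_subset h')
      rw [dev_bottom, dev_bottom]
      exact e

/-- Seen from the bottom chart, the reflected second copy is the image of the second copy under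
`NJM`, the rotation about the vertex by `-halfAngle`. -/
lemma dev_bottom_neg {q : ℝ × ℝ} (h1 : q.1 ∈ Set.Icc (-1 : ℝ) 0) (h2 : q.2 ∈ Set.Icc (0 : ℝ) 1) :
    T.dev .bottom (-q) = halfTurn T.n • halfTurn T.j • halfTurn T.m • T.strip q := by
  have hx : 1 + q.1 ∈ Set.Icc (0 : ℝ) 1 := ⟨by linarith [h1.1], by linarith [h1.2]⟩
  have e1 := T.strip_sub_one (q := (1 + q.1, q.2)) hx h2
  simp only [add_sub_cancel_left] at e1
  rw [show q = (q.1, q.2) from rfl, e1, halfTurn_smul_halfTurn_smul, halfTurn_smul_halfTurn_smul,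
    dev_bottom, ← T.swap_strip (q := (1 + q.1, q.2)) hx.1 h2.1]
  have e2 := T.swap.strip_neg (q := (q.2, 1 + q.1))
    ⟨⟨by linarith [h2.1], h2.2⟩, hx⟩
  simp only [sub_add_cancel_left] at e2
  exact e2

namespace IsSectorLift
variable {T} {R : ℝ} {f : ℝ × ℝ → ℝ × ℝ} (hf : T.IsSectorLift R f)
include hf

lemma coneDist_coneLift {r : ℝ} (hr : r ∈ Set.Icc 0 R) (φ : ℝ) :
    T.coneDist (T.coneLift f (r, φ)) = Real.cosh r := by
  obtain ⟨q, hq, h, h1⟩ := hf.exists_coneLift_eq hr φ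
  have hd : T.coneDist q = Real.cosh r := by rw [coneDist, if_pos hq.2.1, h]
  rcases h1 with h1 | h1
  · rw [h1, hd]
  · rw [h1, T.coneDist_neg (nearBox_subset_centralBox hq), hd]

/-- Balls about the apex correspond to sublevel sets of the continuous function `coneDist`, whence
their images are open. -/
lemma image_coneLift {ε : ℝ} (hε : ε ∈ Set.Ioc 0 R) :
    T.coneLift f '' (Set.Ico 0 ε ×ˢ Set.univ) =
      centralBox ∩ T.coneDist ⁻¹' Set.Iio (Real.cosh ε) := by
  ext q
  constructor
  · rintro ⟨⟨r, φ⟩, ⟨⟨h1, h2⟩, -⟩, rfl⟩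
    have hr : r ∈ Set.Icc 0 R := ⟨h1, h2.le.trans hε.2⟩
    refine ⟨hf.coneLift_mem hr φ, ?_⟩
    rw [Set.mem_preimage, hf.coneDist_coneLift hr, Set.mem_Iio]
    exact Real.cosh_strictMonoOn h1 hε.1.le h2
  · have key : ∀ q ∈ closedBox, T.coshDist (T.strip q) < Real.cosh ε →
        ∃ r ∈ Set.Ico 0 ε, ∃ φ, T.coneLift f (r, φ) = q := by
      intro q hq hd
      obtain ⟨r, φ, hr, hφ, h⟩ := T.exists_polarPt_eq_strip hq
      rw [← h, coshDist_polarPt] at hd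
      have hrε : r < ε := (Real.cosh_strictMonoOn.lt_iff_lt hr hε.1.le).1 hd
      have hrR : r ∈ Set.Icc 0 R := ⟨hr, hrε.le.trans hε.2⟩
      exact ⟨r, ⟨hr, hrε⟩, φ, by
        rw [hf.coneLift_eq hrR hφ, hf.eq_of_strip_eq ⟨hrR, hφ⟩ hq h.symm]⟩
    rintro ⟨hq, hd⟩
    simp only [Set.mem_preimage, Set.mem_Iio, coneDist] at hd
    split_ifs at hd with h0
    · obtain ⟨r, hr, φ, h⟩ := key q (centralBox_mem_closedBox hq h0) hd
      exact ⟨(r, φ), ⟨hr, trivial⟩, h⟩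
    · obtain ⟨r, hr, φ, h⟩ := key (-q) (centralBox_mem_closedBox (neg_mem_centralBox hq)
        (by simp only [Prod.snd_neg]; linarith)) hd
      refine ⟨(r, φ + (1 : ℤ) * T.halfAngle), ⟨hr, trivial⟩, ?_⟩
      rw [coneLift_add, h]; simp

lemma isOpen_image_coneLift {ε : ℝ} (hε : ε ∈ Set.Ioc 0 R) :
    IsOpen (T.coneLift f '' (Set.Ico 0 ε ×ˢ Set.univ)) := by
  rw [hf.image_coneLift hε]
  exact T.continuousOn_coneDist.isOpen_inter_preimage isOpen_centralBox isOpen_Iio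

lemma coneLift_ne_zero {r : ℝ} (hr : r ∈ Set.Ioc 0 R) (φ : ℝ) : T.coneLift f (r, φ) ≠ 0 := by
  intro h
  have hr' : r ∈ Set.Icc 0 R := ⟨hr.1.le, hr.2⟩
  have h1 := hf.coneDist_coneLift hr' φ
  have hR : 0 ≤ R := hr.1.le.trans hr.2
  rw [h, ← hf.coneLift_zero hR 0, hf.coneDist_coneLift ⟨le_rfl, hR⟩] at h1
  exact hr.1.ne (Real.cosh_strictMonoOn.injOn (Set.self_mem_Ici) hr.1.le h1)

/-- In suitable coordinates of the torus the cone is locally isometric to the torus. -/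
lemma exists_eventually_dev_eq_of_mem_Ico {r φ : ℝ} (hr : r ∈ Set.Ioo 0 R)
    (hφ : φ ∈ Set.Ico 0 T.halfAngle) : ∃ i : TorusChart, i ≠ .square ∧ ∀ᶠ q in 𝓝 (r, φ),
      T.coneLift f q ∈ i.box ∧ T.dev i (T.coneLift f q) = T.polarPt q := by
  have hτ := T.halfAngle_pos
  rcases hφ.1.eq_or_lt with h | h
  · subst h
    -- Angle `0` is the bottom side, so both signs of the angle must be covered. For negative angles
    -- the lift is the reflection of a point of the second copy, and `dev_bottom_neg` undoes the
    -- rotation in `polarPt_add`.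
    refine ⟨.bottom, by simp, ?_⟩
    have hc : ContinuousAt (T.coneLift f) (r, 0) :=
      hf.continuousOn_coneLift.continuousAt (prod_mem_nhds (Icc_mem_nhds hr.1 hr.2) Filter.univ_mem)
    have h0 : 0 < (T.coneLift f (r, 0)).1 := by
      rw [T.coneLift_of_mem_Ico f hφ]; exact (hf.apply_angle_zero ⟨hr.1, hr.2.le⟩).1
    have hpos : ∀ᶠ q in 𝓝 (r, (0 : ℝ)), 0 < (T.coneLift f q).1 :=
      (continuous_fst.continuousAt.comp hc).eventually (lt_mem_nhds h0)
    filter_upwards [hpos, prod_mem_nhds (Ioo_mem_nhds hr.1 hr.2)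
      (Ioo_mem_nhds (neg_lt_zero.2 hτ) hτ)]
    rintro ⟨s, ψ⟩ hw ⟨hs, hψ⟩
    have hs' : s ∈ Set.Icc 0 R := ⟨hs.1.le, hs.2.le⟩
    obtain ⟨⟨b1, b2⟩, b3, b4⟩ := hf.coneLift_mem hs' ψ
    refine ⟨⟨⟨hw, ?_⟩, ?_, ?_⟩, ?_⟩
    · simp only [TorusChart.corner]; linarith
    · simpa [TorusChart.corner] using b3
    · simp only [TorusChart.corner]; linarith
    rcases le_or_gt 0 ψ with h | h
    · rw [T.coneLift_of_mem_Ico f ⟨h, hψ.2⟩] at hw ⊢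
      obtain ⟨e1, e2⟩ := hf (s, ψ) ⟨hs', h, hψ.2.le⟩
      rw [dev_bottom, T.swap_strip hw.le e1.2.1, e2]
    · have e3 := T.coneLift_add f s ψ 1
      simp only [Int.cast_one, one_mul, zpow_one, neg_smul, one_smul] at e3
      have hψ' : ψ + T.halfAngle ∈ Set.Ico 0 T.halfAngle := ⟨by linarith [hψ.1], by linarith⟩
      rw [T.coneLift_of_mem_Ico f hψ'] at e3
      rw [← neg_neg (T.coneLift f (s, ψ)), ← e3]
      obtain ⟨e1, e2⟩ := hf (s, ψ + T.halfAngle) ⟨hs', hψ'.1, hψ'.2.le⟩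
      have hx : (f (s, ψ + T.halfAngle)).1 < 0 := by
        rw [e3, Prod.fst_neg]; exact neg_lt_zero.2 hw
      rw [T.dev_bottom_neg ⟨by linarith [e1.1.1], hx.le⟩ ⟨e1.2.1, by linarith [e1.2.2]⟩, e2,
        polarPt_add, halfTurn_smul_halfTurn_smul, halfTurn_smul_halfTurn_smul,
        halfTurn_smul_halfTurn_smul]
  -- Inside the sector the lift may cross the left side `x = 0`, which the left chart contains.
  · refine ⟨.left, by simp, ?_⟩
    filter_upwards [prod_mem_nhds (Ioo_mem_nhds hr.1 hr.2) (Ioo_mem_nhds h hφ.2)]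
    rintro ⟨s, ψ⟩ ⟨hs, hψ⟩
    have hs' : s ∈ Set.Icc 0 R := ⟨hs.1.le, hs.2.le⟩
    rw [T.coneLift_of_mem_Ico f ⟨hψ.1.le, hψ.2⟩]
    obtain ⟨⟨⟨b1, b2⟩, -, b4⟩, e2⟩ := hf (s, ψ) ⟨hs', hψ.1.le, hψ.2.le⟩
    have h3 := hf.snd_pos ⟨hs.1, hs.2.le⟩ hψ
    refine ⟨⟨⟨b1, ?_⟩, h3, ?_⟩, by rw [dev_left, e2]⟩
    · simp only [TorusChart.corner]; linarith
    · simp only [TorusChart.corner]; linarith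

/-- A rotation reduces the angle to the first sector; for an odd number of steps the point
reflection of the torus, an isometry by `exists_dev_neg`, enters too. -/
lemma exists_eventually_dev_eq {g : SL(2, ℝ)} {ε : ℝ} (hg : ∀ r φ, T.polarPt (r, φ) =
      g • hypPolar (r, ε * φ)) {r : ℝ} (hr : r ∈ Set.Ioo 0 R) (φ : ℝ) :
    ∃ (i : TorusChart) (g : SL(2, ℝ)), ∀ᶠ q in 𝓝 (r, φ), ∃ w ∈ i.box,
      torusProj w = torusProj (T.coneLift f q) ∧ T.dev i w = g • hypPolar (q.1, ε * q.2) := by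
  obtain ⟨ψ, hψ, n, rfl⟩ := T.exists_add_int_mul_halfAngle φ
  obtain ⟨i, hi, h⟩ := hf.exists_eventually_dev_eq_of_mem_Ico hr hψ
  have hc : Continuous fun q : ℝ × ℝ => (q.1, q.2 - n * T.halfAngle) := by fun_prop
  have hc' := hc.continuousAt (x := (r, ψ + n * T.halfAngle))
  simp only [ContinuousAt, add_sub_cancel_right] at hc'
  have h' := hc'.eventually h
  have hL : ∀ q : ℝ × ℝ, T.coneLift f q =
      (-1 : ℝ) ^ n • T.coneLift f (q.1, q.2 - n * T.halfAngle) := fun q => by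
    rw [← coneLift_add, sub_add_cancel]
  have hP : ∀ q : ℝ × ℝ, T.polarPt (q.1, q.2 - n * T.halfAngle) =
      (g * rotationAboutI (-(ε * (n * T.halfAngle)))) • hypPolar (q.1, ε * q.2) := fun q => by
    rw [hg, mul_smul, ← hypPolar_add]; congr 3; ring
  obtain ⟨s, hs⟩ := T.exists_dev_neg hi
  rcases Int.even_or_odd n with hn | hn
  · refine ⟨i, _, h'.mono fun q hq => ⟨_, hq.1, ?_, hq.2.trans (hP q)⟩⟩
    rw [hL q, hn.neg_one_zpow, one_smul]
  · refine ⟨i, s * (g * rotationAboutI (-(ε * (n * T.halfAngle)))), h'.mono fun q hq => ?_⟩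
    obtain ⟨w, hw, h1, h2⟩ := hs _ hq.1
    refine ⟨w, hw, ?_, ?_⟩
    · rw [h1, hL q, hn.neg_one_zpow, neg_one_smul]
    · rw [h2, hq.2, hP, ← mul_smul]

end IsSectorLift

lemma hasConePoint :
    letI := T.chartedSpace
    HasConePoint (0 : Torus) (2 * T.halfAngle) := by
  let := T.chartedSpace
  have := T.hasGroupoid
  obtain ⟨R, f, hR, hf⟩ := T.exists_isSectorLift
  obtain ⟨g, ε, hε, hg⟩ := T.exists_polarPt_eq_smul
  have hε2 : ε * ε = 1 := by rcases hε with h | h <;> simp [h]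
  -- Reversing the angle when `ε = -1` makes the cone chart agree with `hypPolar` up to an
  -- orientation-preserving isometry.
  set σ : ℝ × ℝ → ℝ × ℝ := fun q => (q.1, ε * q.2) with hσ
  have hσc : Continuous σ := by fun_prop
  have hσσ : ∀ q, σ (σ q) = q := fun q => by
    simp only [hσ, ← mul_assoc, hε2, one_mul]
  have hne : ∀ r ∈ Set.Ioo 0 R, ∀ φ, torusProj (T.coneLift f (σ (r, φ))) ≠ 0 := by
    intro r hr φ h
    rw [← torusProj_zero] at h
    refine hf.coneLift_ne_zero ⟨hr.1, hr.2.le⟩ (ε * φ)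
      (torusProj_injOn_centralBox (hf.coneLift_mem ⟨hr.1.le, hr.2.le⟩ _) ?_ h)
    constructor <;> norm_num
  have hcont : ContinuousOn (fun q => torusProj (T.coneLift f (σ q))) (Set.Icc 0 R ×ˢ Set.univ) :=
    continuous_torusProj.comp_continuousOn
      (hf.continuousOn_coneLift.comp hσc.continuousOn fun q hq => ⟨hq.1, trivial⟩)
  refine ⟨R, fun q => torusProj (T.coneLift f (σ q)), hR, hcont.mono
    (Set.prod_mono Set.Ico_subset_Icc_self le_rfl), fun φ => ?_, hne, ?_, ?_, ?_⟩
  · simp only [hσ]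
    rw [hf.coneLift_zero hR.le, torusProj_zero]
  · intro r hr s hs φ ψ
    rw [torusProj_injOn_centralBox.eq_iff (hf.coneLift_mem ⟨hr.1.le, hr.2.le⟩ _)
      (hf.coneLift_mem ⟨hs.1.le, hs.2.le⟩ _)]
    rw [hf.coneLift_eq_iff ⟨hr.1, hr.2.le⟩ ⟨hs.1, hs.2.le⟩]
    refine and_congr_right fun _ => ?_
    rcases hε with rfl | rfl
    · simp
    · constructor
      · rintro ⟨k, hk⟩; exact ⟨-k, by push_cast; linarith⟩
      · rintro ⟨k, hk⟩; exact ⟨-k, by push_cast; linarith⟩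
  · intro ε' hε'
    have : (fun q => torusProj (T.coneLift f (σ q))) '' (Set.Ico 0 ε' ×ˢ Set.univ) =
        torusProj '' (T.coneLift f '' (Set.Ico 0 ε' ×ˢ Set.univ)) := by
      rw [Set.image_image]
      ext p
      constructor
      · rintro ⟨q, hq, rfl⟩; exact ⟨σ q, ⟨hq.1, trivial⟩, rfl⟩
      · rintro ⟨q, hq, rfl⟩; exact ⟨σ q, ⟨hq.1, trivial⟩, by simp only [hσσ]⟩
    rw [this]
    exact isOpenMap_torusProj _ (hf.isOpen_image_coneLift hε')
  · rintro r hr φ e he ⟨hp, hpe⟩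
    obtain ⟨i, g', hi⟩ := hf.exists_eventually_dev_eq hg hr (ε * φ)
    have hi' := (hσc.continuousAt (x := (r, φ))).eventually hi
    have hP : ContinuousAt (fun q => torusProj (T.coneLift f (σ q))) (r, φ) :=
      hcont.continuousAt (prod_mem_nhds (Icc_mem_nhds hr.1 hr.2) Filter.univ_mem)
    have hbase : (⟨_, hp⟩ : PuncturedTorus) ∈ (T.chart i).source := by
      obtain ⟨w, hw, h1, -⟩ := hi'.self_of_nhds
      rw [chart_source]
      exact TorusChart.mem_base_iff.2 ⟨w, hw, h1⟩
    have hchart : T.chart i ∈ hypGroupoid.maximalAtlas PuncturedTorus :=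
      hypGroupoid.subset_maximalAtlas ⟨i, rfl⟩
    obtain ⟨s, hs⟩ := exists_smul_of_symm_trans_mem
      (hypGroupoid.compatible_of_mem_maximalAtlas hchart he) hbase hpe
    rw [nhds_subtype_eq_comap, Filter.eventually_comap] at hs
    have hs' := hP.eventually hs
    refine ⟨s * g', ?_⟩
    filter_upwards [hi', hs', prod_mem_nhds (Ioo_mem_nhds hr.1 hr.2) Filter.univ_mem]
    rintro ⟨t, ψ⟩ ⟨w, hw, h1, h2⟩ h3 ⟨ht, -⟩
    refine ⟨hne t ht ψ, ?_⟩
    rw [h3 ⟨_, hne t ht ψ⟩ rfl, T.chart_apply hw h1.symm, h2, mul_smul]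
    congr 2
    exact congrArg hypPolar (hσσ (t, ψ))

end MidpointTriple

end

theorem mainTheorem2 (ξ η : SL(2, ℝ)) (θ : ℝ) (hθ : IsEllipticWithAngle (ξ * η * ξ⁻¹ * η⁻¹) θ) :
    ∃ (S : SingularHyperbolicStructure Torus 0 θ) (ρ : TorusGroup →* SL(2, ℝ)),
      S.HasHolonomy ρ ∧ ρ genX = ξ ∧ ρ genY = η ∧ ρ genK = ξ * η * ξ⁻¹ * η⁻¹ := by
  obtain ⟨htr, rfl⟩ := hθ
  obtain ⟨T, hξ, hη, hT⟩ := exists_midpointTriple ξ η htr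
  have hθ : 2 * T.halfAngle = 2 * Real.arccos
      (-((ξ * η * ξ⁻¹ * η⁻¹ : SL(2, ℝ)) : Matrix (Fin 2) (Fin 2) ℝ).trace / 2) := by
    -- From `tr γ = 2 - 4D` one gets `-(tr γ)/2 = 2D - 1`, the cosine of `halfAngle`.
    rw [hT, MidpointTriple.halfAngle]; congr 2; ring
  have hX : FreeGroup.lift ![ξ, η] genX = ξ := by simp [genX]
  have hY : FreeGroup.lift ![ξ, η] genY = η := by simp [genY]
  refine ⟨⟨T.chartedSpace, T.hasGroupoid, hθ ▸ T.hasConePoint⟩, FreeGroup.lift ![ξ, η], ?_, hX, hY,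
    by simp only [genK, map_mul, map_inv, hX, hY]⟩
  exact MidpointTriple.isHolonomy ⟨fun z => by rw [hX, hξ], fun z => by rw [hY, hη]⟩
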